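/- \textbf{Conventions.} A graph $Q=(Q^0,Q^1,r,s)$ is a directed graph (loops and multiple edges allowed); it is countable if $Q^0$ and $Q^1$ are countable. A vertex $v$ is a source if $r^{-1}(v)=\emptyset$, a sink if $s^{-1}(v)=\emptyset$, an infinite emitter if $s^{-1}(v)$ is infinite, an infinite receiver if $r^{-1}(v)$ is infinite, and regular if it is neither a source nor an infinite receiver. A cycle is a path $\alpha=\alpha_1\cdots\alpha_n$ ($n\ge 1$, $s(\alpha_i)=r(\alpha_{i+1})$) with $r(\alpha_1)=s(\alpha_n)$ and pairwise distinct edges; an entry for $\alpha$ is an edge $a$ with $r(a)=r(\alpha_i)$ and $a\ne\alpha_i$ for some $i$. A measure is localizable if it is semifinite and every family of measurable sets has an essential supremum. A hermitian idempotent in a unital complex Banach algebra $A$ is an $e\in A$ with $e^2=e$ and $\|\exp(i\lambda e)\|\le 1$ for all $\lambda\in\mathbb R$. A Cuntz--Krieger $Q$-family in $A$ consists of contractions $S_a,T_a$ ($a\in Q^1$) and pairwise orthogonal hermitian idempotents $E_v$ ($v\in Q^0$) such that $S_aT_aS_a=S_a$, $T_aS_aT_a=T_a$, the elements $S_aT_a$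 and $T_aS_a$ are hermitian idempotents, $E_{r(a)}S_a=S_aE_{s(a)}=S_a$, $T_aE_{r(a)}=E_{s(a)}T_a=T_a$, $T_aS_b=\delta_{a,b}E_{s(b)}$, and $E_v=\sum_{a\in r^{-1}(v)}S_aT_a$ for every regular vertex $v$. The Leavitt path algebra $L_Q$ is the universal complex (not necessarily unital) algebra generated by $s_a,t_a,e_v$ subject to $e_ve_w=\delta_{v,w}e_v$, $e_{r(a)}s_a=s_ae_{s(a)}=s_a$, $t_ae_{r(a)}=e_{s(a)}t_a=t_a$, $t_as_b=\delta_{a,b}e_{s(b)}$, and $e_v=\sum_{a\in r^{-1}(v)}s_at_a$ for $v$ regular. A representation of $L_Q$ on an $L^p$-space is a homomorphism from $L_Q$ to the bounded operators on it that sends $(s,t,e)$ to a Cuntz--Krieger $Q$-family. $\mathcal O^p(Q)$ is the completion of $L_Q$ in the norm $\|x\|=\sup_\varphi\|\varphi(x)\|$, where $\varphi$ runs over all representations of $L_Q$ on $L^p$-spaces. A Cuntz--Krieger $Q$-family $(S,T,E)$ in $\mathcal B(L^p(\mu))$ induces a canonical contractive homomorphism $\pi\colon\mathcal O^p(Q)\to\mathcal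 B(L^p(\mu))$ with $\pi(s_a)=S_a$, $\pi(t_a)=T_a$, $\pi(e_v)=E_v$. \textbf{Lemma.} Let $p\in[1,\infty)\setminus\{2\}$, let $Q$ be a countable graph, let $(X,\mathcal B,\mu)$ be a localizable measure space, let $(S,T,E)$ be a Cuntz--Krieger $Q$-family in $\mathcal B(L^p(\mu))$, and let $\pi\colon\mathcal O^p(Q)\to\mathcal B(L^p(\mu))$ be its canonical contractive homomorphism. Then there exist a countable graph $Q'$ with no sources, sinks, infinite emitters or infinite receivers, a localizable measure space $(Y,\mathcal C,\nu)$, a Cuntz--Krieger $Q'$-family $(S',T',E')$ in $\mathcal B(L^p(\nu))$ with canonical contractive homomorphism $\pi'\colon\mathcal O^p(Q')\to\mathcal B(L^p(\nu))$, and isometric homomorphisms $\phi\colon\mathcal O^p(Q)\to\mathcal O^p(Q')$ and $\sigma\colon\mathcal B(L^p(\mu))\to\mathcal B(L^p(\nu))$ such that $$\sigma\circ\pi=\pi'\circ\phi .$$ Moreover, $\sigma$ is a corner map: there are a linear isometry $i\colon L^p(\mu)\to L^p(\nu)$ and a linear contraction $j\colon L^p(\nu)\to L^p(\mu)$ with $ji=\mathrm{id}$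 and $ij$ a hermitian idempotent, such that $\sigma(d)=i\,d\,j$ for all $d\in\mathcal B(L^p(\mu))$. Finally, if every cycle of $Q$ has an entry, then every cycle of $Q'$ has an entry. -/

import Mathlib

open scoped ENNReal

universe u

noncomputable section

namespace LpGraph

/-! ### Directed graphs -/

/-- A directed graph `(V, E, r, s)`; loops and parallel edges are allowed. -/
structure DirGraph : Type (u + 1) where
  V : Type u
  E : Type u
  r : E → V
  s : E → V

namespace DirGraph

variable (Q : DirGraph.{u})

/-- The edges with range `v`. -/
def into (v : Q.V) : Set Q.E := {a | Q.r a = v}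

/-- The edges with source `v`. -/
def outOf (v : Q.V) : Set Q.E := {a | Q.s a = v}

def IsCountable : Prop := Countable Q.V ∧ Countable Q.E

def IsSource (v : Q.V) : Prop := Q.into v = ∅

def IsSink (v : Q.V) : Prop := Q.outOf v = ∅

def IsInfiniteEmitter (v : Q.V) : Prop := (Q.outOf v).Infinite

def IsInfiniteReceiver (v : Q.V) : Prop := (Q.into v).Infinite

/-- A vertex is regular if it is neither a source nor an infinite receiver. -/
def IsRegular (v : Q.V) : Prop := ¬ Q.IsSource v ∧ ¬ Q.IsInfiniteReceiver v

variable {Q} in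
theorem IsRegular.finite {v : Q.V} (h : Q.IsRegular v) : (Q.into v).Finite :=
  Set.not_infinite.1 h.2

/-- A cycle `α₁ α₂ ⋯ αₙ₊₁` (paths are composed from right to left, so `s (αᵢ) = r (αᵢ₊₁)`):
a closed path of positive length whose edges are pairwise distinct. -/
structure IsCycle {n : ℕ} (α : Fin (n + 1) → Q.E) : Prop where
  isPath : ∀ i : Fin n, Q.s (α i.castSucc) = Q.r (α i.succ)
  closed : Q.r (α 0) = Q.s (α (Fin.last n))
  injective : Function.Injective α

/-- Every cycle has an entry: an edge `a` with `r a = r (αᵢ)` and `a ≠ αᵢ` for some `i`. -/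
def EveryCycleHasEntry : Prop :=
  ∀ (n : ℕ) (α : Fin (n + 1) → Q.E), Q.IsCycle α →
    ∃ (a : Q.E) (i : Fin (n + 1)), Q.r a = Q.r (α i) ∧ a ≠ α i

end DirGraph

/-! ### Localizable measures -/

/-- A measure is localizable if it is semifinite and every family of measurable sets has an
essential supremum. -/
structure IsLocalizable {X : Type*} [MeasurableSpace X] (μ : MeasureTheory.Measure X) : Prop where
  semifinite : ∀ A : Set X, MeasurableSet A → μ A = ∞ →
    ∃ B ⊆ A, MeasurableSet B ∧ 0 < μ B ∧ μ B < ∞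
  exists_essSup : ∀ 𝒜 : Set (Set X), (∀ A ∈ 𝒜, MeasurableSet A) →
    ∃ H : Set X, MeasurableSet H ∧ (∀ A ∈ 𝒜, μ (A \ H) = 0) ∧
      ∀ G : Set X, MeasurableSet G → (∀ A ∈ 𝒜, μ (A \ G) = 0) → μ (H \ G) = 0

/-- The Banach algebra of bounded operators on the complex space `L^p(μ)`. -/
abbrev LpOp (p : ℝ≥0∞) [Fact (1 ≤ p)] {X : Type*} [MeasurableSpace X]
    (μ : MeasureTheory.Measure X) : Type _ :=
  MeasureTheory.Lp ℂ p μ →L[ℂ] MeasureTheory.Lp ℂ p μ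

/-! ### Hermitian idempotents and Cuntz–Krieger families in unital Banach algebras -/

section Families

variable {A : Type*} [NormedRing A] [NormedAlgebra ℂ A]

/-- A hermitian idempotent of a unital Banach algebra: `a² = a` and `‖exp(iλa)‖ ≤ 1` for all
real `λ`. -/
structure IsHermitianIdempotent (a : A) : Prop where
  idem : a * a = a
  hermitian : ∀ l : ℝ, ‖NormedSpace.exp ((Complex.I * (l : ℂ)) • a)‖ ≤ 1

/-- Cuntz–Krieger `Q`-families in a unital Banach algebra. -/
structure IsCKFamily (Q : DirGraph.{u}) (S T : Q.E → A) (E : Q.V → A) : Prop where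
  hermitian_E : ∀ v, IsHermitianIdempotent (E v)
  orthogonal_E : ∀ v w, v ≠ w → E v * E w = 0
  norm_S : ∀ a, ‖S a‖ ≤ 1
  norm_T : ∀ a, ‖T a‖ ≤ 1
  sts : ∀ a, S a * T a * S a = S a
  tst : ∀ a, T a * S a * T a = T a
  hermitian_ST : ∀ a, IsHermitianIdempotent (S a * T a)
  hermitian_TS : ∀ a, IsHermitianIdempotent (T a * S a)
  E_S : ∀ a, E (Q.r a) * S a = S a
  S_E : ∀ a, S a * E (Q.s a) = S a
  T_E : ∀ a, T a * E (Q.r a) = T a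
  E_T : ∀ a, E (Q.s a) * T a = T a
  ck1_self : ∀ a, T a * S a = E (Q.s a)
  ck1_ne : ∀ a b, a ≠ b → T a * S b = 0
  ck2 : ∀ (v : Q.V) (h : Q.IsRegular v), E v = ∑ a ∈ h.finite.toFinset, S a * T a

/-- For an idempotent `a`, `exp(za) = 1 + (exp z - 1) a`. -/
theorem exp_smul_idem [CompleteSpace A] {a : A} (h : a * a = a) (z : ℂ) :
    NormedSpace.exp (z • a) = 1 + (Complex.exp z - 1) • a := by
  have hp : ∀ n : ℕ, n ≠ 0 → a ^ n = a := by
    intro n hn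
    induction n with
    | zero => exact absurd rfl hn
    | succ k ih =>
      rcases Nat.eq_zero_or_pos k with rfl | hk
      · simp
      · rw [pow_succ, ih hk.ne', h]
  have h1 : HasSum (fun n : ℕ => ((n.factorial : ℂ)⁻¹) • (z • a) ^ n) (NormedSpace.exp (z • a)) :=
    NormedSpace.exp_series_hasSum_exp' (𝕂 := ℂ) (z • a)
  have h2 : HasSum (fun n : ℕ => ((n.factorial : ℂ)⁻¹) • z ^ n) (NormedSpace.exp z) :=
    NormedSpace.exp_series_hasSum_exp' (𝕂 := ℂ) z
  have h3 : HasSum (fun n : ℕ => if n = 0 then (1 - a) else 0) (1 - a) := by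
    simpa using hasSum_ite_eq (0 : ℕ) (1 - a)
  have h4 := h3.add (h2.smul_const a)
  have h5 : (fun n : ℕ => ((n.factorial : ℂ)⁻¹) • (z • a) ^ n) =
      fun n : ℕ => (if n = 0 then (1 - a) else 0) + (((n.factorial : ℂ)⁻¹) • z ^ n) • a := by
    funext n
    by_cases hn : n = 0
    · subst hn
      simp
    · simp [hn, smul_pow, hp n hn, smul_smul]
  rw [h5] at h1
  rw [h1.unique h4, Complex.exp_eq_exp_ℂ, sub_smul, one_smul]
  abel

theorem IsHermitianIdempotent.norm_le_one [CompleteSpace A] {a : A}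
    (h : IsHermitianIdempotent a) : ‖a‖ ≤ 1 := by
  have h0 : ‖(1 : A)‖ ≤ 1 := by simpa using h.hermitian 0
  have h1 := h.hermitian Real.pi
  rw [exp_smul_idem h.idem, mul_comm, Complex.exp_pi_mul_I] at h1
  have h2 : (2 : ℂ) • a = 1 - (1 + (-1 - 1 : ℂ) • a) := by
    have : (-1 - 1 : ℂ) = -2 := by norm_num
    rw [this, neg_smul]
    abel
  have h3 : ‖(2 : ℂ) • a‖ ≤ 1 + 1 := by
    rw [h2]
    exact (norm_sub_le _ _).trans (add_le_add h0 h1)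
  rw [norm_smul] at h3
  norm_num at h3
  linarith

end Families

/-! ### Leavitt path algebras -/

section Leavitt

/-- Generators of the Leavitt path algebra. -/
inductive LeavittGen (Q : DirGraph.{u}) : Type u
  | s (a : Q.E) : LeavittGen Q
  | t (a : Q.E) : LeavittGen Q
  | e (v : Q.V) : LeavittGen Q

open LeavittGen FreeAlgebra in
/-- The defining relations of the Leavitt path algebra. -/
inductive LeavittRel (Q : DirGraph.{u}) :
    FreeAlgebra ℂ (LeavittGen Q) → FreeAlgebra ℂ (LeavittGen Q) → Prop
  | idem (v : Q.V) : LeavittRel Q (ι ℂ (e v) * ι ℂ (e v)) (ι ℂ (e v))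
  | orth (v w : Q.V) (h : v ≠ w) : LeavittRel Q (ι ℂ (e v) * ι ℂ (e w)) 0
  | e_s (a : Q.E) : LeavittRel Q (ι ℂ (e (Q.r a)) * ι ℂ (s a)) (ι ℂ (s a))
  | s_e (a : Q.E) : LeavittRel Q (ι ℂ (s a) * ι ℂ (e (Q.s a))) (ι ℂ (s a))
  | t_e (a : Q.E) : LeavittRel Q (ι ℂ (t a) * ι ℂ (e (Q.r a))) (ι ℂ (t a))
  | e_t (a : Q.E) : LeavittRel Q (ι ℂ (e (Q.s a)) * ι ℂ (t a)) (ι ℂ (t a))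
  | ck1_self (a : Q.E) : LeavittRel Q (ι ℂ (t a) * ι ℂ (s a)) (ι ℂ (e (Q.s a)))
  | ck1_ne (a b : Q.E) (h : a ≠ b) : LeavittRel Q (ι ℂ (t a) * ι ℂ (s b)) 0
  | ck2 (v : Q.V) (h : Q.IsRegular v) :
      LeavittRel Q (ι ℂ (e v)) (∑ a ∈ h.finite.toFinset, ι ℂ (s a) * ι ℂ (t a))

/-- The universal *unital* algebra on the generators and relations of the Leavitt path algebra,
that is, the (one-dimensional) unitization of the latter. -/
abbrev UnitalLeavitt (Q : DirGraph.{u}) : Type u := RingQuot (LeavittRel Q)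

/-- A generator in the unital algebra. -/
def unitalGen {Q : DirGraph.{u}} (x : LeavittGen Q) : UnitalLeavitt Q :=
  RingQuot.mkAlgHom ℂ (LeavittRel Q) (FreeAlgebra.ι ℂ x)

/-- The Leavitt path algebra `L_Q`, the universal (not necessarily unital) complex algebra on the
generators `s_a, t_a, e_v` and their relations: the non-unital subalgebra that the generators
span in the universal unital algebra on the same generators and relations. -/
def Leavitt (Q : DirGraph.{u}) : Type u :=
  NonUnitalAlgebra.adjoin ℂ (Set.range (unitalGen (Q := Q)))

instance (Q : DirGraph.{u}) : NonUnitalRing (Leavitt Q) :=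
  inferInstanceAs (NonUnitalRing (NonUnitalAlgebra.adjoin ℂ (Set.range (unitalGen (Q := Q)))))

instance (Q : DirGraph.{u}) : Module ℂ (Leavitt Q) :=
  inferInstanceAs (Module ℂ (NonUnitalAlgebra.adjoin ℂ (Set.range (unitalGen (Q := Q)))))

namespace Leavitt

variable {Q : DirGraph.{u}}

def gen (x : LeavittGen Q) : Leavitt Q :=
  ⟨unitalGen x, NonUnitalAlgebra.subset_adjoin ℂ ⟨x, rfl⟩⟩

def s (a : Q.E) : Leavitt Q := gen (.s a)

def t (a : Q.E) : Leavitt Q := gen (.t a)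

def e (v : Q.V) : Leavitt Q := gen (.e v)

/-- The values on the generators of the homomorphism attached to a Cuntz–Krieger family. -/
def genMap {A : Type*} (S T : Q.E → A) (E : Q.V → A) : LeavittGen Q → A
  | .s a => S a
  | .t a => T a
  | .e v => E v

section Lift

variable {A : Type*} [NormedRing A] [NormedAlgebra ℂ A] {S T : Q.E → A} {E : Q.V → A}

theorem lift_rel (h : IsCKFamily Q S T E) ⦃x y : FreeAlgebra ℂ (LeavittGen Q)⦄
    (hxy : LeavittRel Q x y) :
    FreeAlgebra.lift ℂ (genMap S T E) x = FreeAlgebra.lift ℂ (genMap S T E) y := by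
  cases hxy with
  | idem v => simpa [genMap] using (h.hermitian_E v).idem
  | orth v w hvw => simpa [genMap] using h.orthogonal_E v w hvw
  | e_s a => simpa [genMap] using h.E_S a
  | s_e a => simpa [genMap] using h.S_E a
  | t_e a => simpa [genMap] using h.T_E a
  | e_t a => simpa [genMap] using h.E_T a
  | ck1_self a => simpa [genMap] using h.ck1_self a
  | ck1_ne a b hab => simpa [genMap] using h.ck1_ne a b hab
  | ck2 v hv => simpa [genMap, map_sum] using h.ck2 v hv

/-- The homomorphism `L_Q → A` that a Cuntz–Krieger family in `A` induces. -/
def lift (h : IsCKFamily Q S T E) : Leavitt Q →ₙₐ[ℂ] A :=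
  let f : UnitalLeavitt Q →ₐ[ℂ] A :=
    RingQuot.liftAlgHom ℂ ⟨FreeAlgebra.lift ℂ (genMap S T E), lift_rel h⟩
  { toFun := fun x => f x.1
    map_zero' := map_zero f
    map_add' := fun x y => map_add f x.1 y.1
    map_mul' := fun x y => map_mul f x.1 y.1
    map_smul' := fun c x => map_smul f c x.1 }

theorem lift_gen (h : IsCKFamily Q S T E) (x : LeavittGen Q) :
    lift h (gen x) = genMap S T E x := by
  change RingQuot.liftAlgHom ℂ ⟨FreeAlgebra.lift ℂ (genMap S T E), lift_rel h⟩
    (RingQuot.mkAlgHom ℂ (LeavittRel Q) (FreeAlgebra.ι ℂ x)) = _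
  rw [RingQuot.liftAlgHom_mkAlgHom_apply, FreeAlgebra.lift_ι_apply]

/-- A representation of `L_Q` on a unital Banach algebra: a homomorphism that sends the
generators to a Cuntz–Krieger family. -/
def IsRepresentation (φ : Leavitt Q →ₙₐ[ℂ] A) : Prop :=
  IsCKFamily Q (fun a => φ (s a)) (fun a => φ (t a)) (fun v => φ (e v))

theorem isRepresentation_lift (h : IsCKFamily Q S T E) : IsRepresentation (lift h) := by
  have h1 : (fun a => lift h (s a)) = S := funext fun a => lift_gen h _
  have h2 : (fun a => lift h (t a)) = T := funext fun a => lift_gen h _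
  have h3 : (fun v => lift h (e v)) = E := funext fun a => lift_gen h _
  unfold IsRepresentation
  rw [h1, h2, h3]
  exact h

theorem norm_gen_le [CompleteSpace A] {φ : Leavitt Q →ₙₐ[ℂ] A} (h : IsRepresentation φ)
    (x : LeavittGen Q) : ‖φ (gen x)‖ ≤ 1 := by
  cases x with
  | s a => exact h.norm_S a
  | t a => exact h.norm_T a
  | e v => exact (h.hermitian_E v).norm_le_one

end Lift

end Leavitt

end Leavitt

/-! ### The `L^p`-operator graph algebra -/

section Algebra

variable (p : ℝ≥0∞) [Fact (1 ≤ p)] (Q : DirGraph.{u})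

/-- The norms `‖φ x‖`, where `φ` runs over the representations of `L_Q` on `L^p`-spaces. -/
def repNorms (x : Leavitt Q) : Set ℝ :=
  {c | ∃ (X : Type u) (_ : MeasurableSpace X) (μ : MeasureTheory.Measure X)
    (φ : Leavitt Q →ₙₐ[ℂ] LpOp p μ), Leavitt.IsRepresentation φ ∧ c = ‖φ x‖}

/-- `‖x‖ = sup {‖φ x‖ : φ a representation of L_Q on an L^p-space}`. -/
def repNorm (x : Leavitt Q) : ℝ := sSup (repNorms p Q x)

theorem bddAbove_repNorms (x : Leavitt Q) : BddAbove (repNorms p Q x) := by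
  suffices H : ∃ C : ℝ, ∀ (X : Type u) (_ : MeasurableSpace X) (μ : MeasureTheory.Measure X)
      (φ : Leavitt Q →ₙₐ[ℂ] LpOp p μ), Leavitt.IsRepresentation φ → ‖φ x‖ ≤ C by
    obtain ⟨C, hC⟩ := H
    refine ⟨C, ?_⟩
    rintro _ ⟨X, mX, μ, φ, hφ, rfl⟩
    exact hC X mX μ φ hφ
  obtain ⟨x, hx⟩ := x
  induction hx using NonUnitalAlgebra.adjoin_induction with
  | mem x hx =>
    obtain ⟨y, rfl⟩ := hx
    exact ⟨1, fun X mX μ φ hφ => Leavitt.norm_gen_le hφ y⟩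
  | zero =>
    refine ⟨0, fun X mX μ φ hφ => ?_⟩
    have : φ ⟨0, zero_mem _⟩ = 0 := map_zero φ
    rw [this, norm_zero]
  | add x y hx hy h1 h2 =>
    obtain ⟨C, hC⟩ := h1
    obtain ⟨D, hD⟩ := h2
    refine ⟨C + D, fun X mX μ φ hφ => ?_⟩
    have : φ ⟨x + y, add_mem hx hy⟩ = φ ⟨x, hx⟩ + φ ⟨y, hy⟩ := map_add φ ⟨x, hx⟩ ⟨y, hy⟩
    rw [this]
    exact (norm_add_le _ _).trans (add_le_add (hC X mX μ φ hφ) (hD X mX μ φ hφ))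
  | mul x y hx hy h1 h2 =>
    obtain ⟨C, hC⟩ := h1
    obtain ⟨D, hD⟩ := h2
    refine ⟨C * D, fun X mX μ φ hφ => ?_⟩
    have : φ ⟨x * y, mul_mem hx hy⟩ = φ ⟨x, hx⟩ * φ ⟨y, hy⟩ := map_mul φ ⟨x, hx⟩ ⟨y, hy⟩
    rw [this]
    have hC' := hC X mX μ φ hφ
    exact (norm_mul_le _ _).trans (mul_le_mul hC' (hD X mX μ φ hφ) (norm_nonneg _)
      ((norm_nonneg _).trans hC'))
  | smul r x hx h1 =>
    obtain ⟨C, hC⟩ := h1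
    refine ⟨‖r‖ * C, fun X mX μ φ hφ => ?_⟩
    have : φ ⟨r • x, SMulMemClass.smul_mem r hx⟩ = r • φ ⟨x, hx⟩ := map_smul φ r ⟨x, hx⟩
    rw [this]
    exact (norm_smul_le _ _).trans (mul_le_mul_of_nonneg_left (hC X mX μ φ hφ) (norm_nonneg _))

variable {Q} in
theorem norm_le_repNorm {X : Type u} [mX : MeasurableSpace X] {μ : MeasureTheory.Measure X}
    {φ : Leavitt Q →ₙₐ[ℂ] LpOp p μ} (hφ : Leavitt.IsRepresentation φ) (x : Leavitt Q) :
    ‖φ x‖ ≤ repNorm p Q x :=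
  le_csSup (bddAbove_repNorms p Q x) ⟨X, mX, μ, φ, hφ, rfl⟩

theorem repNorm_nonneg (x : Leavitt Q) : 0 ≤ repNorm p Q x := by
  refine Real.sSup_nonneg ?_
  rintro _ ⟨X, mX, μ, φ, hφ, rfl⟩
  exact norm_nonneg _

variable {Q} in
theorem repNorm_le {x : Leavitt Q} {C : ℝ} (hC : 0 ≤ C)
    (h : ∀ (X : Type u) [MeasurableSpace X] (μ : MeasureTheory.Measure X)
      (φ : Leavitt Q →ₙₐ[ℂ] LpOp p μ), Leavitt.IsRepresentation φ → ‖φ x‖ ≤ C) :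
    repNorm p Q x ≤ C := by
  refine Real.sSup_le ?_ hC
  rintro _ ⟨X, mX, μ, φ, hφ, rfl⟩
  exact h X μ φ hφ

/-- `repNorm` as a seminorm on the additive group of `L_Q`. -/
def repSeminorm : AddGroupSeminorm (Leavitt Q) where
  toFun := repNorm p Q
  map_zero' := le_antisymm (repNorm_le p le_rfl fun X _ μ φ _ => by rw [map_zero, norm_zero])
    (repNorm_nonneg p Q 0)
  add_le' x y := repNorm_le p (add_nonneg (repNorm_nonneg p Q x) (repNorm_nonneg p Q y))
    fun X _ μ φ hφ => by
      rw [map_add]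
      exact (norm_add_le _ _).trans
        (add_le_add (norm_le_repNorm p hφ x) (norm_le_repNorm p hφ y))
  neg' x := by
    have key : ∀ y : Leavitt Q, repNorm p Q (-y) ≤ repNorm p Q y := fun y =>
      repNorm_le p (repNorm_nonneg p Q y) fun X _ μ φ hφ => by
        rw [map_neg, norm_neg]
        exact norm_le_repNorm p hφ y
    refine le_antisymm (key x) ?_
    simpa using key (-x)

/-- `L_Q` equipped with the norm `repNorm`. -/
def NormedLeavitt (_p : ℝ≥0∞) (Q : DirGraph.{u}) : Type u := Leavitt Q

instance : NonUnitalRing (NormedLeavitt p Q) := inferInstanceAs (NonUnitalRing (Leavitt Q))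

instance : Module ℂ (NormedLeavitt p Q) := inferInstanceAs (Module ℂ (Leavitt Q))

instance : NonUnitalSeminormedRing (NormedLeavitt p Q) where
  __ := (inferInstance : NonUnitalRing (NormedLeavitt p Q))
  __ := (repSeminorm p Q).toSeminormedAddCommGroup
  norm_mul_le x y := repNorm_le (Q := Q) (x := (show Leavitt Q from x) * (show Leavitt Q from y)) p
    (mul_nonneg (repNorm_nonneg p Q x) (repNorm_nonneg p Q y)) fun X _ μ φ hφ => by
      rw [map_mul]
      exact (norm_mul_le _ _).trans (mul_le_mul (norm_le_repNorm p hφ _)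
        (norm_le_repNorm p hφ _) (norm_nonneg _) (repNorm_nonneg p Q _))

instance : NormedSpace ℂ (NormedLeavitt p Q) where
  norm_smul_le c x := repNorm_le (Q := Q) (x := c • (show Leavitt Q from x)) p
    (mul_nonneg (norm_nonneg c) (repNorm_nonneg p Q x)) fun X _ μ φ hφ => by
      rw [map_smul]
      exact (norm_smul_le _ _).trans
        (mul_le_mul_of_nonneg_left (norm_le_repNorm p hφ _) (norm_nonneg c))

/-- The completion of a (seminormed, not necessarily unital) algebra. -/
def AlgCompletion (A : Type*) [NonUnitalSeminormedRing A] : Type _ := UniformSpace.Completion A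

namespace AlgCompletion

open UniformSpace

variable {A : Type*} [NonUnitalSeminormedRing A]

instance : NormedAddCommGroup (AlgCompletion A) :=
  inferInstanceAs (NormedAddCommGroup (Completion A))

instance : CompleteSpace (AlgCompletion A) := inferInstanceAs (CompleteSpace (Completion A))

/-- The canonical map into the completion. -/
def of : A →+ AlgCompletion A := Completion.toCompl

theorem isDenseInducing_of : IsDenseInducing (of : A → AlgCompletion A) :=
  Completion.isDenseInducing_coe

theorem continuous_of : Continuous (of : A → AlgCompletion A) := Completion.continuous_coe A

theorem norm_of (a : A) : ‖of a‖ = ‖a‖ := Completion.norm_coe a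

/-- The multiplication of the completion extends that of the algebra by continuity. -/
instance : Mul (AlgCompletion A) :=
  ⟨Function.curry <| ((isDenseInducing_of (A := A)).prodMap isDenseInducing_of).extend
    (of ∘ Function.uncurry (· * ·))⟩

theorem of_mul (a b : A) : of (a * b) = of a * of b :=
  ((isDenseInducing_of.prodMap isDenseInducing_of).extend_eq
    (continuous_of.comp (continuous_mul (M := A))) (a, b)).symm

instance : ContinuousMul (AlgCompletion A) where
  continuous_mul := by
    let m := (AddMonoidHom.mul : A →+ A →+ A).compr₂ of
    have : Continuous fun q : A × A => m q.1 q.2 := continuous_of.comp continuous_mul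
    have di : IsDenseInducing (of : A → AlgCompletion A) := isDenseInducing_of
    exact (di.extend_Z_bilin di this :)

theorem induction_on {P : AlgCompletion A → Prop} (x : AlgCompletion A)
    (hP : IsClosed {x | P x}) (h : ∀ a : A, P (of a)) : P x :=
  Completion.induction_on x hP h

theorem induction_on₂ {P : AlgCompletion A → AlgCompletion A → Prop} (x y : AlgCompletion A)
    (hP : IsClosed {q : AlgCompletion A × AlgCompletion A | P q.1 q.2})
    (h : ∀ a b : A, P (of a) (of b)) : P x y :=
  Completion.induction_on₂ x y hP h

theorem induction_on₃ {P : AlgCompletion A → AlgCompletion A → AlgCompletion A → Prop}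
    (x y z : AlgCompletion A)
    (hP : IsClosed {q : AlgCompletion A × AlgCompletion A × AlgCompletion A | P q.1 q.2.1 q.2.2})
    (h : ∀ a b c : A, P (of a) (of b) (of c)) : P x y z :=
  Completion.induction_on₃ x y z hP h

instance : NonUnitalNormedRing (AlgCompletion A) where
  __ := (inferInstance : NormedAddCommGroup (AlgCompletion A))
  __ := (inferInstance : Mul (AlgCompletion A))
  zero_mul x := by
    refine induction_on (P := fun x => 0 * x = 0) x (isClosed_eq (by fun_prop) (by fun_prop))
      fun a => ?_
    rw [← map_zero of, ← of_mul, zero_mul]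
  mul_zero x := by
    refine induction_on (P := fun x => x * 0 = 0) x (isClosed_eq (by fun_prop) (by fun_prop))
      fun a => ?_
    rw [← map_zero of, ← of_mul, mul_zero]
  mul_assoc x y z := by
    refine induction_on₃ (P := fun x y z => x * y * z = x * (y * z)) x y z
      (isClosed_eq (by fun_prop) (by fun_prop)) fun a b c => ?_
    rw [← of_mul, ← of_mul, ← of_mul, ← of_mul, mul_assoc]
  left_distrib x y z := by
    refine induction_on₃ (P := fun x y z => x * (y + z) = x * y + x * z) x y z
      (isClosed_eq (by fun_prop) (by fun_prop)) fun a b c => ?_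
    rw [← map_add, ← of_mul, ← of_mul, ← of_mul, ← map_add, mul_add]
  right_distrib x y z := by
    refine induction_on₃ (P := fun x y z => (x + y) * z = x * z + y * z) x y z
      (isClosed_eq (by fun_prop) (by fun_prop)) fun a b c => ?_
    rw [← map_add, ← of_mul, ← of_mul, ← of_mul, ← map_add, add_mul]
  norm_mul_le x y := by
    refine induction_on₂ (P := fun x y => ‖x * y‖ ≤ ‖x‖ * ‖y‖) x y
      (isClosed_le (by fun_prop) (by fun_prop)) fun a b => ?_
    rw [← of_mul, norm_of, norm_of, norm_of]
    exact norm_mul_le a b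

instance [NormedSpace ℂ A] : NormedSpace ℂ (AlgCompletion A) :=
  inferInstanceAs (NormedSpace ℂ (Completion A))

theorem of_smul [NormedSpace ℂ A] (c : ℂ) (a : A) : of (c • a) = c • of a :=
  Completion.coe_smul c a

/-- The extension of a map to the completion by continuity. -/
def extendFun {B : Type*} [NormedRing B] (f : A → B) : AlgCompletion A → B :=
  Completion.extension f

theorem continuous_extendFun {B : Type*} [NormedRing B] [CompleteSpace B] (f : A → B) :
    Continuous (extendFun f) := Completion.continuous_extension

theorem extendFun_of [NormedSpace ℂ A] {B : Type*} [NormedRing B] [NormedAlgebra ℂ B]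
    [CompleteSpace B] (f : A →ₙₐ[ℂ] B) (hf : ∀ x, ‖f x‖ ≤ ‖x‖) (a : A) :
    extendFun f (of a) = f a :=
  Completion.extension_coe (AddMonoidHomClass.lipschitz_of_bound f 1
    (by simpa using hf)).uniformContinuous a

/-- The extension to the completion of a contractive homomorphism into a Banach algebra. -/
def extend [NormedSpace ℂ A] {B : Type*} [NormedRing B] [NormedAlgebra ℂ B] [CompleteSpace B]
    (f : A →ₙₐ[ℂ] B) (hf : ∀ x, ‖f x‖ ≤ ‖x‖) : AlgCompletion A →ₙₐ[ℂ] B where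
  toFun := extendFun f
  map_zero' := by rw [← map_zero of, extendFun_of f hf, map_zero]
  map_add' x y := by
    have hg := continuous_extendFun (f : A → B)
    refine induction_on₂ (P := fun x y => extendFun f (x + y) = extendFun f x + extendFun f y) x y
      (isClosed_eq (by fun_prop) (by fun_prop)) fun a b => ?_
    rw [← map_add, extendFun_of f hf, extendFun_of f hf, extendFun_of f hf, map_add]
  map_mul' x y := by
    have hg := continuous_extendFun (f : A → B)
    refine induction_on₂ (P := fun x y => extendFun f (x * y) = extendFun f x * extendFun f y) x y
      (isClosed_eq (by fun_prop) (by fun_prop)) fun a b => ?_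
    rw [← of_mul, extendFun_of f hf, extendFun_of f hf, extendFun_of f hf, map_mul]
  map_smul' c x := by
    have hg := continuous_extendFun (f : A → B)
    refine induction_on (P := fun x => extendFun f (c • x) = c • extendFun f x) x
      (isClosed_eq (hg.comp (continuous_const_smul c)) (hg.const_smul c)) fun a => ?_
    rw [← of_smul, extendFun_of f hf, extendFun_of f hf, map_smul]

theorem extend_of [NormedSpace ℂ A] {B : Type*} [NormedRing B] [NormedAlgebra ℂ B]
    [CompleteSpace B] (f : A →ₙₐ[ℂ] B) (hf : ∀ x, ‖f x‖ ≤ ‖x‖) (a : A) :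
    extend f hf (of a) = f a := extendFun_of f hf a

theorem norm_extend_le [NormedSpace ℂ A] {B : Type*} [NormedRing B] [NormedAlgebra ℂ B]
    [CompleteSpace B] (f : A →ₙₐ[ℂ] B) (hf : ∀ x, ‖f x‖ ≤ ‖x‖) (x : AlgCompletion A) :
    ‖extend f hf x‖ ≤ ‖x‖ := by
  have hc : Continuous (extend f hf) := continuous_extendFun (f : A → B)
  refine induction_on (P := fun x => ‖extend f hf x‖ ≤ ‖x‖) x
    (isClosed_le (by fun_prop) (by fun_prop)) fun a => ?_
  rw [extend_of, norm_of]
  exact hf a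

end AlgCompletion

/-- The `L^p`-operator graph algebra `O^p(Q)`: the completion of `L_Q`. -/
abbrev GraphAlgebra : Type u := AlgCompletion (NormedLeavitt p Q)

variable {Q} in
/-- The canonical map `L_Q → O^p(Q)`. -/
def toGraphAlgebra (x : Leavitt Q) : GraphAlgebra p Q :=
  AlgCompletion.of (show NormedLeavitt p Q from x)

variable {p Q} {X : Type u} [MeasurableSpace X] {μ : MeasureTheory.Measure X}
  {S T : Q.E → LpOp p μ} {E : Q.V → LpOp p μ}

/-- The canonical contractive homomorphism `O^p(Q) → B(L^p(μ))` of a Cuntz–Krieger family. -/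
def canonicalHom (h : IsCKFamily Q S T E) : GraphAlgebra p Q →ₙₐ[ℂ] LpOp p μ :=
  AlgCompletion.extend (A := NormedLeavitt p Q) (Leavitt.lift h)
    (norm_le_repNorm p (Leavitt.isRepresentation_lift h))

theorem canonicalHom_s (h : IsCKFamily Q S T E) (a : Q.E) :
    canonicalHom h (toGraphAlgebra p (Leavitt.s a)) = S a :=
  (AlgCompletion.extend_of (A := NormedLeavitt p Q) _ _ _).trans (Leavitt.lift_gen h _)

theorem canonicalHom_t (h : IsCKFamily Q S T E) (a : Q.E) :
    canonicalHom h (toGraphAlgebra p (Leavitt.t a)) = T a :=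
  (AlgCompletion.extend_of (A := NormedLeavitt p Q) _ _ _).trans (Leavitt.lift_gen h _)

theorem canonicalHom_e (h : IsCKFamily Q S T E) (v : Q.V) :
    canonicalHom h (toGraphAlgebra p (Leavitt.e v)) = E v :=
  (AlgCompletion.extend_of (A := NormedLeavitt p Q) _ _ _).trans (Leavitt.lift_gen h _)

theorem norm_canonicalHom_le (h : IsCKFamily Q S T E) (x : GraphAlgebra p Q) :
    ‖canonicalHom h x‖ ≤ ‖x‖ :=
  AlgCompletion.norm_extend_le _ _ x

end Algebra

end LpGraph

end

noncomputable section

namespace LpGraph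

open MeasureTheory

/-! The graph is desingularized, and the families are dilated with it. Number the edges of Q
injectively by `n`. Replace each vertex v by a chain of vertices (v, m), with a chain edge from (v,
m) to (v, m + 1), and let the edge b run from (s b, n b) to (r b, -n b). Distinct edges are attached
at distinct levels, so every new vertex receives and emits at most one old edge besides its chain
edges. Chains are infinite upward, which excludes sinks. Downward they are infinite over singular
vertices, while over a regular v the chain stops where the last edge into v is attached, so that its
lowest vertex is not a source either.

The edge b is recovered as the path that climbs from (s b, 0) to level n b, crosses b, and climbs
from level -n b to (r b, 0). These paths form a Leavitt Q-family in the Leavitt path algebra of the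
new graph (`IsLeavittFamily.ofDesing`), and representations of the latter restrict to
representations of L_Q (`IsCKFamily.ofDesing`). Conversely, a family (S, T, E) dilates to ℤ copies
of the measure space (`IsCKFamily.dilation`): at (v, m) sits, on copy m, the idempotent E_v minus
all S_b T_b with r b = v and n b < -m; chain edges move it one copy up, and b acts as S_b from copy
n b to copy -n b. The path of b then acts as S_b on copy 0, so restricting the dilation returns the
original family in the corner of copy 0. Restriction and dilation give the two inequalities that
make φ isometric (`repNorm_desingHom`), and the corner identity, extended from the dense image of
L_Q, is the intertwining relation.

The analytic point is that differences and conjugates of hermitian idempotents must again be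
hermitian. On L^p with p ≠ 2 this holds because hermitian idempotents are exactly the
L^p-projections (`IsHermitianIdempotent.isLpProj`), a class that is stable under both operations
when the idempotents are nested and the conjugating maps are mutually inverse contractions on the
relevant ranges. The proof is in the spirit of Lamperti: equality in Clarkson's inequality detects
disjointness, hence isometries preserve disjointness.

The old edges on an entry-free cycle of the new graph contain an entry-free cycle of Q
(`desing_everyCycleHasEntry`). -/

/-! ### A strict form of Clarkson's inequality for complex numbers -/

/-- The defect in Clarkson's inequality with exponent `q`. -/
def clarksonDefect (q : ℝ) (a b : ℂ) : ℝ :=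
  ‖a + b‖ ^ q + ‖a - b‖ ^ q - 2 * (‖a‖ ^ q + ‖b‖ ^ q)

/-- Write (u + v)^r as u (u + v)^(r-1) + v (u + v)^(r-1) and use that t ↦ t^(r-1) is strictly
decreasing. For r > 1 it is increasing and the inequality is reversed. -/
theorem add_rpow_lt_of_lt_one {r u v : ℝ} (hr : r < 1) (hu : 0 < u) (hv : 0 < v) :
    (u + v) ^ r < u ^ r + v ^ r := by
  have key : ∀ {w : ℝ}, 0 < w → w < u + v → w * (u + v) ^ (r - 1) < w ^ r := by
    intro w hw hlt
    have h : w ^ r = w * w ^ (r - 1) := by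
      rw [Real.rpow_sub_one hw.ne']
      field_simp
    rw [h]
    exact mul_lt_mul_of_pos_left (Real.rpow_lt_rpow_of_neg hw hlt (by linarith)) hw
  have h : (u + v) ^ r = u * (u + v) ^ (r - 1) + v * (u + v) ^ (r - 1) := by
    rw [Real.rpow_sub_one (by positivity)]
    field_simp
  rw [h]
  exact add_lt_add (key hu (by linarith)) (key hv (by linarith))

theorem lt_add_rpow_of_one_lt {r u v : ℝ} (hr : 1 < r) (hu : 0 < u) (hv : 0 < v) :
    u ^ r + v ^ r < (u + v) ^ r := by
  have key : ∀ {w : ℝ}, 0 < w → w < u + v → w ^ r < w * (u + v) ^ (r - 1) := by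
    intro w hw hlt
    have h : w ^ r = w * w ^ (r - 1) := by
      rw [Real.rpow_sub_one hw.ne']
      field_simp
    rw [h]
    exact mul_lt_mul_of_pos_left (Real.rpow_lt_rpow hw.le hlt (by linarith)) hw
  have h : (u + v) ^ r = u * (u + v) ^ (r - 1) + v * (u + v) ^ (r - 1) := by
    rw [Real.rpow_sub_one (by positivity)]
    field_simp
  rw [h]
  exact add_lt_add (key hu (by linarith)) (key hv (by linarith))

theorem sq_rpow_half {x : ℝ} (hx : 0 ≤ x) (q : ℝ) : (x ^ 2) ^ (q / 2) = x ^ q := by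
  rw [← Real.rpow_natCast, ← Real.rpow_mul hx]
  congr 1
  push_cast
  ring

theorem clarksonDefect_eq_zero {q : ℝ} (hq : 0 < q) {a b : ℂ} (h : a = 0 ∨ b = 0) :
    clarksonDefect q a b = 0 := by
  rcases h with rfl | rfl <;> simp [clarksonDefect, Real.zero_rpow hq.ne'] <;> ring

/-- By the parallelogram law |a|² + |b|² is the mean of |a + b|² and |a - b|². Concavity of t^(q/2)
bounds the mean of |a ± b|^q by (|a|² + |b|²)^(q/2), and strict subadditivity bounds this by |a|^q +
|b|^q, strictly if a and b are both nonzero. For q > 2 convexity and superadditivity reverse both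
steps. -/
theorem clarksonDefect_of_lt_two {q : ℝ} (hq : 0 < q) (hq2 : q < 2) (a b : ℂ) :
    clarksonDefect q a b ≤ 0 ∧ (clarksonDefect q a b = 0 → a = 0 ∨ b = 0) := by
  by_cases h : a = 0 ∨ b = 0
  · exact ⟨(clarksonDefect_eq_zero hq h).le, fun _ => h⟩
  push Not at h
  have hlt := add_rpow_lt_of_lt_one (r := q / 2) (by linarith)
    (pow_pos (norm_pos_iff.2 h.1) 2) (pow_pos (norm_pos_iff.2 h.2) 2)
  have hc := (Real.concaveOn_rpow (p := q / 2) (by linarith) (by linarith)).2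
    (Set.mem_Ici.2 (sq_nonneg ‖a + b‖)) (Set.mem_Ici.2 (sq_nonneg ‖a - b‖))
    (one_half_pos (α := ℝ)).le (one_half_pos (α := ℝ)).le (add_halves 1)
  have hp := parallelogram_law_with_norm ℂ a b
  have hs : (1 / 2 : ℝ) • ‖a + b‖ ^ 2 + (1 / 2 : ℝ) • ‖a - b‖ ^ 2 = ‖a‖ ^ 2 + ‖b‖ ^ 2 := by
    simp only [smul_eq_mul]
    linarith
  rw [hs] at hc
  simp only [smul_eq_mul, sq_rpow_half (norm_nonneg _)] at hc hlt
  have : clarksonDefect q a b < 0 := by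
    unfold clarksonDefect
    linarith
  exact ⟨this.le, fun h0 => absurd h0 this.ne⟩

theorem clarksonDefect_of_two_lt {q : ℝ} (hq2 : 2 < q) (a b : ℂ) :
    0 ≤ clarksonDefect q a b ∧ (clarksonDefect q a b = 0 → a = 0 ∨ b = 0) := by
  by_cases h : a = 0 ∨ b = 0
  · exact ⟨(clarksonDefect_eq_zero (by linarith) h).ge, fun _ => h⟩
  push Not at h
  have hlt := lt_add_rpow_of_one_lt (r := q / 2) (by linarith)
    (pow_pos (norm_pos_iff.2 h.1) 2) (pow_pos (norm_pos_iff.2 h.2) 2)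
  have hc := (convexOn_rpow (p := q / 2) (by linarith)).2
    (Set.mem_Ici.2 (sq_nonneg ‖a + b‖)) (Set.mem_Ici.2 (sq_nonneg ‖a - b‖))
    (one_half_pos (α := ℝ)).le (one_half_pos (α := ℝ)).le (add_halves 1)
  have hp := parallelogram_law_with_norm ℂ a b
  have hs : (1 / 2 : ℝ) • ‖a + b‖ ^ 2 + (1 / 2 : ℝ) • ‖a - b‖ ^ 2 = ‖a‖ ^ 2 + ‖b‖ ^ 2 := by
    simp only [smul_eq_mul]
    linarith
  rw [hs] at hc
  simp only [smul_eq_mul, sq_rpow_half (norm_nonneg _)] at hc hlt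
  have : 0 < clarksonDefect q a b := by
    unfold clarksonDefect
    linarith
  exact ⟨this.le, fun h0 => absurd h0 this.ne'⟩

/-! ### Multiplication by indicator functions -/

section Restrict

variable {p : ℝ≥0∞} {X : Type*} [MeasurableSpace X] {μ : Measure X}

/-- Multiplication by the indicator function of a measurable set. -/
def restrictLp {D : Set X} (hD : MeasurableSet D) (f : Lp ℂ p μ) : Lp ℂ p μ :=
  ((Lp.memLp f).indicator hD).toLp _

theorem coeFn_restrictLp {D : Set X} (hD : MeasurableSet D) (f : Lp ℂ p μ) :
    restrictLp hD f =ᵐ[μ] D.indicator f := MemLp.coeFn_toLp _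

theorem restrictLp_add_restrictLp_compl {D : Set X} (hD : MeasurableSet D) (f : Lp ℂ p μ) :
    restrictLp hD f + restrictLp hD.compl f = f := by
  refine Lp.ext ?_
  filter_upwards [Lp.coeFn_add (restrictLp hD f) (restrictLp hD.compl f), coeFn_restrictLp hD f,
    coeFn_restrictLp hD.compl f] with x h1 h2 h3
  rw [h1, Pi.add_apply, h2, h3]
  by_cases hx : x ∈ D <;> simp [hx]

end Restrict

/-! ### Disjointness in `L^p` -/

section Disjoint

variable {p : ℝ≥0∞} [Fact (1 ≤ p)] {X : Type*} [MeasurableSpace X] {μ : Measure X}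

theorem toReal_pos_of_fact (hp : p ≠ ∞) : 0 < p.toReal :=
  ENNReal.toReal_pos (zero_lt_one.trans_le (Fact.out : 1 ≤ p)).ne' hp

theorem integrable_rpow (hp : p ≠ ∞) (f : Lp ℂ p μ) :
    Integrable (fun x => ‖f x‖ ^ p.toReal) μ :=
  (Lp.memLp f).integrable_norm_rpow (zero_lt_one.trans_le (Fact.out : 1 ≤ p)).ne' hp

theorem norm_rpow_eq_integral (hp : p ≠ ∞) (f : Lp ℂ p μ) :
    ‖f‖ ^ p.toReal = ∫ x, ‖f x‖ ^ p.toReal ∂μ := by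
  have h0 := toReal_pos_of_fact hp
  have hi : 0 ≤ ∫ x, ‖f x‖ ^ p.toReal ∂μ := integral_nonneg fun x => by positivity
  rw [Lp.norm_def, (Lp.memLp f).eLpNorm_eq_integral_rpow_norm
    (zero_lt_one.trans_le (Fact.out : 1 ≤ p)).ne' hp, ENNReal.toReal_ofReal (by positivity),
    ← Real.rpow_mul hi, inv_mul_cancel₀ h0.ne', Real.rpow_one]

/-- Two elements of `L^p` are disjoint if their product vanishes almost everywhere. -/
def AEDisjointLp (f g : Lp ℂ p μ) : Prop := ∀ᵐ x ∂μ, f x = 0 ∨ g x = 0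

theorem integral_clarksonDefect (hp : p ≠ ∞) (f g : Lp ℂ p μ) :
    Integrable (fun x => clarksonDefect p.toReal (f x) (g x)) μ ∧
    ∫ x, clarksonDefect p.toReal (f x) (g x) ∂μ =
      ‖f + g‖ ^ p.toReal + ‖f - g‖ ^ p.toReal - 2 * (‖f‖ ^ p.toReal + ‖g‖ ^ p.toReal) := by
  have h1 := integrable_rpow hp (f + g)
  have h2 := integrable_rpow hp (f - g)
  have h3 := integrable_rpow hp f
  have h4 := integrable_rpow hp g
  have he : (fun x => clarksonDefect p.toReal (f x) (g x)) =ᵐ[μ] fun x =>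
      ‖(f + g) x‖ ^ p.toReal + ‖(f - g) x‖ ^ p.toReal
        - 2 * (‖f x‖ ^ p.toReal + ‖g x‖ ^ p.toReal) := by
    filter_upwards [Lp.coeFn_add f g, Lp.coeFn_sub f g] with x h5 h6
    rw [clarksonDefect, h5, h6, Pi.add_apply, Pi.sub_apply]
  refine ⟨((h1.add h2).sub ((h3.add h4).const_mul 2)).congr he.symm, ?_⟩
  rw [integral_congr_ae he]
  simp only [norm_rpow_eq_integral hp]
  rw [← integral_add h1 h2, ← integral_add h3 h4, ← integral_const_mul]
  exact integral_sub (h1.add h2) ((h3.add h4).const_mul 2)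

/-- For `p ≠ 2`, two elements of `L^p` are disjoint iff equality holds in Clarkson's inequality. -/
theorem aeDisjointLp_iff (hp : p ≠ ∞) (hp2 : p ≠ 2) (f g : Lp ℂ p μ) :
    AEDisjointLp f g ↔ ‖f + g‖ ^ p.toReal + ‖f - g‖ ^ p.toReal
      = 2 * (‖f‖ ^ p.toReal + ‖g‖ ^ p.toReal) := by
  have h0 := toReal_pos_of_fact hp
  obtain ⟨hI, hint⟩ := integral_clarksonDefect hp f g
  rw [← sub_eq_zero, ← hint]
  have hq2 : p.toReal ≠ 2 := fun h => hp2 <| by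
    rw [← ENNReal.ofReal_toReal hp, h]
    simp
  constructor
  · intro h
    refine integral_eq_zero_of_ae ?_
    filter_upwards [h] with x hx using clarksonDefect_eq_zero h0 hx
  · intro h
    -- The integrand has constant sign on either side of the exponent 2, so a vanishing integral
    -- forces it to vanish almost everywhere.
    rcases lt_or_gt_of_ne hq2 with hlt | hgt
    · have h1 : ∫ x, -clarksonDefect p.toReal (f x) (g x) ∂μ = 0 := by
        rw [integral_neg, h, neg_zero]
      rw [integral_eq_zero_iff_of_nonneg
        (fun x => neg_nonneg.2 (clarksonDefect_of_lt_two h0 hlt _ _).1) hI.neg] at h1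
      filter_upwards [h1] with x hx
      exact (clarksonDefect_of_lt_two h0 hlt _ _).2 (neg_eq_zero.1 hx)
    · rw [integral_eq_zero_iff_of_nonneg
        (fun x => (clarksonDefect_of_two_lt hgt _ _).1) hI] at h
      filter_upwards [h] with x hx
      exact (clarksonDefect_of_two_lt hgt _ _).2 hx

theorem AEDisjointLp.norm_rpow_add (hp : p ≠ ∞) {f g : Lp ℂ p μ} (h : AEDisjointLp f g) :
    ‖f + g‖ ^ p.toReal = ‖f‖ ^ p.toReal + ‖g‖ ^ p.toReal := by
  have h0 := toReal_pos_of_fact hp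
  simp only [norm_rpow_eq_integral hp]
  rw [← integral_add (integrable_rpow hp f) (integrable_rpow hp g)]
  refine integral_congr_ae ?_
  filter_upwards [h, Lp.coeFn_add f g] with x hx h1
  rw [h1]
  rcases hx with hx | hx <;> simp [hx, Real.zero_rpow h0.ne']

/-- Isometries of `L^p`, `p ≠ 2`, preserve disjointness. -/
theorem AEDisjointLp.map (hp : p ≠ ∞) (hp2 : p ≠ 2) {f g : Lp ℂ p μ} (h : AEDisjointLp f g)
    {U : LpOp p μ} (hU : ∀ ξ, ‖U ξ‖ = ‖ξ‖) : AEDisjointLp (U f) (U g) := by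
  -- The criterion involves only norms of linear combinations of f and g.
  rw [aeDisjointLp_iff hp hp2] at h ⊢
  rwa [← map_add, ← map_sub, hU, hU, hU, hU]

theorem norm_restrictLp_rpow (hp : p ≠ ∞) {D : Set X} (hD : MeasurableSet D) (f : Lp ℂ p μ) :
    ‖restrictLp hD f‖ ^ p.toReal = ∫ x in D, ‖f x‖ ^ p.toReal ∂μ := by
  have h0 := toReal_pos_of_fact hp
  rw [norm_rpow_eq_integral hp, ← integral_indicator hD]
  refine integral_congr_ae ?_
  filter_upwards [coeFn_restrictLp hD f] with x hx
  rw [hx]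
  by_cases hx : x ∈ D <;> simp [hx, Real.zero_rpow h0.ne']

end Disjoint

/-! ### `L^p`-projections -/

/-- An idempotent operator `P` with `‖ξ‖^q = ‖P ξ‖^q + ‖ξ - P ξ‖^q`. -/
structure IsLpProj {V : Type*} [NormedAddCommGroup V] [NormedSpace ℂ V] (q : ℝ)
    (P : V →L[ℂ] V) : Prop where
  idem : P * P = P
  norm_rpow : ∀ ξ, ‖ξ‖ ^ q = ‖P ξ‖ ^ q + ‖ξ - P ξ‖ ^ q

namespace IsLpProj

variable {V W : Type*} [NormedAddCommGroup V] [NormedSpace ℂ V] [NormedAddCommGroup W]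
  [NormedSpace ℂ W] {q : ℝ} {P R : V →L[ℂ] V}

theorem apply_apply (h : IsLpProj q P) (ξ : V) : P (P ξ) = P ξ := DFunLike.congr_fun h.idem ξ

theorem zero (hq : 0 < q) : IsLpProj q (0 : V →L[ℂ] V) :=
  ⟨by simp, fun ξ => by simp [Real.zero_rpow hq.ne']⟩

/-- `L^p`-projections are hermitian. -/
theorem isHermitianIdempotent [CompleteSpace V] (hq : 0 < q) (h : IsLpProj q P) :
    IsHermitianIdempotent P := by
  refine ⟨h.idem, fun l => ?_⟩
  rw [exp_smul_idem h.idem]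
  refine ContinuousLinearMap.opNorm_le_bound _ zero_le_one fun ξ => ?_
  set z : ℂ := Complex.exp (Complex.I * l)
  have hz : ‖z‖ = 1 := by
    simp only [z]
    rw [mul_comm, Complex.norm_exp_ofReal_mul_I]
  have e1 : (1 + (z - 1) • P) ξ = ξ + (z - 1) • P ξ := by simp
  rw [e1, one_mul]
  refine le_of_eq ((Real.rpow_left_inj (norm_nonneg _) (norm_nonneg _) hq.ne').1 ?_)
  -- The exponential multiplies the component P ξ by the unimodular z and fixes ξ - P ξ, so it
  -- preserves both terms of the norm identity.
  have e2 : P (ξ + (z - 1) • P ξ) = z • P ξ := by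
    rw [map_add, map_smul, h.apply_apply]
    module
  rw [h.norm_rpow (ξ + (z - 1) • P ξ), h.norm_rpow ξ, e2, norm_smul, hz, one_mul]
  congr 3
  module

/-- The difference of an `L^p`-projection and a smaller one. -/
theorem sub (hP : IsLpProj q P) (hR : IsLpProj q R) (h1 : P * R = R)
    (h2 : R * P = R) : IsLpProj q (P - R) := by
  have a1 : ∀ ξ, P (R ξ) = R ξ := fun ξ => DFunLike.congr_fun h1 ξ
  have a2 : ∀ ξ, R (P ξ) = R ξ := fun ξ => DFunLike.congr_fun h2 ξ
  refine ⟨by rw [sub_mul, mul_sub, mul_sub, hP.idem, hR.idem, h1, h2]; abel, fun ξ => ?_⟩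
  -- Both ξ and ξ - (P - R) ξ are decomposed along R ξ, (P - R) ξ and ξ - P ξ. Comparing the
  -- resulting sums of q-th powers gives the identity for P - R.
  have e1 := hR.norm_rpow ξ
  have e2 := hP.norm_rpow (ξ - R ξ)
  have e3 := hP.norm_rpow (ξ - (P - R) ξ)
  have b1 : P (ξ - R ξ) = (P - R) ξ := by simp [a1]
  have b2 : ξ - R ξ - (P - R) ξ = ξ - P ξ := by simp
  have b3 : P (ξ - (P - R) ξ) = R ξ := by simp [a1, hP.apply_apply]
  have b4 : ξ - (P - R) ξ - R ξ = ξ - P ξ := by simp only [sub_apply]; abel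
  rw [b1, b2] at e2
  rw [b3, b4] at e3
  linarith

/-- Conjugation of an `L^p`-projection by a partial isometry `c` with inverse `d`. -/
theorem conj {c : V →L[ℂ] W} {d : W →L[ℂ] V} (hc : ∀ ξ, ‖c ξ‖ ≤ ‖ξ‖)
    (hd : ∀ ξ, ‖d ξ‖ ≤ ‖ξ‖) (hcd : IsLpProj q (c.comp d)) (h : IsLpProj q P)
    (h1 : ∀ ξ, d (c (P ξ)) = P ξ) (h3 : ∀ ξ, d (c (d ξ)) = d ξ) :
    IsLpProj q (c.comp (P.comp d)) := by
  -- A contraction with a contractive left inverse on a subspace is isometric there. This applies to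
  -- c on the vectors P ξ, d ξ and d ξ - P (d ξ).
  have nP : ∀ ξ, ‖c (P ξ)‖ = ‖P ξ‖ := fun ξ =>
    le_antisymm (hc _) (by simpa [h1] using hd (c (P ξ)))
  have nd : ∀ ξ, ‖c (d ξ)‖ = ‖d ξ‖ := fun ξ =>
    le_antisymm (hc _) (by simpa [h3] using hd (c (d ξ)))
  have ns : ∀ ξ, ‖c (d ξ) - c (P (d ξ))‖ = ‖d ξ - P (d ξ)‖ := fun ξ => by
    rw [← map_sub]
    exact le_antisymm (hc _) (by simpa [h1, h3] using hd (c (d ξ - P (d ξ))))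
  constructor
  · ext ξ
    simp [h1, h.apply_apply]
  · intro ξ
    have e1 := hcd.norm_rpow ξ
    have e2 := h.norm_rpow (d ξ)
    have e3 := hcd.norm_rpow (ξ - c (P (d ξ)))
    have b1 : (c.comp d) (ξ - c (P (d ξ))) = c (d ξ) - c (P (d ξ)) := by simp [h1]
    have b2 : ξ - c (P (d ξ)) - (c (d ξ) - c (P (d ξ))) = ξ - (c.comp d) ξ := by simp
    rw [b1, b2, ns] at e3
    simp only [ContinuousLinearMap.comp_apply, nd] at e1 e3 ⊢
    rw [nP]
    linarith

end IsLpProj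

/-! ### Hermitian idempotents on `L^p`-spaces -/

section Hermitian

variable {p : ℝ≥0∞} [Fact (1 ≤ p)] {X : Type*} [MeasurableSpace X] {μ : Measure X}
  {P : LpOp p μ}

/-- The operator 1 + (z - 1) P is exp(iλP) with λ = arg z, hence a contraction. Its inverse 1 + (z⁻¹
- 1) P has the same form, so it is an isometry. -/
theorem IsHermitianIdempotent.norm_add_smul (h : IsHermitianIdempotent P) {z : ℂ} (hz : ‖z‖ = 1)
    (ξ : Lp ℂ p μ) : ‖ξ + (z - 1) • P ξ‖ = ‖ξ‖ := by
  have hPP : ∀ ξ, P (P ξ) = P ξ := fun ξ => DFunLike.congr_fun h.idem ξ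
  have key : ∀ (w : ℂ), ‖w‖ = 1 → ∀ ξ, ‖ξ + (w - 1) • P ξ‖ ≤ ‖ξ‖ := by
    intro w hw ξ
    have h1 := h.hermitian w.arg
    rw [exp_smul_idem h.idem, mul_comm, show Complex.exp (w.arg * Complex.I) = w by
      simpa [hw] using Complex.norm_mul_exp_arg_mul_I w] at h1
    simpa using ContinuousLinearMap.le_of_opNorm_le _ h1 ξ
  refine le_antisymm (key z hz ξ) ?_
  have hz0 : z ≠ 0 := norm_ne_zero_iff.1 (by rw [hz]; exact one_ne_zero)
  have h2 := key z⁻¹ (by rw [norm_inv, hz, inv_one]) (ξ + (z - 1) • P ξ)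
  suffices e : ξ + (z - 1) • P ξ + (z⁻¹ - 1) • P (ξ + (z - 1) • P ξ) = ξ by rwa [e] at h2
  have e : P ξ + (z - 1) • P ξ = z • P ξ := by module
  have e0 : z - 1 + (z⁻¹ - 1) * z = 0 := by
    field_simp
    ring
  rw [map_add, map_smul, hPP, e, smul_smul, add_assoc, ← add_smul, e0, zero_smul, add_zero]

/-- The isometries 1 + (z - 1) P preserve the disjointness of f and g. At a point where g = 0 and Pg
≠ 0, the choices z = -1 and z = i give f = 2 Pf and f = (1 - i) Pf, which force Pf = 0 and f = 0. -/
theorem IsHermitianIdempotent.aeDisjointLp_apply (hp : p ≠ ∞) (hp2 : p ≠ 2)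
    (h : IsHermitianIdempotent P) {f g : Lp ℂ p μ} (hfg : AEDisjointLp f g) :
    AEDisjointLp f (P g) := by
  have key : ∀ z : ℂ, ‖z‖ = 1 → AEDisjointLp (f + (z - 1) • P f) (g + (z - 1) • P g) := by
    intro z hz
    have := hfg.map hp hp2 (U := 1 + (z - 1) • P)
      (fun ξ => by simpa using h.norm_add_smul hz ξ)
    simpa using this
  filter_upwards [hfg, key (-1) (by simp), key Complex.I (by simp),
    Lp.coeFn_add f ((-1 - 1 : ℂ) • P f), Lp.coeFn_add g ((-1 - 1 : ℂ) • P g),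
    Lp.coeFn_add f ((Complex.I - 1) • P f), Lp.coeFn_add g ((Complex.I - 1) • P g),
    Lp.coeFn_smul (-1 - 1 : ℂ) (P f), Lp.coeFn_smul (-1 - 1 : ℂ) (P g),
    Lp.coeFn_smul (Complex.I - 1) (P f), Lp.coeFn_smul (Complex.I - 1) (P g)]
    with x h0 h1 h2 a1 a2 a3 a4 b1 b2 b3 b4
  rw [a1, a2, Pi.add_apply, Pi.add_apply, b1, b2, Pi.smul_apply, Pi.smul_apply, smul_eq_mul,
    smul_eq_mul, ← mul_eq_zero] at h1
  rw [a3, a4, Pi.add_apply, Pi.add_apply, b3, b4, Pi.smul_apply, Pi.smul_apply, smul_eq_mul,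
    smul_eq_mul, ← mul_eq_zero] at h2
  rcases h0 with h0 | h0
  · exact Or.inl h0
  · rw [or_iff_not_imp_left]
    intro hf
    rw [h0] at h1 h2
    have e1 : (P g) x * (f x - 2 * (P f) x) = 0 := by linear_combination (-1 / 2) * h1
    have e2 : (Complex.I - 1) * ((P g) x * (f x + (Complex.I - 1) * (P f) x)) = 0 := by
      linear_combination h2
    by_contra hg
    have hI : Complex.I - 1 ≠ 0 := fun h => by simpa using congrArg Complex.im h
    have hI' : Complex.I + 1 ≠ 0 := fun h => by simpa using congrArg Complex.im h
    have e1' := (mul_eq_zero.1 e1).resolve_left hg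
    have e2' := (mul_eq_zero.1 ((mul_eq_zero.1 e2).resolve_left hI)).resolve_left hg
    have e3 : (Complex.I + 1) * (P f) x = 0 := by linear_combination e2' - e1'
    have e4 := (mul_eq_zero.1 e3).resolve_left hI'
    rw [e4] at e1'
    exact hf (by simpa using e1')

/-- A hermitian idempotent on `L^p`, `p ≠ 2`, commutes with indicator functions. -/
theorem IsHermitianIdempotent.apply_restrictLp (hp : p ≠ ∞) (hp2 : p ≠ 2)
    (h : IsHermitianIdempotent P) {D : Set X} (hD : MeasurableSet D) (ξ : Lp ℂ p μ) :
    P (restrictLp hD ξ) = restrictLp hD (P ξ) := by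
  have key : ∀ {D : Set X} (hD : MeasurableSet D),
      ∀ᵐ x ∂μ, x ∉ D → P (restrictLp hD ξ) x = 0 := by
    intro D hD
    -- The part of P(1_D ξ) off D is disjoint from 1_D ξ, hence from P(1_D ξ), hence from itself; so
    -- it vanishes.
    have hd : AEDisjointLp (restrictLp hD.compl (P (restrictLp hD ξ))) (restrictLp hD ξ) := by
      filter_upwards [coeFn_restrictLp hD.compl (P (restrictLp hD ξ)), coeFn_restrictLp hD ξ]
        with x h1 h2
      rw [h1, h2]
      by_cases hx : x ∈ D <;> simp [hx]
    filter_upwards [h.aeDisjointLp_apply hp hp2 hd,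
      coeFn_restrictLp hD.compl (P (restrictLp hD ξ))] with x h1 h2 hx
    rw [h2] at h1
    simpa [hx] using h1
  have hsum : P ξ = P (restrictLp hD ξ) + P (restrictLp hD.compl ξ) := by
    rw [← map_add, restrictLp_add_restrictLp_compl]
  have hsum' := Lp.coeFn_add (P (restrictLp hD ξ)) (P (restrictLp hD.compl ξ))
  rw [← hsum] at hsum'
  refine Lp.ext ?_
  filter_upwards [key hD, key hD.compl, coeFn_restrictLp hD (P ξ), hsum'] with x h1 h2 h3 h4
  rw [h3]
  by_cases hx : x ∈ D
  · rw [Set.indicator_of_mem hx, h4, Pi.add_apply, h2 (by simpa using hx), add_zero]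
  · rw [Set.indicator_of_notMem hx, h1 hx]

/-- After squaring, the first equality says that the real part of conj(a) b vanishes, and the second
then says the same of its imaginary part. -/
theorem eq_zero_or_eq_zero_of_norm {a b : ℂ} (h1 : ‖b - a‖ = ‖b + a‖)
    (h2 : ‖b + Complex.I * a‖ = ‖b + a‖) : a = 0 ∨ b = 0 := by
  have h1' := congrArg (· ^ 2) h1
  have h2' := congrArg (· ^ 2) h2
  simp only [Complex.sq_norm, Complex.normSq_apply, Complex.sub_re, Complex.sub_im,
    Complex.add_re, Complex.add_im, Complex.mul_re, Complex.mul_im, Complex.I_re,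
    Complex.I_im] at h1' h2'
  have e1 : b.re * a.re + b.im * a.im = 0 := by linarith
  have e2 : b.im * a.re - b.re * a.im = 0 := by linarith
  have : (starRingEnd ℂ a) * b = 0 := by
    apply Complex.ext <;> simp <;> linarith
  rcases mul_eq_zero.1 this with h | h
  · exact Or.inl (by simpa using h)
  · exact Or.inr h

/-- The hermitian idempotents on `L^p`, `p ≠ 2`, are the `L^p`-projections. -/
theorem IsHermitianIdempotent.isLpProj (hp : p ≠ ∞) (hp2 : p ≠ 2)
    (h : IsHermitianIdempotent P) : IsLpProj p.toReal P := by
  refine ⟨h.idem, fun ξ => ?_⟩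
  have h0 := toReal_pos_of_fact hp
  -- The isometry 1 + (z - 1) P commutes with all indicator functions, so it preserves the integral
  -- of |ξ|^p over every measurable set, and therefore |ξ| almost everywhere.
  have key : ∀ z : ℂ, ‖z‖ = 1 → ∀ᵐ x ∂μ, ‖(ξ + (z - 1) • P ξ) x‖ = ‖ξ x‖ := by
    intro z hz
    have hae : (fun x => ‖(ξ + (z - 1) • P ξ) x‖ ^ p.toReal) =ᵐ[μ]
        fun x => ‖ξ x‖ ^ p.toReal := by
      refine Integrable.ae_eq_of_forall_setIntegral_eq _ _ (integrable_rpow hp _)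
        (integrable_rpow hp _) fun D hD _ => ?_
      rw [← norm_restrictLp_rpow hp hD, ← norm_restrictLp_rpow hp hD,
        ← h.norm_add_smul hz (restrictLp hD ξ), h.apply_restrictLp hp hp2]
      congr 2
      refine Lp.ext ?_
      filter_upwards [coeFn_restrictLp hD (ξ + (z - 1) • P ξ),
        Lp.coeFn_add ξ ((z - 1) • P ξ), Lp.coeFn_smul (z - 1) (P ξ),
        Lp.coeFn_add (restrictLp hD ξ) ((z - 1) • restrictLp hD (P ξ)),
        Lp.coeFn_smul (z - 1) (restrictLp hD (P ξ)), coeFn_restrictLp hD ξ,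
        coeFn_restrictLp hD (P ξ)] with x h1 h2 h3 h4 h5 h6 h7
      rw [h1, h4, Pi.add_apply, h5, Pi.smul_apply, h6, h7]
      by_cases hx : x ∈ D
      · simp only [Set.indicator_of_mem hx]
        rw [h2, Pi.add_apply, h3, Pi.smul_apply]
      · simp [hx]
    filter_upwards [hae] with x hx
    exact (Real.rpow_left_inj (norm_nonneg _) (norm_nonneg _) h0.ne').1 hx
  -- With a = P ξ and b = ξ - P ξ at a point, z = -1 and z = i say that b - a and b + i a have the
  -- same modulus as b + a.
  have hd : AEDisjointLp (P ξ) (ξ - P ξ) := by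
    filter_upwards [key (-1) (by simp), key Complex.I (by simp),
      Lp.coeFn_add ξ ((-1 - 1 : ℂ) • P ξ), Lp.coeFn_add ξ ((Complex.I - 1) • P ξ),
      Lp.coeFn_smul (-1 - 1 : ℂ) (P ξ), Lp.coeFn_smul (Complex.I - 1) (P ξ),
      Lp.coeFn_sub ξ (P ξ)] with x h1 h2 a1 a2 b1 b2 c
    rw [c, Pi.sub_apply]
    rw [a1, Pi.add_apply, b1, Pi.smul_apply, smul_eq_mul] at h1
    rw [a2, Pi.add_apply, b2, Pi.smul_apply, smul_eq_mul] at h2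
    refine eq_zero_or_eq_zero_of_norm ?_ ?_
    · convert h1 using 2 <;> ring
    · convert h2 using 2 <;> ring
  have := hd.norm_rpow_add hp
  rwa [add_sub_cancel] at this

end Hermitian

/-! ### Desingularization of graphs -/

namespace DirGraph

variable (Q : DirGraph.{u}) (n : Q.E → ℕ)

/-- The levels `m` at which there is a vertex over `v` in the desingularization: all of them if `v`
is singular, and those down to the last edge with range `v` if `v` is regular. -/
def IsLevel (v : Q.V) (m : ℤ) : Prop := ¬ Q.IsRegular v ∨ ∃ b, Q.r b = v ∧ -m ≤ n b

variable {Q n}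

theorem IsLevel.mono {v : Q.V} {m k : ℤ} (h : Q.IsLevel n v m) (hmk : m ≤ k) :
    Q.IsLevel n v k := by
  rcases h with h | ⟨b, hb, hm⟩
  · exact Or.inl h
  · exact Or.inr ⟨b, hb, by omega⟩

/-- The upper half of a chain, where the old edges start, is always present: a regular vertex
receives some edge b, and -m ≤ 0 ≤ n b. -/
theorem isLevel_of_nonneg (v : Q.V) {m : ℤ} (hm : 0 ≤ m) : Q.IsLevel n v m := by
  by_cases h : Q.IsRegular v
  · obtain ⟨b, hb⟩ := Set.nonempty_iff_ne_empty.2 h.1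
    exact Or.inr ⟨b, hb, by omega⟩
  · exact Or.inl h

theorem isLevel_r (b : Q.E) : Q.IsLevel n (Q.r b) (-n b) := Or.inr ⟨b, rfl, by omega⟩

variable (Q n)

/-- The desingularization of a graph with respect to a numbering of its edges: every vertex `v` is
replaced by a chain of vertices `(v, m)`, where the edge `b` starts at `(s b, n b)` and ends at
`(r b, -n b)`. -/
abbrev desing : DirGraph.{u} where
  V := {x : Q.V × ℤ // Q.IsLevel n x.1 x.2}
  E := Q.E ⊕ {x : Q.V × ℤ // Q.IsLevel n x.1 x.2}
  r := Sum.elim (fun b => ⟨(Q.r b, -n b), isLevel_r b⟩)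
    (fun x => ⟨(x.1.1, x.1.2 + 1), x.2.mono (by omega)⟩)
  s := Sum.elim (fun b => ⟨(Q.s b, n b), isLevel_of_nonneg _ (by omega)⟩) id

variable {Q n}

theorem desing_r_inl (b : Q.E) : (Q.desing n).r (Sum.inl b) = ⟨(Q.r b, -n b), isLevel_r b⟩ := rfl

theorem desing_s_inl (b : Q.E) :
    (Q.desing n).s (Sum.inl b) = ⟨(Q.s b, n b), isLevel_of_nonneg _ (by omega)⟩ := rfl

theorem desing_r_inr (x : {x : Q.V × ℤ // Q.IsLevel n x.1 x.2}) :
    (Q.desing n).r (Sum.inr x) = ⟨(x.1.1, x.1.2 + 1), x.2.mono (by omega)⟩ := rfl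

theorem desing_s_inr (x : {x : Q.V × ℤ // Q.IsLevel n x.1 x.2}) :
    (Q.desing n).s (Sum.inr x) = x := rfl

theorem desing_isCountable (hQ : Q.IsCountable) : (Q.desing n).IsCountable := by
  have := hQ.1
  have := hQ.2
  exact ⟨inferInstanceAs (Countable {x : Q.V × ℤ // Q.IsLevel n x.1 x.2}),
    inferInstanceAs (Countable (Q.E ⊕ {x : Q.V × ℤ // Q.IsLevel n x.1 x.2}))⟩

theorem desing_into_inl {v : Q.V} {m : ℤ} {h : Q.IsLevel n v m} {b : Q.E} :
    Sum.inl b ∈ (Q.desing n).into ⟨(v, m), h⟩ ↔ Q.r b = v ∧ (n b : ℤ) = -m := by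
  change (Q.desing n).r (Sum.inl b) = ⟨(v, m), h⟩ ↔ _
  rw [desing_r_inl, Subtype.ext_iff, Prod.ext_iff]
  exact and_congr_right fun _ => by dsimp only; omega

theorem desing_into_inr {v : Q.V} {m : ℤ} {h : Q.IsLevel n v m}
    {x : {x : Q.V × ℤ // Q.IsLevel n x.1 x.2}} :
    Sum.inr x ∈ (Q.desing n).into ⟨(v, m), h⟩ ↔ x.1 = (v, m - 1) := by
  change (Q.desing n).r (Sum.inr x) = ⟨(v, m), h⟩ ↔ _
  rw [desing_r_inr, Subtype.ext_iff, Prod.ext_iff, Prod.ext_iff]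
  exact and_congr_right fun _ => by dsimp only; omega

/-- Applied to the edges into or out of a vertex of the desingularization: injectivity allows at
most one old edge and at most one chain edge. -/
theorem finite_sum_of_injective {α β γ δ : Type*} {f : α → γ} (hf : Function.Injective f)
    {g : β → δ} (hg : Function.Injective g) {A : Set (α ⊕ β)} {c : γ} {d : δ}
    (h1 : ∀ a, Sum.inl a ∈ A → f a = c) (h2 : ∀ b, Sum.inr b ∈ A → g b = d) : A.Finite := by
  have hA : A ⊆ Sum.inl '' (f ⁻¹' {c}) ∪ Sum.inr '' (g ⁻¹' {d}) := by
    rintro (a | b) h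
    · exact Or.inl ⟨a, h1 a h, rfl⟩
    · exact Or.inr ⟨b, h2 b h, rfl⟩
  exact Set.Finite.subset (((Set.finite_singleton c).preimage hf.injOn).image _ |>.union
    (((Set.finite_singleton d).preimage hg.injOn).image _)) hA

theorem desing_finite_into (hn : Function.Injective n) (x : (Q.desing n).V) :
    ((Q.desing n).into x).Finite := by
  obtain ⟨⟨v, m⟩, h⟩ := x
  exact finite_sum_of_injective (f := fun b => (n b : ℤ))
    (Nat.cast_injective.comp hn) Subtype.val_injective
    (fun b hb => (desing_into_inl.1 hb).2) (fun y hy => desing_into_inr.1 hy)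

theorem desing_finite_outOf (hn : Function.Injective n) (x : (Q.desing n).V) :
    ((Q.desing n).outOf x).Finite := by
  obtain ⟨⟨v, m⟩, h⟩ := x
  refine finite_sum_of_injective (f := fun b => (n b : ℤ)) (c := m) (d := (v, m))
    (Nat.cast_injective.comp hn) Subtype.val_injective (fun b hb => ?_) (fun y hy => ?_)
  · exact congrArg (fun x => x.1.2) (show (Q.desing n).s (Sum.inl b) = _ from hb)
  · exact congrArg Subtype.val (show (Q.desing n).s (Sum.inr y) = _ from hy)

/-- A chain ends only where the last edge into v is attached. This edge enters the lowest vertex of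
the chain, which is why that vertex is not a source. -/
theorem exists_edge_of_not_isLevel {v : Q.V} {m : ℤ} (h : Q.IsLevel n v m)
    (h' : ¬ Q.IsLevel n v (m - 1)) : ∃ b, Q.r b = v ∧ (n b : ℤ) = -m := by
  rcases h with h | ⟨b, hb, hm⟩
  · exact absurd (Or.inl h) h'
  · refine ⟨b, hb, ?_⟩
    by_contra hne
    exact h' (Or.inr ⟨b, hb, by omega⟩)

theorem desing_nonempty_into (x : (Q.desing n).V) : ((Q.desing n).into x).Nonempty := by
  obtain ⟨⟨v, m⟩, h⟩ := x
  by_cases h' : Q.IsLevel n v (m - 1)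
  · exact ⟨Sum.inr ⟨(v, m - 1), h'⟩, desing_into_inr.2 rfl⟩
  · obtain ⟨b, hb⟩ := exists_edge_of_not_isLevel h h'
    exact ⟨Sum.inl b, desing_into_inl.2 hb⟩

theorem desing_isRegular (hn : Function.Injective n) (x : (Q.desing n).V) :
    (Q.desing n).IsRegular x :=
  ⟨(desing_nonempty_into x).ne_empty, fun h => h (desing_finite_into hn x)⟩

theorem desing_nonsingular (hn : Function.Injective n) (x : (Q.desing n).V) :
    ¬ (Q.desing n).IsSource x ∧ ¬ (Q.desing n).IsSink x ∧ ¬ (Q.desing n).IsInfiniteEmitter x ∧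
      ¬ (Q.desing n).IsInfiniteReceiver x :=
  ⟨(desing_isRegular hn x).1, Set.Nonempty.ne_empty ⟨Sum.inr x, desing_s_inr x⟩,
    fun h => h (desing_finite_outOf hn x), (desing_isRegular hn x).2⟩

/-! ### Entries of cycles -/

/-- A finite nonempty family of edges, closed under passing to an edge that ends where the given
one starts, contains a cycle. -/
theorem exists_cycle_of_pred {C : Set Q.E} (hC : C.Finite) (hne : C.Nonempty)
    (h : ∀ b ∈ C, ∃ b' ∈ C, Q.r b' = Q.s b) :
    ∃ (k : ℕ) (α : Fin (k + 1) → Q.E), Q.IsCycle α ∧ ∀ i, α i ∈ C := by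
  choose f hf hrf using h
  have := hC.to_subtype
  let g : C → C := fun b => ⟨f b.1 b.2, hf b.1 b.2⟩
  have hg : ∀ b : C, Q.r (g b).1 = Q.s b.1 := fun b => hrf b.1 b.2
  obtain ⟨b₀, hb₀⟩ := hne
  -- Since C is finite, iterating the choice of a predecessor repeats itself, which yields a
  -- periodic point c.
  obtain ⟨i, j, hij, heq⟩ : ∃ i j, i < j ∧ g^[i] ⟨b₀, hb₀⟩ = g^[j] ⟨b₀, hb₀⟩ := by
    obtain ⟨i, j, hij, heq⟩ := Finite.exists_ne_map_eq_of_infinite fun i => g^[i] ⟨b₀, hb₀⟩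
    rcases lt_or_gt_of_ne hij with h | h
    · exact ⟨i, j, h, heq⟩
    · exact ⟨j, i, h, heq.symm⟩
  set c := g^[i] ⟨b₀, hb₀⟩ with hc
  have hper : c ∈ Function.periodicPts g := by
    refine ⟨j - i, by omega, ?_⟩
    change g^[j - i] c = c
    conv_rhs => rw [heq]
    rw [hc, ← Function.iterate_add_apply]
    congr 2
    omega
  -- One minimal period of c is the cycle: minimality makes the edges distinct, and walking to
  -- predecessors matches the right-to-left order of paths.
  obtain ⟨k, hk⟩ : ∃ k, Function.minimalPeriod g c = k + 1 :=
    Nat.exists_eq_succ_of_ne_zero (Function.minimalPeriod_pos_of_mem_periodicPts hper).ne'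
  refine ⟨k, fun i => (g^[i] c).1, ⟨fun i => ?_, ?_, fun i j hij => ?_⟩, fun i => (g^[i] c).2⟩
  · rw [Fin.val_succ, Function.iterate_succ_apply', hg]
    rfl
  · have h1 : g^[k + 1] c = c := hk ▸ Function.iterate_minimalPeriod
    rw [← hg, Fin.val_last, ← Function.iterate_succ_apply' g, h1]
    rfl
  · refine Fin.ext (Function.iterate_injOn_Iio_minimalPeriod (f := g) (x := c) ?_ ?_
      (Subtype.ext hij))
    · rw [Set.mem_Iio, hk]
      exact i.2
    · rw [Set.mem_Iio, hk]
      exact j.2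

theorem IsCycle.exists_next {k : ℕ} {α : Fin (k + 1) → Q.E} (h : Q.IsCycle α) (i : Fin (k + 1)) :
    ∃ j, Q.r (α j) = Q.s (α i) := by
  induction i using Fin.lastCases with
  | last => exact ⟨0, h.closed⟩
  | cast i => exact ⟨i.succ, (h.isPath i).symm⟩

theorem IsCycle.exists_prev {k : ℕ} {α : Fin (k + 1) → Q.E} (h : Q.IsCycle α) (i : Fin (k + 1)) :
    ∃ j, Q.s (α j) = Q.r (α i) := by
  induction i using Fin.cases with
  | zero => exact ⟨Fin.last k, h.closed.symm⟩
  | succ i => exact ⟨i.castSucc, h.isPath i⟩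

/-- If a cycle of the desingularization has no entry, each of its vertices receives only the edge of
the cycle. Let C be the set of old edges on it. Each b in C is then the only edge of Q with range r
b, and descending the chain from the source of b meets an edge of C that ends at s b in Q. So C
contains a cycle of Q, and this cycle has no entry. -/
theorem desing_everyCycleHasEntry (hn : Function.Injective n) (hQ : Q.EveryCycleHasEntry) :
    (Q.desing n).EveryCycleHasEntry := by
  intro k α hα
  by_contra! H
  let R : Set (Q.V × ℤ) := Set.range fun i => ((Q.desing n).r (α i)).1
  -- the cycle passes through the only edge that ends at a given vertex of the cycle
  have into_inl : ∀ b, (Q.r b, -(n b : ℤ)) ∈ R → ∃ i, α i = Sum.inl b := by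
    rintro b ⟨i, hi⟩
    exact ⟨i, (H (Sum.inl b) i (Subtype.ext hi.symm)).symm⟩
  have into_inr : ∀ v m, Q.IsLevel n v m → (v, m + 1) ∈ R → ∃ (i : _) (h : Q.IsLevel n v m),
      α i = Sum.inr ⟨(v, m), h⟩ := by
    rintro v m h ⟨i, hi⟩
    exact ⟨i, h, (H (Sum.inr ⟨(v, m), h⟩) i (Subtype.ext hi.symm)).symm⟩
  have mem_r : ∀ i, ((Q.desing n).r (α i)).1 ∈ R := fun i => ⟨i, rfl⟩
  have mem_s : ∀ i, ((Q.desing n).s (α i)).1 ∈ R := fun i => by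
    obtain ⟨j, hj⟩ := hα.exists_next i
    exact ⟨j, congrArg Subtype.val hj⟩
  have level_R : ∀ v m, (v, m) ∈ R → Q.IsLevel n v m := by
    rintro v m ⟨i, hi⟩
    have := ((Q.desing n).r (α i)).2
    rw [show ((Q.desing n).r (α i)).1 = (v, m) from hi] at this
    exact this
  -- unique receiving
  have not_both : ∀ b, (Q.r b, -(n b : ℤ)) ∈ R → ¬ Q.IsLevel n (Q.r b) (-(n b : ℤ) - 1) := by
    rintro b ⟨i, hi⟩ h
    have h1 := H (Sum.inl b) i (Subtype.ext hi.symm)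
    have h2 := H (Sum.inr ⟨(Q.r b, -(n b : ℤ) - 1), h⟩) i
      (Subtype.ext (by rw [show ((Q.desing n).r (α i)).1 = _ from hi, desing_r_inr]; simp))
    rw [← h2] at h1
    cases h1
  -- going up along the chain
  have up : ∀ v (m : ℤ), (v, m) ∈ R → m < 0 → (v, m + 1) ∈ R := by
    rintro v m ⟨i, hi⟩ hm
    obtain ⟨j, hj⟩ := hα.exists_prev i
    have hj' : ((Q.desing n).s (α j)).1 = (v, m) := (congrArg Subtype.val hj).trans hi
    rcases hαj : α j with b | x
    · rw [hαj, desing_s_inl] at hj'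
      -- Old edges start at levels n b ≥ 0, so a vertex of negative level can be left only along the
      -- chain.
      have : (n b : ℤ) = m := congrArg Prod.snd hj'
      omega
    · have := mem_r j
      rw [hαj, desing_s_inr] at hj'
      rw [hαj, desing_r_inr] at this
      change (x.1.1, x.1.2 + 1) ∈ R at this
      rwa [hj'] at this
  have up' : ∀ v (j : ℕ) (m : ℤ), (v, m) ∈ R → m + j ≤ 0 → (v, m + j) ∈ R := by
    intro v j
    induction j with
    | zero => intro m h _; simpa using h
    | succ j ih =>
      intro m h hm
      have := up v _ (ih m h (by push_cast at hm; omega)) (by push_cast at hm; omega)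
      rwa [add_assoc] at this
  let C : Set Q.E := {b | ∃ i, α i = Sum.inl b}
  have unique : ∀ b ∈ C, ∀ b', Q.r b' = Q.r b → b' = b := by
    rintro b ⟨i, hi⟩ b' hb'
    have hb : (Q.r b, -(n b : ℤ)) ∈ R := by
      have := mem_r i
      rwa [hi] at this
    by_contra hne
    -- If n b' < n b, then b' is attached higher up: the cycle climbs to that vertex, where the
    -- chain edge and b' both enter. If n b' > n b, the chain continues below b, and its chain edge
    -- enters together with b.
    rcases lt_or_gt_of_ne (fun h => hne (hn h) : n b' ≠ n b) with h | h
    · have h1 := up' (Q.r b) (n b - n b') _ hb (by omega)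
      have h2 : -(n b : ℤ) + ((n b - n b' : ℕ) : ℤ) = -(n b' : ℤ) := by omega
      rw [h2, ← hb'] at h1
      refine not_both b' h1 ?_
      rw [hb']
      exact (level_R _ _ hb).mono (by omega)
    · exact not_both b hb (Or.inr ⟨b', hb', by omega⟩)
  -- going down along the chain, one meets an edge of `Q`
  have finR : R.Finite := Set.finite_range _
  obtain ⟨M, hM⟩ : ∃ M : ℤ, ∀ x ∈ R, M ≤ x.2 := by
    obtain ⟨M, hM⟩ := (finR.image Prod.snd).bddBelow
    exact ⟨M, fun x hx => hM ⟨x, hx, rfl⟩⟩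
  -- Induction on the height above the lowest level M that the cycle visits; at height 0 a further
  -- chain edge would lead below M.
  have down : ∀ (j : ℕ) v (m : ℤ), (v, m) ∈ R → m ≤ M + j → ∃ b ∈ C, Q.r b = v := by
    intro j
    induction j with
    | zero =>
      intro v m h hm
      have h1 := hM _ h
      by_cases hl : Q.IsLevel n v (m - 1)
      · obtain ⟨i, h', hi⟩ := into_inr v (m - 1) hl (by simpa using h)
        have := hM _ (mem_s i)
        rw [hi, desing_s_inr] at this
        simp at this h1 hm
        omega
      · obtain ⟨b, rfl, hb⟩ := exists_edge_of_not_isLevel (level_R _ _ h) hl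
        refine ⟨b, into_inl b ?_, rfl⟩
        rwa [hb, neg_neg]
    | succ j ih =>
      intro v m h hm
      by_cases hl : Q.IsLevel n v (m - 1)
      · obtain ⟨i, h', hi⟩ := into_inr v (m - 1) hl (by simpa using h)
        have := mem_s i
        rw [hi, desing_s_inr] at this
        exact ih v (m - 1) this (by push_cast at hm; omega)
      · obtain ⟨b, rfl, hb⟩ := exists_edge_of_not_isLevel (level_R _ _ h) hl
        refine ⟨b, into_inl b ?_, rfl⟩
        rwa [hb, neg_neg]
  have down' : ∀ v (m : ℤ), (v, m) ∈ R → ∃ b ∈ C, Q.r b = v := fun v m h =>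
    down (m - M).toNat v m h (by have := hM _ h; simp at this; omega)
  have hCfin : C.Finite := by
    have : C ⊆ Sum.inl ⁻¹' Set.range α := by
      rintro b ⟨i, hi⟩
      exact ⟨i, hi⟩
    exact ((Set.finite_range α).preimage Sum.inl_injective.injOn).subset this
  have hCne : C.Nonempty := by
    obtain ⟨b, hb, -⟩ := down' _ _ (mem_r 0)
    exact ⟨b, hb⟩
  obtain ⟨l, β, hβ, hβC⟩ := exists_cycle_of_pred hCfin hCne fun b hb => by
    obtain ⟨i, hi⟩ := hb
    have := mem_s i
    rw [hi] at this
    exact down' _ _ this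
  obtain ⟨a, i, ha, hne⟩ := hQ l β hβ
  exact hne (unique _ (hβC i) a ha)

end DirGraph

/-! ### Leavitt families -/

/-- Families in a ring that satisfy the relations of the Leavitt path algebra. -/
structure IsLeavittFamily {A : Type*} [NonUnitalRing A] (Q : DirGraph.{u}) (S T : Q.E → A)
    (E : Q.V → A) : Prop where
  idem : ∀ v, E v * E v = E v
  orth : ∀ v w, v ≠ w → E v * E w = 0
  E_S : ∀ a, E (Q.r a) * S a = S a
  S_E : ∀ a, S a * E (Q.s a) = S a
  T_E : ∀ a, T a * E (Q.r a) = T a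
  E_T : ∀ a, E (Q.s a) * T a = T a
  ck1_self : ∀ a, T a * S a = E (Q.s a)
  ck1_ne : ∀ a b, a ≠ b → T a * S b = 0
  ck2 : ∀ (v : Q.V) (h : Q.IsRegular v), E v = ∑ a ∈ h.finite.toFinset, S a * T a

theorem IsCKFamily.isLeavittFamily {A : Type*} [NormedRing A] [NormedAlgebra ℂ A]
    {Q : DirGraph.{u}} {S T : Q.E → A} {E : Q.V → A} (h : IsCKFamily Q S T E) :
    IsLeavittFamily Q S T E :=
  ⟨fun v => (h.hermitian_E v).idem, h.orthogonal_E, h.E_S, h.S_E, h.T_E, h.E_T, h.ck1_self,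
    h.ck1_ne, h.ck2⟩

/-- The other axioms follow algebraically from T_a S_a = E_(s a); hermiticity of the S_a T_a is the
one that does not. -/
theorem IsLeavittFamily.isCKFamily {A : Type*} [NormedRing A] [NormedAlgebra ℂ A]
    {Q : DirGraph.{u}} {S T : Q.E → A} {E : Q.V → A} (h : IsLeavittFamily Q S T E)
    (hE : ∀ v, IsHermitianIdempotent (E v)) (hS : ∀ a, ‖S a‖ ≤ 1) (hT : ∀ a, ‖T a‖ ≤ 1)
    (hST : ∀ a, IsHermitianIdempotent (S a * T a)) : IsCKFamily Q S T E where
  hermitian_E := hE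
  orthogonal_E := h.orth
  norm_S := hS
  norm_T := hT
  sts a := by rw [mul_assoc, h.ck1_self, h.S_E]
  tst a := by rw [h.ck1_self, h.E_T]
  hermitian_ST := hST
  hermitian_TS a := by rw [h.ck1_self]; exact hE _
  E_S := h.E_S
  S_E := h.S_E
  T_E := h.T_E
  E_T := h.E_T
  ck1_self := h.ck1_self
  ck1_ne := h.ck1_ne
  ck2 := h.ck2

theorem IsLeavittFamily.map {A B F : Type*} [NonUnitalRing A] [NonUnitalRing B] [FunLike F A B]
    [NonUnitalRingHomClass F A B] {Q : DirGraph.{u}} {S T : Q.E → A} {E : Q.V → A}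
    (h : IsLeavittFamily Q S T E) (f : F) :
    IsLeavittFamily Q (fun a => f (S a)) (fun a => f (T a)) (fun v => f (E v)) where
  idem v := by rw [← map_mul, h.idem]
  orth v w hvw := by rw [← map_mul, h.orth v w hvw, map_zero]
  E_S a := by rw [← map_mul, h.E_S]
  S_E a := by rw [← map_mul, h.S_E]
  T_E a := by rw [← map_mul, h.T_E]
  E_T a := by rw [← map_mul, h.E_T]
  ck1_self a := by rw [← map_mul, h.ck1_self]
  ck1_ne a b hab := by rw [← map_mul, h.ck1_ne a b hab, map_zero]
  ck2 v hv := by simp only [← map_mul, ← map_sum, ← h.ck2 v hv]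

/-! ### The Leavitt family of a graph in that of its desingularization -/

section Desing

variable {A : Type*} [NonUnitalRing A] {Q : DirGraph.{u}} {n : Q.E → ℕ}

open Classical in
/-- The function on all pairs `(v, m)` that extends `f` by zero. -/
def extendZero (f : {x : Q.V × ℤ // Q.IsLevel n x.1 x.2} → A) (v : Q.V) (m : ℤ) : A :=
  if h : Q.IsLevel n v m then f ⟨(v, m), h⟩ else 0

theorem extendZero_of_isLevel {f : {x : Q.V × ℤ // Q.IsLevel n x.1 x.2} → A} {v : Q.V} {m : ℤ}
    (h : Q.IsLevel n v m) : extendZero f v m = f ⟨(v, m), h⟩ := dif_pos h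

theorem extendZero_of_not {f : {x : Q.V × ℤ // Q.IsLevel n x.1 x.2} → A} {v : Q.V} {m : ℤ}
    (h : ¬ Q.IsLevel n v m) : extendZero f v m = 0 := dif_neg h

theorem extendZero_eq {f : {x : Q.V × ℤ // Q.IsLevel n x.1 x.2} → A} {g : Q.V → ℤ → A}
    (hf : ∀ x, f x = g x.1.1 x.1.2) (hg : ∀ v m, ¬ Q.IsLevel n v m → g v m = 0) (v : Q.V)
    (m : ℤ) : extendZero f v m = g v m := by
  by_cases h : Q.IsLevel n v m
  · rw [extendZero_of_isLevel h, hf]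
  · rw [extendZero_of_not h, hg v m h]

theorem extendZero_mul (f g : {x : Q.V × ℤ // Q.IsLevel n x.1 x.2} → A) (v : Q.V) (m : ℤ) :
    extendZero (fun x => f x * g x) v m = extendZero f v m * extendZero g v m := by
  by_cases h : Q.IsLevel n v m
  · simp only [extendZero_of_isLevel h]
  · simp only [extendZero_of_not h, mul_zero]

/-- The vertex at which b is attached receives b and the chain edge from below. The extension by
zero covers the case in which the chain ends there. -/
theorem sum_into_add (hn : Function.Injective n) (b : Q.E) {m : ℤ} (hm : (n b : ℤ) = -m)
    {hl : Q.IsLevel n (Q.r b) m} {hf : ((Q.desing n).into ⟨(Q.r b, m), hl⟩).Finite}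
    {f : (Q.desing n).E → A} :
    ∑ a ∈ hf.toFinset, f a = extendZero (fun x => f (Sum.inr x)) (Q.r b) (m - 1) +
      f (Sum.inl b) := by
  classical
  have hb : ∀ b', Sum.inl b' ∈ (Q.desing n).into ⟨(Q.r b, m), hl⟩ ↔ b' = b := by
    intro b'
    rw [DirGraph.desing_into_inl]
    refine ⟨fun hb' => hn (by omega), ?_⟩
    rintro rfl
    exact ⟨rfl, hm⟩
  by_cases hl' : Q.IsLevel n (Q.r b) (m - 1)
  · rw [extendZero_of_isLevel hl']
    rw [← Finset.sum_pair (f := f)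
      (a := Sum.inr ⟨(Q.r b, m - 1), hl'⟩) (b := Sum.inl b) (by simp)]
    refine Finset.sum_congr (Finset.ext ?_) fun _ _ => rfl
    rintro (b' | x)
    · simp only [Set.Finite.mem_toFinset, hb]
      simp
    · rw [Set.Finite.mem_toFinset]
      refine DirGraph.desing_into_inr.trans ?_
      simp [Subtype.ext_iff]
  · rw [extendZero_of_not hl', zero_add, ← Finset.sum_singleton f (Sum.inl b)]
    refine Finset.sum_congr (Finset.ext ?_) fun _ _ => rfl
    rintro (b' | x)
    · simp only [Set.Finite.mem_toFinset, hb]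
      simp
    · rw [Set.Finite.mem_toFinset]
      refine DirGraph.desing_into_inr.trans ?_
      simp only [Finset.mem_singleton, reduceCtorEq, iff_false]
      intro hx
      have := x.2
      rw [hx] at this
      exact hl' this

/-- Where no old edge is attached the chain cannot end, so the chain edge from below is the only
edge in the sum. -/
theorem sum_into_eq {v : Q.V} {m : ℤ} (hl : Q.IsLevel n v m)
    (hb : ∀ b, Q.r b = v → (n b : ℤ) ≠ -m) {hf : ((Q.desing n).into ⟨(v, m), hl⟩).Finite}
    {f : (Q.desing n).E → A} :
    ∑ a ∈ hf.toFinset, f a = extendZero (fun x => f (Sum.inr x)) v (m - 1) := by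
  classical
  have hl' : Q.IsLevel n v (m - 1) := by
    by_contra hl'
    obtain ⟨b, h1, h2⟩ := DirGraph.exists_edge_of_not_isLevel hl hl'
    exact hb b h1 h2
  rw [extendZero_of_isLevel hl', ← Finset.sum_singleton f (Sum.inr ⟨(v, m - 1), hl'⟩)]
  refine Finset.sum_congr (Finset.ext ?_) fun _ _ => rfl
  rintro (b' | x)
  · rw [Set.Finite.mem_toFinset]
    refine DirGraph.desing_into_inl.trans ?_
    simpa using hb b'
  · rw [Set.Finite.mem_toFinset]
    refine DirGraph.desing_into_inr.trans ?_
    simp [Subtype.ext_iff]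

theorem map_extendZero {B F : Type*} [NonUnitalRing B] [FunLike F A B]
    [NonUnitalRingHomClass F A B] (φ : F) (f : {x : Q.V × ℤ // Q.IsLevel n x.1 x.2} → A)
    (v : Q.V) (m : ℤ) : φ (extendZero f v m) = extendZero (fun x => φ (f x)) v m := by
  by_cases h : Q.IsLevel n v m
  · rw [extendZero_of_isLevel h, extendZero_of_isLevel h]
  · rw [extendZero_of_not h, extendZero_of_not h, map_zero]

variable (S T : (Q.desing n).E → A) (E : (Q.desing n).V → A)

/-- The path from `(v, 0)` to `(v, j)`. -/
def upS (v : Q.V) : ℕ → A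
  | 0 => extendZero E v 0
  | j + 1 => extendZero (fun x => S (Sum.inr x)) v j * upS v j

/-- The reverse of the path from `(v, 0)` to `(v, j)`. -/
def upT (v : Q.V) : ℕ → A
  | 0 => extendZero E v 0
  | j + 1 => upT v j * extendZero (fun x => T (Sum.inr x)) v j

/-- The path from `(v, -j)` to `(v, 0)`. -/
def downS (v : Q.V) : ℕ → A
  | 0 => extendZero E v 0
  | j + 1 => downS v j * extendZero (fun x => S (Sum.inr x)) v (-j - 1)

/-- The reverse of the path from `(v, -j)` to `(v, 0)`. -/
def downT (v : Q.V) : ℕ → A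
  | 0 => extendZero E v 0
  | j + 1 => extendZero (fun x => T (Sum.inr x)) v (-j - 1) * downT v j

/-- The path in the desingularization that represents the edge `b`. -/
def edgeS (b : Q.E) : A := downS S E (Q.r b) (n b) * S (Sum.inl b) * upS S E (Q.s b) (n b)

/-- The reverse of the path in the desingularization that represents the edge `b`. -/
def edgeT (b : Q.E) : A := upT T E (Q.s b) (n b) * T (Sum.inl b) * downT T E (Q.r b) (n b)

section Map

variable {B F : Type*} [NonUnitalRing B] [FunLike F A B] [NonUnitalRingHomClass F A B] (φ : F)

theorem map_upS (v : Q.V) (j : ℕ) :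
    φ (upS S E v j) = upS (fun a => φ (S a)) (fun x => φ (E x)) v j := by
  induction j with
  | zero => exact map_extendZero φ _ _ _
  | succ j ih => rw [upS, upS, map_mul, ih, map_extendZero]

theorem map_upT (v : Q.V) (j : ℕ) :
    φ (upT T E v j) = upT (fun a => φ (T a)) (fun x => φ (E x)) v j := by
  induction j with
  | zero => exact map_extendZero φ _ _ _
  | succ j ih => rw [upT, upT, map_mul, ih, map_extendZero]

theorem map_downS (v : Q.V) (j : ℕ) :
    φ (downS S E v j) = downS (fun a => φ (S a)) (fun x => φ (E x)) v j := by
  induction j with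
  | zero => exact map_extendZero φ _ _ _
  | succ j ih => rw [downS, downS, map_mul, ih, map_extendZero]

theorem map_downT (v : Q.V) (j : ℕ) :
    φ (downT T E v j) = downT (fun a => φ (T a)) (fun x => φ (E x)) v j := by
  induction j with
  | zero => exact map_extendZero φ _ _ _
  | succ j ih => rw [downT, downT, map_mul, ih, map_extendZero]

theorem map_edgeS (b : Q.E) :
    φ (edgeS S E b) = edgeS (fun a => φ (S a)) (fun x => φ (E x)) b := by
  simp only [edgeS, map_mul, map_upS, map_downS]

theorem map_edgeT (b : Q.E) :
    φ (edgeT T E b) = edgeT (fun a => φ (T a)) (fun x => φ (E x)) b := by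
  simp only [edgeT, map_mul, map_upT, map_downT]

end Map

variable {S T E}

namespace IsLeavittFamily

variable (h : IsLeavittFamily (Q.desing n) S T E)

local notation "ε" => extendZero E
local notation "ς" => extendZero (fun x => S (Sum.inr x))
local notation "τ" => extendZero (fun x => T (Sum.inr x))

include h

theorem level_idem (v : Q.V) (m : ℤ) : ε v m * ε v m = ε v m := by
  by_cases hl : Q.IsLevel n v m
  · rw [extendZero_of_isLevel hl, h.idem]
  · rw [extendZero_of_not hl, zero_mul]

theorem level_orth {v w : Q.V} (hvw : v ≠ w) (m k : ℤ) : ε v m * ε w k = 0 := by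
  by_cases hl : Q.IsLevel n v m
  · by_cases hl' : Q.IsLevel n w k
    · rw [extendZero_of_isLevel hl, extendZero_of_isLevel hl', h.orth]
      exact fun he => hvw (congrArg (fun x => x.1.1) he)
    · rw [extendZero_of_not hl', mul_zero]
  · rw [extendZero_of_not hl, zero_mul]

theorem level_chainS (v : Q.V) (m : ℤ) : ε v (m + 1) * ς v m = ς v m := by
  by_cases hl : Q.IsLevel n v m
  · rw [extendZero_of_isLevel hl, extendZero_of_isLevel (hl.mono (by omega : m ≤ m + 1))]
    exact h.E_S (Sum.inr ⟨(v, m), hl⟩)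
  · rw [extendZero_of_not hl, mul_zero]

theorem chainS_level (v : Q.V) (m : ℤ) : ς v m * ε v m = ς v m := by
  by_cases hl : Q.IsLevel n v m
  · rw [extendZero_of_isLevel hl, extendZero_of_isLevel hl]
    exact h.S_E (Sum.inr ⟨(v, m), hl⟩)
  · rw [extendZero_of_not hl, zero_mul]

theorem chainT_level (v : Q.V) (m : ℤ) : τ v m * ε v (m + 1) = τ v m := by
  by_cases hl : Q.IsLevel n v m
  · rw [extendZero_of_isLevel hl, extendZero_of_isLevel (hl.mono (by omega : m ≤ m + 1))]
    exact h.T_E (Sum.inr ⟨(v, m), hl⟩)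
  · rw [extendZero_of_not hl, zero_mul]

theorem level_chainT (v : Q.V) (m : ℤ) : ε v m * τ v m = τ v m := by
  by_cases hl : Q.IsLevel n v m
  · rw [extendZero_of_isLevel hl, extendZero_of_isLevel hl]
    exact h.E_T (Sum.inr ⟨(v, m), hl⟩)
  · rw [extendZero_of_not hl, extendZero_of_not hl, mul_zero]

theorem chainT_chainS (v : Q.V) (m : ℤ) : τ v m * ς v m = ε v m := by
  by_cases hl : Q.IsLevel n v m
  · rw [extendZero_of_isLevel hl, extendZero_of_isLevel hl, extendZero_of_isLevel hl]
    exact h.ck1_self (Sum.inr ⟨(v, m), hl⟩)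
  · rw [extendZero_of_not hl, extendZero_of_not hl, extendZero_of_not hl, zero_mul]

theorem chainT_edge (v : Q.V) (m : ℤ) (b : Q.E) : τ v m * S (Sum.inl b) = 0 := by
  by_cases hl : Q.IsLevel n v m
  · rw [extendZero_of_isLevel hl]
    exact h.ck1_ne _ _ (by simp)
  · rw [extendZero_of_not hl, zero_mul]

theorem edge_chainS (v : Q.V) (m : ℤ) (b : Q.E) : T (Sum.inl b) * ς v m = 0 := by
  by_cases hl : Q.IsLevel n v m
  · rw [extendZero_of_isLevel hl]
    exact h.ck1_ne _ _ (by simp)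
  · rw [extendZero_of_not hl, mul_zero]

theorem level_edge (b : Q.E) : ε (Q.r b) (-n b) * S (Sum.inl b) = S (Sum.inl b) := by
  rw [extendZero_of_isLevel (DirGraph.isLevel_r b)]
  exact h.E_S (Sum.inl b)

theorem level_edgeT (b : Q.E) : ε (Q.s b) (n b) * T (Sum.inl b) = T (Sum.inl b) := by
  rw [extendZero_of_isLevel (DirGraph.isLevel_of_nonneg _ (by omega))]
  exact h.E_T (Sum.inl b)

theorem inlT_inlS (b : Q.E) : T (Sum.inl b) * S (Sum.inl b) = ε (Q.s b) (n b) := by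
  rw [extendZero_of_isLevel (DirGraph.isLevel_of_nonneg _ (by omega))]
  exact h.ck1_self (Sum.inl b)

theorem level_eq_add (hn : Function.Injective n) (b : Q.E) {m : ℤ} (hm : (n b : ℤ) = -m) :
    ε (Q.r b) m = ς (Q.r b) (m - 1) * τ (Q.r b) (m - 1) + S (Sum.inl b) * T (Sum.inl b) := by
  have hl : Q.IsLevel n (Q.r b) m := Or.inr ⟨b, rfl, by omega⟩
  rw [extendZero_of_isLevel hl, h.ck2 _ (DirGraph.desing_isRegular hn _),
    sum_into_add hn b hm, extendZero_mul]

/-- On the chain this is the Cuntz–Krieger relation with a single summand. Below the end of the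
chain both sides are zero, since the set of levels is closed upward. -/
theorem level_eq (hn : Function.Injective n) {v : Q.V} {m : ℤ}
    (hb : ∀ b, Q.r b = v → (n b : ℤ) ≠ -m) : ε v m = ς v (m - 1) * τ v (m - 1) := by
  by_cases hl : Q.IsLevel n v m
  · rw [extendZero_of_isLevel hl, h.ck2 _ (DirGraph.desing_isRegular hn _),
      sum_into_eq hl hb, extendZero_mul]
  · rw [extendZero_of_not hl, extendZero_of_not fun h' => hl (h'.mono (by omega)), zero_mul]

theorem level_upS (v : Q.V) (j : ℕ) : ε v j * upS S E v j = upS S E v j := by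
  cases j with
  | zero => exact h.level_idem v 0
  | succ j => rw [upS, ← mul_assoc, Nat.cast_succ, h.level_chainS]

theorem upS_level (v : Q.V) (j : ℕ) : upS S E v j * ε v 0 = upS S E v j := by
  induction j with
  | zero => exact h.level_idem v 0
  | succ j ih => rw [upS, mul_assoc, ih]

theorem level_upT (v : Q.V) (j : ℕ) : ε v 0 * upT T E v j = upT T E v j := by
  induction j with
  | zero => exact h.level_idem v 0
  | succ j ih => rw [upT, ← mul_assoc, ih]

theorem upT_upS (v : Q.V) (j : ℕ) : upT T E v j * upS S E v j = ε v 0 := by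
  induction j with
  | zero => exact h.level_idem v 0
  | succ j ih =>
    rw [upS, upT, mul_assoc, ← mul_assoc (τ v j), h.chainT_chainS, h.level_upS, ih]

/-- Above level 0 a vertex receives only its chain edge, because -n b ≤ 0, so the relations lose
nothing along the way. Below level 0 only the product in the other order, `downT_downS`, is an
idempotent at a vertex. -/
theorem upS_upT (hn : Function.Injective n) (v : Q.V) (j : ℕ) :
    upS S E v j * upT T E v j = ε v j := by
  induction j with
  | zero => exact h.level_idem v 0
  | succ j ih =>
    rw [upS, upT, mul_assoc, ← mul_assoc (upS S E v j), ih, h.level_chainT, Nat.cast_succ,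
      h.level_eq hn (m := (j : ℤ) + 1) (fun b _ => by omega), add_sub_cancel_right]

theorem level_downS (v : Q.V) (j : ℕ) : ε v 0 * downS S E v j = downS S E v j := by
  induction j with
  | zero => exact h.level_idem v 0
  | succ j ih => rw [downS, ← mul_assoc, ih]

theorem downS_level (v : Q.V) (j : ℕ) : downS S E v j * ε v (-j) = downS S E v j := by
  cases j with
  | zero => exact h.level_idem v 0
  | succ j =>
    rw [downS, mul_assoc, show (-((j + 1 : ℕ) : ℤ)) = -j - 1 by push_cast; ring, h.chainS_level]

theorem downT_level (v : Q.V) (j : ℕ) : downT T E v j * ε v 0 = downT T E v j := by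
  induction j with
  | zero => exact h.level_idem v 0
  | succ j ih => rw [downT, mul_assoc, ih]

theorem level_chainS' (v : Q.V) (m : ℤ) : ε v m * ς v (m - 1) = ς v (m - 1) := by
  simpa using h.level_chainS v (m - 1)

theorem chainT_level' (v : Q.V) (m : ℤ) : τ v (m - 1) * ε v m = τ v (m - 1) := by
  simpa using h.chainT_level v (m - 1)

theorem downT_downS (v : Q.V) (j : ℕ) : downT T E v j * downS S E v j = ε v (-j) := by
  induction j with
  | zero => exact h.level_idem v 0
  | succ j ih =>
    rw [downS, downT, mul_assoc, ← mul_assoc (downT T E v j), ih, h.level_chainS',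
      h.chainT_chainS]
    congr 1
    push_cast
    ring

/-- For two paths that descend over the same vertex: after cancelling the common part, the longer
one begins with the chain edge below level -j, which is orthogonal to an old edge attached at level
-j. -/
theorem downT_downS_of_lt (v : Q.V) {j k : ℕ} (hjk : j < k) :
    ∃ x, downT T E v j * downS S E v k = ς v (-j - 1) * x := by
  induction k, hjk using Nat.le_induction with
  | base =>
    refine ⟨ε v (-j - 1), ?_⟩
    rw [downS, ← mul_assoc, h.downT_downS, h.level_chainS', h.chainS_level]
  | succ k hk ih =>
    obtain ⟨x, hx⟩ := ih
    refine ⟨x * ς v (-k - 1), ?_⟩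
    rw [downS, ← mul_assoc, hx, mul_assoc]

theorem downT_downS_of_gt (v : Q.V) {j k : ℕ} (hjk : j < k) :
    ∃ x, downT T E v k * downS S E v j = x * τ v (-j - 1) := by
  induction k, hjk using Nat.le_induction with
  | base =>
    refine ⟨ε v (-j - 1), ?_⟩
    rw [downT, mul_assoc, h.downT_downS, h.chainT_level', h.level_chainT]
  | succ k hk ih =>
    obtain ⟨x, hx⟩ := ih
    refine ⟨τ v (-k - 1) * x, ?_⟩
    rw [downT, mul_assoc, hx, mul_assoc]

/-- Edges with different ranges are separated by the idempotents at level 0. Edges with the same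
range are attached at different levels, and at the upper one of these one path takes the old edge
while the other takes the chain edge. -/
theorem edgeT_mul_edgeS_ne (hn : Function.Injective n) {a b : Q.E} (hab : a ≠ b) :
    edgeT T E a * edgeS S E b = 0 := by
  suffices H : T (Sum.inl a) * (downT T E (Q.r a) (n a) * downS S E (Q.r b) (n b)) *
      S (Sum.inl b) = 0 by
    have : edgeT T E a * edgeS S E b = upT T E (Q.s a) (n a) *
        (T (Sum.inl a) * (downT T E (Q.r a) (n a) * downS S E (Q.r b) (n b)) *
      S (Sum.inl b)) * upS S E (Q.s b) (n b) := by
      simp only [edgeS, edgeT, mul_assoc]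
    rw [this, H, mul_zero, zero_mul]
  by_cases hr : Q.r a = Q.r b
  · rw [hr]
    rcases lt_or_gt_of_ne (fun he => hab (hn he) : n a ≠ n b) with hlt | hlt
    · obtain ⟨x, hx⟩ := h.downT_downS_of_lt (Q.r b) hlt
      rw [hx, ← mul_assoc, h.edge_chainS, zero_mul, zero_mul]
    · obtain ⟨x, hx⟩ := h.downT_downS_of_gt (Q.r b) hlt
      rw [hx, mul_assoc, mul_assoc, h.chainT_edge, mul_zero, mul_zero]
  · rw [← h.downT_level, ← h.level_downS (Q.r b), mul_assoc (downT T E (Q.r a) (n a)),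
      ← mul_assoc (ε (Q.r a) 0), h.level_orth hr, zero_mul, mul_zero, mul_zero, zero_mul]

theorem edgeS_mul_edgeT (hn : Function.Injective n) (b : Q.E) : edgeS S E b * edgeT T E b =
    downS S E (Q.r b) (n b) * (S (Sum.inl b) * T (Sum.inl b)) * downT T E (Q.r b) (n b) := by
  have : edgeS S E b * edgeT T E b = downS S E (Q.r b) (n b) * (S (Sum.inl b) *
      ((upS S E (Q.s b) (n b) * upT T E (Q.s b) (n b)) * T (Sum.inl b))) *
        downT T E (Q.r b) (n b) := by
    simp only [edgeS, edgeT, mul_assoc]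
  rw [this, h.upS_upT hn, h.level_edgeT]

/-- Repeated use of the Cuntz–Krieger relation down the chain: each of the first k levels splits off
the old edge attached there, if any, and leaves the part that descends to level -k. -/
theorem level_eq_sum (hn : Function.Injective n) {v : Q.V} (F : Finset Q.E)
    (hF : ∀ b, b ∈ F ↔ Q.r b = v) (k : ℕ) : ε v 0 = downS S E v k * downT T E v k +
      ∑ b ∈ F.filter (fun b => n b < k), edgeS S E b * edgeT T E b := by
  classical
  induction k with
  | zero =>
    rw [downS, downT, h.level_idem]
    simp
  | succ k ih =>
    -- This inserts the idempotent at level -k in the middle of the remainder, where it can be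
    -- expanded.
    rw [ih, ← h.downS_level v k]
    by_cases hb : ∃ b, Q.r b = v ∧ n b = k
    · obtain ⟨b, rfl, rfl⟩ := hb
      have e : F.filter (fun b' => n b' < n b + 1) =
          insert b (F.filter (fun b' => n b' < n b)) := by
        ext b'
        simp only [Finset.mem_filter, Finset.mem_insert, hF, Nat.lt_succ_iff_lt_or_eq]
        constructor
        · rintro ⟨h1, h2 | h2⟩
          · exact Or.inr ⟨h1, h2⟩
          · exact Or.inl (hn h2)
        · rintro (rfl | ⟨h1, h2⟩)
          · exact ⟨rfl, Or.inr rfl⟩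
          · exact ⟨h1, Or.inl h2⟩
      rw [e, Finset.sum_insert (by simp), h.edgeS_mul_edgeT hn b, ← add_assoc]
      congr 1
      rw [h.level_eq_add hn b (m := -(n b : ℤ)) (by omega), downS, downT, mul_add, add_mul]
      simp only [mul_assoc]
    · push Not at hb
      have e : F.filter (fun b' => n b' < k + 1) = F.filter (fun b' => n b' < k) := by
        refine Finset.filter_congr fun b' hb' => ?_
        have := hb b' ((hF b').1 hb')
        omega
      rw [e]
      congr 1
      rw [h.level_eq hn (v := v) (m := -(k : ℤ)) (fun b hb' => by have := hb b hb'; omega),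
        downS, downT]
      simp only [mul_assoc]

/-- A Leavitt family of the desingularization induces one of the graph. -/
theorem ofDesing (hn : Function.Injective n) :
    IsLeavittFamily Q (edgeS S E) (edgeT T E) (fun v => ε v 0) where
  idem v := h.level_idem v 0
  orth v w hvw := h.level_orth hvw 0 0
  E_S a := by rw [edgeS, ← mul_assoc, ← mul_assoc, h.level_downS]
  S_E a := by rw [edgeS, mul_assoc, h.upS_level]
  T_E a := by rw [edgeT, mul_assoc, h.downT_level]
  E_T a := by rw [edgeT, ← mul_assoc, ← mul_assoc, h.level_upT]
  ck1_self a := by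
    have : edgeT T E a * edgeS S E a = upT T E (Q.s a) (n a) * (T (Sum.inl a) *
        ((downT T E (Q.r a) (n a) * downS S E (Q.r a) (n a)) *
        S (Sum.inl a)) * upS S E (Q.s a) (n a)) := by
      simp only [edgeS, edgeT, mul_assoc]
    rw [this, h.downT_downS, h.level_edge, h.inlT_inlS, h.level_upS, h.upT_upS]
  ck1_ne a b hab := h.edgeT_mul_edgeS_ne hn hab
  ck2 v hv := by
    have h1 := h.level_eq_sum hn (v := v) hv.finite.toFinset (fun b => by simp [DirGraph.into])
      (hv.finite.toFinset.sup n + 1)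
    -- One level below the last edge into the regular vertex v the chain has ended. The remainder
    -- vanishes there, and all edges into v have been split off.
    have h2 : ¬ Q.IsLevel n v (-((hv.finite.toFinset.sup n + 1 : ℕ) : ℤ)) := by
      rintro (h2 | ⟨b, hb, h2⟩)
      · exact h2 hv
      · have := Finset.le_sup (f := n) (hv.finite.mem_toFinset.2 hb)
        omega
    rw [← h.downS_level, extendZero_of_not h2, mul_zero, zero_mul, zero_add,
      Finset.filter_true_of_mem] at h1
    · exact h1
    · intro b hb
      have := Finset.le_sup (f := n) hb
      omega

end IsLeavittFamily

end Desing

/-! ### Homomorphisms between Leavitt path algebras and their completions -/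

namespace Leavitt

variable {Q Q' : DirGraph.{u}}

/-- The inclusion of the Leavitt path algebra into its unitization. -/
def incl : Leavitt Q →ₙₐ[ℂ] UnitalLeavitt Q where
  toFun x := x.1
  map_zero' := rfl
  map_add' _ _ := rfl
  map_mul' _ _ := rfl
  map_smul' _ _ := rfl

theorem incl_injective : Function.Injective (incl (Q := Q)) := Subtype.val_injective

theorem isLeavittFamily : IsLeavittFamily Q (s (Q := Q)) t e := by
  have key : ∀ {x y}, LeavittRel Q x y → RingQuot.mkAlgHom ℂ (LeavittRel Q) x =
    RingQuot.mkAlgHom ℂ (LeavittRel Q) y := fun h => RingQuot.mkAlgHom_rel ℂ h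
  have hg : ∀ y, incl (gen y) = RingQuot.mkAlgHom ℂ (LeavittRel Q) (FreeAlgebra.ι ℂ y) :=
    fun _ => rfl
  constructor
  · exact fun v => incl_injective (by simpa [s, t, e, hg] using key (.idem v))
  · exact fun v w hvw => incl_injective (by simpa [s, t, e, hg] using key (.orth v w hvw))
  · exact fun a => incl_injective (by simpa [s, t, e, hg] using key (.e_s a))
  · exact fun a => incl_injective (by simpa [s, t, e, hg] using key (.s_e a))
  · exact fun a => incl_injective (by simpa [s, t, e, hg] using key (.t_e a))
  · exact fun a => incl_injective (by simpa [s, t, e, hg] using key (.e_t a))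
  · exact fun a => incl_injective (by simpa [s, t, e, hg] using key (.ck1_self a))
  · exact fun a b hab => incl_injective (by simpa [s, t, e, hg] using key (.ck1_ne a b hab))
  · exact fun v hv => incl_injective (by simpa [s, t, e, hg, map_sum] using key (.ck2 v hv))

theorem induction {P : Leavitt Q → Prop} (x : Leavitt Q) (gen : ∀ y, P (gen y)) (zero : P 0)
    (add : ∀ x y, P x → P y → P (x + y)) (mul : ∀ x y, P x → P y → P (x * y))
    (smul : ∀ (c : ℂ) x, P x → P (c • x)) : P x := by
  obtain ⟨x, hx⟩ := x
  induction hx using NonUnitalAlgebra.adjoin_induction with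
  | mem x hx =>
    obtain ⟨y, rfl⟩ := hx
    exact gen y
  | zero => exact zero
  | add x y hx hy h1 h2 => exact add ⟨x, hx⟩ ⟨y, hy⟩ h1 h2
  | mul x y hx hy h1 h2 => exact mul ⟨x, hx⟩ ⟨y, hy⟩ h1 h2
  | smul r x hx h1 => exact smul r ⟨x, hx⟩ h1

theorem hom_ext {B : Type*} [NonUnitalRing B] [Module ℂ B] {f g : Leavitt Q →ₙₐ[ℂ] B}
    (h : ∀ y, f (gen y) = g (gen y)) : f = g := by
  refine NonUnitalAlgHom.ext fun x => ?_
  induction x using induction with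
  | gen y => exact h y
  | zero => rw [map_zero, map_zero]
  | add x y h1 h2 => rw [map_add, map_add, h1, h2]
  | mul x y h1 h2 => rw [map_mul, map_mul, h1, h2]
  | smul c x h1 => rw [map_smul, map_smul, h1]

section MapOf

variable {S T : Q.E → Leavitt Q'} {E : Q.V → Leavitt Q'}

/-- The presentation has its universal property among unital algebras, so the homomorphism is built
on the unitizations and then restricted. -/
theorem mapOf_rel (h : IsLeavittFamily Q S T E) ⦃x y : FreeAlgebra ℂ (LeavittGen Q)⦄
    (hxy : LeavittRel Q x y) :
    FreeAlgebra.lift ℂ (fun z => incl (genMap S T E z)) x =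
      FreeAlgebra.lift ℂ (fun z => incl (genMap S T E z)) y := by
  have h := h.map (incl (Q := Q'))
  cases hxy with
  | idem v => simpa [genMap] using h.idem v
  | orth v w hvw => simpa [genMap] using h.orth v w hvw
  | e_s a => simpa [genMap] using h.E_S a
  | s_e a => simpa [genMap] using h.S_E a
  | t_e a => simpa [genMap] using h.T_E a
  | e_t a => simpa [genMap] using h.E_T a
  | ck1_self a => simpa [genMap] using h.ck1_self a
  | ck1_ne a b hab => simpa [genMap] using h.ck1_ne a b hab
  | ck2 v hv => simpa [genMap, map_sum] using h.ck2 v hv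

/-- The extension of `mapOf` to the unital algebras. -/
def unitalMapOf (h : IsLeavittFamily Q S T E) : UnitalLeavitt Q →ₐ[ℂ] UnitalLeavitt Q' :=
  RingQuot.liftAlgHom ℂ ⟨FreeAlgebra.lift ℂ (fun z => incl (genMap S T E z)), mapOf_rel h⟩

theorem unitalMapOf_gen (h : IsLeavittFamily Q S T E) (x : LeavittGen Q) :
    unitalMapOf h (unitalGen x) = incl (genMap S T E x) := by
  rw [unitalMapOf, unitalGen, RingQuot.liftAlgHom_mkAlgHom_apply, FreeAlgebra.lift_ι_apply]

theorem unitalMapOf_mem (h : IsLeavittFamily Q S T E) (x : Leavitt Q) :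
    unitalMapOf h x.1 ∈ NonUnitalAlgebra.adjoin ℂ (Set.range (unitalGen (Q := Q'))) := by
  induction x using induction with
  | gen y =>
    change unitalMapOf h (unitalGen y) ∈ _
    rw [unitalMapOf_gen]
    exact (genMap S T E y).2
  | zero => exact (map_zero (unitalMapOf h)).symm ▸ zero_mem _
  | add x y h1 h2 => exact (map_add (unitalMapOf h) x.1 y.1).symm ▸ add_mem h1 h2
  | mul x y h1 h2 => exact (map_mul (unitalMapOf h) x.1 y.1).symm ▸ mul_mem h1 h2
  | smul c x h1 =>
    exact (map_smul (unitalMapOf h) c x.1).symm ▸ SMulMemClass.smul_mem c h1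

/-- The homomorphism between Leavitt path algebras that a Leavitt family induces. -/
def mapOf (h : IsLeavittFamily Q S T E) : Leavitt Q →ₙₐ[ℂ] Leavitt Q' where
  toFun x := ⟨unitalMapOf h x.1, unitalMapOf_mem h x⟩
  map_zero' := Subtype.ext (map_zero (unitalMapOf h))
  map_add' x y := Subtype.ext (map_add (unitalMapOf h) x.1 y.1)
  map_mul' x y := Subtype.ext (map_mul (unitalMapOf h) x.1 y.1)
  map_smul' c x := Subtype.ext (map_smul (unitalMapOf h) c x.1)

theorem mapOf_gen (h : IsLeavittFamily Q S T E) (x : LeavittGen Q) :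
    mapOf h (gen x) = genMap S T E x := Subtype.ext (unitalMapOf_gen h x)

end MapOf

end Leavitt

/-! ### Extension of isometric homomorphisms to completions -/

namespace AlgCompletion

open UniformSpace

variable {A B : Type*} [NonUnitalSeminormedRing A] [NormedSpace ℂ A] [NonUnitalSeminormedRing B]
  [NormedSpace ℂ B]

theorem isometry_of_comp {f : A →ₙₐ[ℂ] B} (hf : ∀ x, ‖f x‖ = ‖x‖) :
    Isometry fun a => (of (f a) : AlgCompletion B) :=
  AddMonoidHomClass.isometry_of_norm ((of : B →+ AlgCompletion B).comp (f : A →+ B))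
    fun a => (norm_of (f a)).trans (hf a)

/-- The extension of an isometric homomorphism to the completions. -/
def mapFun (f : A →ₙₐ[ℂ] B) : AlgCompletion A → AlgCompletion B :=
  Completion.extension fun a => (of (f a) : AlgCompletion B)

theorem continuous_mapFun (f : A →ₙₐ[ℂ] B) : Continuous (mapFun f) :=
  Completion.continuous_extension

theorem mapFun_of {f : A →ₙₐ[ℂ] B} (hf : ∀ x, ‖f x‖ = ‖x‖) (a : A) :
    mapFun f (of a) = of (f a) :=
  Completion.extension_coe (isometry_of_comp hf).uniformContinuous a

/-- The homomorphism between the completions that an isometric homomorphism induces. -/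
def mapHom (f : A →ₙₐ[ℂ] B) (hf : ∀ x, ‖f x‖ = ‖x‖) : AlgCompletion A →ₙₐ[ℂ] AlgCompletion B where
  toFun := mapFun f
  map_zero' := by rw [← map_zero of, mapFun_of hf, map_zero, map_zero]
  map_add' x y := by
    have hg := continuous_mapFun f
    refine induction_on₂ (P := fun x y => mapFun f (x + y) = mapFun f x + mapFun f y) x y
      (isClosed_eq (by fun_prop) (by fun_prop)) fun a b => ?_
    rw [← map_add, mapFun_of hf, mapFun_of hf, mapFun_of hf, map_add, map_add]
  map_mul' x y := by
    have hg := continuous_mapFun f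
    refine induction_on₂ (P := fun x y => mapFun f (x * y) = mapFun f x * mapFun f y) x y
      (isClosed_eq (by fun_prop) (by fun_prop)) fun a b => ?_
    rw [← of_mul, mapFun_of hf, mapFun_of hf, mapFun_of hf, map_mul, of_mul]
  map_smul' c x := by
    have hg := continuous_mapFun f
    refine induction_on (P := fun x => mapFun f (c • x) = c • mapFun f x) x
      (isClosed_eq (hg.comp (continuous_const_smul c)) (hg.const_smul c)) fun a => ?_
    rw [← of_smul, mapFun_of hf, mapFun_of hf, map_smul, of_smul]

theorem mapHom_of {f : A →ₙₐ[ℂ] B} (hf : ∀ x, ‖f x‖ = ‖x‖) (a : A) :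
    mapHom f hf (of a) = of (f a) := mapFun_of hf a

theorem isometry_mapHom {f : A →ₙₐ[ℂ] B} (hf : ∀ x, ‖f x‖ = ‖x‖) : Isometry (mapHom f hf) :=
  (isometry_of_comp hf).completion_extension

end AlgCompletion

/-! ### Restriction of Cuntz–Krieger families of the desingularization -/

section Restriction

variable {p : ℝ≥0∞} [Fact (1 ≤ p)] {Q : DirGraph.{u}} {n : Q.E → ℕ}
  {X : Type*} [MeasurableSpace X] {μ : Measure X}
  {S T : (Q.desing n).E → LpOp p μ} {E : (Q.desing n).V → LpOp p μ}

theorem norm_apply_le {c : LpOp p μ} (hc : ‖c‖ ≤ 1) (ξ : Lp ℂ p μ) : ‖c ξ‖ ≤ ‖ξ‖ := by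
  simpa using c.le_of_opNorm_le hc ξ

theorem norm_mul_le_one {c d : LpOp p μ} (hc : ‖c‖ ≤ 1) (hd : ‖d‖ ≤ 1) : ‖c * d‖ ≤ 1 :=
  (norm_mul_le c d).trans (mul_le_one₀ hc (norm_nonneg d) hd)

theorem norm_extendZero_le {f : {x : Q.V × ℤ // Q.IsLevel n x.1 x.2} → LpOp p μ}
    (hf : ∀ x, ‖f x‖ ≤ 1) (v : Q.V) (m : ℤ) : ‖extendZero f v m‖ ≤ 1 := by
  by_cases h : Q.IsLevel n v m
  · rw [extendZero_of_isLevel h]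
    exact hf _
  · rw [extendZero_of_not h, norm_zero]
    exact zero_le_one

theorem isLpProj_extendZero (hp : p ≠ ∞) {f : {x : Q.V × ℤ // Q.IsLevel n x.1 x.2} → LpOp p μ}
    (hf : ∀ x, IsLpProj p.toReal (f x)) (v : Q.V) (m : ℤ) :
    IsLpProj p.toReal (extendZero f v m) := by
  by_cases h : Q.IsLevel n v m
  · rw [extendZero_of_isLevel h]
    exact hf _
  · rw [extendZero_of_not h]
    exact IsLpProj.zero (toReal_pos_of_fact hp)

theorem IsLpProj.conj_mul {q : ℝ} {c d P : LpOp p μ} (hP : IsLpProj q P) (hc : ‖c‖ ≤ 1)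
    (hd : ‖d‖ ≤ 1) (hcd : IsLpProj q (c * d)) (h1 : d * c * P = P) (h2 : d * c * d = d) :
    IsLpProj q (c * P * d) :=
  IsLpProj.conj (norm_apply_le hc) (norm_apply_le hd) hcd hP (fun ξ => DFunLike.congr_fun h1 ξ)
    (fun ξ => DFunLike.congr_fun h2 ξ)

variable (h : IsCKFamily (Q.desing n) S T E)

include h

/-- A product of partial isometries need not have a hermitian range idempotent. Here the conjugation
is done one chain edge at a time, each time under the L^p-projection S T of that edge. -/
theorem IsCKFamily.isLpProj_down (hp : p ≠ ∞) (hp2 : p ≠ 2) (v : Q.V) (j : ℕ) {P : LpOp p μ}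
    (hP : IsLpProj p.toReal P) (hPE : extendZero E v (-j) * P = P) :
    IsLpProj p.toReal (downS S E v j * P * downT T E v j) := by
  have hL := h.isLeavittFamily
  induction j generalizing P with
  | zero =>
    rw [Nat.cast_zero, neg_zero] at hPE
    have hn1 := norm_extendZero_le (fun x => (h.hermitian_E x).norm_le_one) v 0
    rw [downS, downT]
    refine hP.conj_mul hn1 hn1 ?_ ?_ ?_
    · rw [hL.level_idem]
      exact isLpProj_extendZero hp (fun x => (h.hermitian_E x).isLpProj hp hp2) v 0
    · rw [hL.level_idem, hPE]
    · rw [hL.level_idem, hL.level_idem]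
  | succ j ih =>
    have e : -((j + 1 : ℕ) : ℤ) = -j - 1 := by push_cast; ring
    rw [e] at hPE
    -- The lowest chain edge is absorbed into P, which turns it into a projection at level -j.
    have key := ih (P := extendZero (fun x => S (Sum.inr x)) v (-j - 1) * P *
      extendZero (fun x => T (Sum.inr x)) v (-j - 1)) ?_ ?_
    · simpa only [downS, downT, mul_assoc] using key
    · refine hP.conj_mul (norm_extendZero_le (fun x => h.norm_S _) v _)
        (norm_extendZero_le (fun x => h.norm_T _) v _) ?_ ?_ ?_
      · rw [← extendZero_mul]
        exact isLpProj_extendZero hp (fun x => (h.hermitian_ST _).isLpProj hp hp2) v _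
      · rw [hL.chainT_chainS, hPE]
      · rw [hL.chainT_chainS, hL.level_chainT]
    · rw [← mul_assoc, ← mul_assoc, hL.level_chainS']

theorem IsCKFamily.norm_upS_le (v : Q.V) (j : ℕ) : ‖upS S E v j‖ ≤ 1 := by
  induction j with
  | zero => exact norm_extendZero_le (fun x => (h.hermitian_E x).norm_le_one) v 0
  | succ j ih => exact norm_mul_le_one (norm_extendZero_le (fun x => h.norm_S _) v _) ih

theorem IsCKFamily.norm_upT_le (v : Q.V) (j : ℕ) : ‖upT T E v j‖ ≤ 1 := by
  induction j with
  | zero => exact norm_extendZero_le (fun x => (h.hermitian_E x).norm_le_one) v 0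
  | succ j ih => exact norm_mul_le_one ih (norm_extendZero_le (fun x => h.norm_T _) v _)

theorem IsCKFamily.norm_downS_le (v : Q.V) (j : ℕ) : ‖downS S E v j‖ ≤ 1 := by
  induction j with
  | zero => exact norm_extendZero_le (fun x => (h.hermitian_E x).norm_le_one) v 0
  | succ j ih => exact norm_mul_le_one ih (norm_extendZero_le (fun x => h.norm_S _) v _)

theorem IsCKFamily.norm_downT_le (v : Q.V) (j : ℕ) : ‖downT T E v j‖ ≤ 1 := by
  induction j with
  | zero => exact norm_extendZero_le (fun x => (h.hermitian_E x).norm_le_one) v 0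
  | succ j ih => exact norm_mul_le_one (norm_extendZero_le (fun x => h.norm_T _) v _) ih

/-- A Cuntz–Krieger family of the desingularization on an `L^p`-space, `p ≠ 2`, induces one of the
graph. -/
theorem IsCKFamily.ofDesing (hp : p ≠ ∞) (hp2 : p ≠ 2) (hn : Function.Injective n) :
    IsCKFamily Q (edgeS S E) (edgeT T E) (fun v => extendZero E v 0) := by
  have hL := h.isLeavittFamily
  refine (hL.ofDesing hn).isCKFamily (fun v => ?_) (fun a => ?_) (fun a => ?_) (fun a => ?_)
  · exact (isLpProj_extendZero hp (fun x => (h.hermitian_E x).isLpProj hp hp2)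
      v 0).isHermitianIdempotent (toReal_pos_of_fact hp)
  · exact norm_mul_le_one (norm_mul_le_one (h.norm_downS_le _ _) (h.norm_S _))
      (h.norm_upS_le _ _)
  · exact norm_mul_le_one (norm_mul_le_one (h.norm_upT_le _ _) (h.norm_T _))
      (h.norm_downT_le _ _)
  -- The ascending part of the path cancels, and S_b T_b is conjugated by the path from level -n b
  -- to level 0.
  · rw [hL.edgeS_mul_edgeT hn]
    refine (h.isLpProj_down hp hp2 _ _ ((h.hermitian_ST _).isLpProj hp hp2)
      ?_).isHermitianIdempotent (toReal_pos_of_fact hp)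
    rw [← mul_assoc, hL.level_edge]

end Restriction

/-! ### Countably many copies of a measure space -/

section Copies

variable {X : Type*} [MeasurableSpace X]

/-- The inclusion of the copy `m`. -/
abbrev mkCopy {X : Type*} (m : ℤ) (x : X) : Σ _ : ℤ, X := ⟨m, x⟩

theorem measurableSet_sigma_iff {A : Set (Σ _ : ℤ, X)} :
    MeasurableSet A ↔ ∀ m : ℤ, MeasurableSet (mkCopy m ⁻¹' A) :=
  MeasurableSpace.measurableSet_iInf

theorem preimage_mk_image_mk {X : Type*} (m k : ℤ) (A : Set X) [Decidable (k = m)] :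
    (mkCopy k ⁻¹' (mkCopy m '' A : Set (Σ _ : ℤ, X))) = if k = m then A else ∅ := by
  ext x
  split_ifs with h
  · subst h
    simp
  · simp [Ne.symm h]

theorem measurableEmbedding_mk (m : ℤ) :
    MeasurableEmbedding (mkCopy m : X → Σ _ : ℤ, X) where
  injective x y h := by simpa using h
  measurable A hA := measurableSet_sigma_iff.1 hA m
  measurableSet_image' A hA := measurableSet_sigma_iff.2 fun k => by
    classical
    rw [preimage_mk_image_mk]
    split_ifs
    exacts [hA, MeasurableSet.empty]

/-- The measure on the disjoint union of copies of `X` indexed by `ℤ`. -/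
def copies (μ : Measure X) : Measure (Σ _ : ℤ, X) := Measure.sum fun m => μ.map (mkCopy m)

variable {μ : Measure X}

theorem ae_copies_iff {P : (Σ _ : ℤ, X) → Prop} :
    (∀ᵐ y ∂(copies μ), P y) ↔ ∀ m : ℤ, ∀ᵐ x ∂μ, P ⟨m, x⟩ := by
  rw [copies, Measure.ae_sum_iff]
  exact forall_congr' fun m => (measurableEmbedding_mk m).ae_map_iff

theorem copies_apply {A : Set (Σ _ : ℤ, X)} (hA : MeasurableSet A) :
    copies μ A = ∑' m : ℤ, μ (mkCopy m ⁻¹' A) := by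
  rw [copies, Measure.sum_apply _ hA]
  exact tsum_congr fun m => (measurableEmbedding_mk m).map_apply μ A

theorem copies_image_mk (m : ℤ) {A : Set X} (hA : MeasurableSet A) :
    copies μ (mkCopy m '' A) = μ A := by
  classical
  rw [copies_apply ((measurableEmbedding_mk m).measurableSet_image.2 hA), tsum_eq_single m]
  · rw [preimage_mk_image_mk, if_pos rfl]
  · intro k hk
    rw [preimage_mk_image_mk, if_neg hk, measure_empty]

theorem copies_eq_zero_iff {A : Set (Σ _ : ℤ, X)} (hA : MeasurableSet A) :
    copies μ A = 0 ↔ ∀ m : ℤ, μ (mkCopy m ⁻¹' A) = 0 := by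
  rw [copies_apply hA, ENNReal.tsum_eq_zero]

/-- A set of infinite measure has a slice of positive measure, which contains a set of positive
finite measure. Essential suprema are taken on each copy and glued; measurability and nullity on the
union are tested slice by slice. -/
theorem IsLocalizable.copies (h : IsLocalizable μ) : IsLocalizable (copies μ) where
  semifinite A hA hinf := by
    obtain ⟨m, hm⟩ : ∃ m : ℤ, μ (mkCopy m ⁻¹' A) ≠ 0 := by
      by_contra! H
      rw [(copies_eq_zero_iff hA).2 H] at hinf
      exact ENNReal.zero_ne_top hinf
    have hAm := measurableSet_sigma_iff.1 hA m
    obtain ⟨B, hBA, hB, h0, h1⟩ : ∃ B ⊆ mkCopy m ⁻¹' A, MeasurableSet B ∧ 0 < μ B ∧ μ B < ∞ := by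
      by_cases hi : μ (mkCopy m ⁻¹' A) = ∞
      · exact h.semifinite _ hAm hi
      · exact ⟨_, subset_rfl, hAm, pos_iff_ne_zero.2 hm, lt_top_iff_ne_top.2 hi⟩
    refine ⟨mkCopy m '' B, Set.image_subset_iff.2 hBA,
      (measurableEmbedding_mk m).measurableSet_image.2 hB, ?_, ?_⟩
    · rwa [copies_image_mk m hB]
    · rwa [copies_image_mk m hB]
  exists_essSup 𝒜 h𝒜 := by
    have key : ∀ m : ℤ, ∃ H : Set X, MeasurableSet H ∧
        (∀ A ∈ 𝒜, μ (mkCopy m ⁻¹' A \ H) = 0) ∧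
        ∀ G : Set X, MeasurableSet G → (∀ A ∈ 𝒜, μ (mkCopy m ⁻¹' A \ G) = 0) →
          μ (H \ G) = 0 := by
      intro m
      obtain ⟨H, h1, h2, h3⟩ := h.exists_essSup ((mkCopy m ⁻¹' ·) '' 𝒜) (by
        rintro _ ⟨A, hA, rfl⟩
        exact measurableSet_sigma_iff.1 (h𝒜 A hA) m)
      exact ⟨H, h1, fun A hA => h2 _ ⟨A, hA, rfl⟩, fun G hG hG' => h3 G hG (by
        rintro _ ⟨A, hA, rfl⟩
        exact hG' A hA)⟩
    choose H h1 h2 h3 using key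
    have hH : MeasurableSet {y : Σ _ : ℤ, X | y.2 ∈ H y.1} := measurableSet_sigma_iff.2 h1
    refine ⟨{y | y.2 ∈ H y.1}, hH, fun A hA => ?_, fun G hG hG' => ?_⟩
    · exact (copies_eq_zero_iff ((h𝒜 A hA).diff hH)).2 fun m => h2 m A hA
    · refine (copies_eq_zero_iff (hH.diff hG)).2 fun m =>
        h3 m _ (measurableSet_sigma_iff.1 hG m) fun A hA => ?_
      exact (copies_eq_zero_iff ((h𝒜 A hA).diff hG)).1 (hG' A hA) m

variable {p : ℝ≥0∞}

theorem memLp_comp_mk (m : ℤ) (f : Lp ℂ p (copies μ)) : MemLp (fun x => f ⟨m, x⟩) p μ :=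
  (measurableEmbedding_mk m).memLp_map_measure_iff.1
    ((Lp.memLp f).mono_measure (Measure.le_sum (fun m => μ.map (mkCopy m)) m))

open Classical in
theorem memLp_extend (hp0 : p ≠ 0) (hp : p ≠ ∞) (m : ℤ) (f : Lp ℂ p μ) :
    MemLp (fun y : Σ _ : ℤ, X => if y.1 = m then f y.2 else 0) p (copies μ) := by
  have hmeas : Measurable (fun y : Σ _ : ℤ, X => if y.1 = m then f y.2 else 0) := by
    intro A hA
    refine measurableSet_sigma_iff.2 fun k => ?_
    by_cases hk : k = m
    · subst hk
      simpa [Set.preimage_preimage] using (Lp.stronglyMeasurable f).measurable hA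
    · simpa [Set.preimage_preimage, hk] using measurable_const hA
  refine ⟨hmeas.aestronglyMeasurable, ?_⟩
  rw [eLpNorm_lt_top_iff_lintegral_rpow_enorm_lt_top hp0 hp, copies, lintegral_sum_measure,
    tsum_eq_single m]
  · rw [(measurableEmbedding_mk m).lintegral_map]
    simpa using (eLpNorm_lt_top_iff_lintegral_rpow_enorm_lt_top hp0 hp).1 (Lp.memLp f).2
  · intro k hk
    rw [(measurableEmbedding_mk k).lintegral_map]
    simp [hk, ENNReal.toReal_pos hp0 hp]

/-- The restriction of a function to a copy. -/
def toCopyFun (m : ℤ) (f : Lp ℂ p (copies μ)) : Lp ℂ p μ := (memLp_comp_mk m f).toLp _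

theorem coeFn_toCopyFun (m : ℤ) (f : Lp ℂ p (copies μ)) :
    toCopyFun m f =ᵐ[μ] fun x => f ⟨m, x⟩ := MemLp.coeFn_toLp _

theorem ext_toCopyFun {f g : Lp ℂ p (copies μ)} (h : ∀ m, toCopyFun m f = toCopyFun m g) :
    f = g := by
  refine Lp.ext (ae_copies_iff.2 fun m => ?_)
  filter_upwards [coeFn_toCopyFun m f, coeFn_toCopyFun m g] with x h1 h2
  rw [← h1, ← h2, h m]

theorem toCopyFun_add (m : ℤ) (f g : Lp ℂ p (copies μ)) :
    toCopyFun m (f + g) = toCopyFun m f + toCopyFun m g := by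
  refine Lp.ext ?_
  filter_upwards [coeFn_toCopyFun m f, coeFn_toCopyFun m g, coeFn_toCopyFun m (f + g),
    Lp.coeFn_add (toCopyFun m f) (toCopyFun m g), ae_copies_iff.1 (Lp.coeFn_add f g) m]
    with x h1 h2 h3 h4 h5
  rw [h3, h4, h5, Pi.add_apply, Pi.add_apply, h1, h2]

theorem toCopyFun_smul (m : ℤ) (c : ℂ) (f : Lp ℂ p (copies μ)) :
    toCopyFun m (c • f) = c • toCopyFun m f := by
  refine Lp.ext ?_
  filter_upwards [coeFn_toCopyFun m f, coeFn_toCopyFun m (c • f),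
    Lp.coeFn_smul c (toCopyFun m f), ae_copies_iff.1 (Lp.coeFn_smul c f) m] with x h1 h2 h3 h4
  rw [h2, h3, h4, Pi.smul_apply, Pi.smul_apply, h1]

variable [Fact (1 ≤ p)]

/-- Reduces all norm computations on the union to single copies. -/
theorem hasSum_norm_toCopyFun (hp : p ≠ ∞) (f : Lp ℂ p (copies μ)) :
    HasSum (fun m => ‖toCopyFun m f‖ ^ p.toReal) (‖f‖ ^ p.toReal) := by
  have h1 := hasSum_integral_measure (μ := fun m : ℤ => μ.map (mkCopy m))
    (integrable_rpow hp f)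
  rw [norm_rpow_eq_integral hp]
  have h2 : (fun m => ‖toCopyFun m f‖ ^ p.toReal) =
      fun m => ∫ y, ‖f y‖ ^ p.toReal ∂(μ.map (mkCopy m)) := by
    funext m
    rw [(measurableEmbedding_mk m).integral_map, norm_rpow_eq_integral hp]
    refine integral_congr_ae ?_
    filter_upwards [coeFn_toCopyFun m f] with x hx
    rw [hx]
  rw [h2]
  exact h1

/-- The restriction to a copy as an operator. -/
def toCopy (hp : p ≠ ∞) (m : ℤ) : Lp ℂ p (copies μ) →L[ℂ] Lp ℂ p μ :=
  LinearMap.mkContinuous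
    { toFun := toCopyFun m
      map_add' := toCopyFun_add m
      map_smul' := toCopyFun_smul m } 1 fun f => by
    rw [one_mul]
    refine (Real.rpow_le_rpow_iff (norm_nonneg _) (norm_nonneg _) (toReal_pos_of_fact hp)).1 ?_
    exact le_hasSum (hasSum_norm_toCopyFun hp f) m fun k _ => by positivity

theorem norm_toCopy_le (hp : p ≠ ∞) (m : ℤ) : ‖(toCopy hp m : _ →L[ℂ] Lp ℂ p μ)‖ ≤ 1 :=
  LinearMap.mkContinuous_norm_le _ zero_le_one _

open Classical in
/-- The extension by zero of a function on a copy. -/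
def ofCopyFun (hp : p ≠ ∞) (m : ℤ) (f : Lp ℂ p μ) : Lp ℂ p (copies μ) :=
  (memLp_extend (zero_lt_one.trans_le (Fact.out : 1 ≤ p)).ne' hp m f).toLp _

theorem toCopy_ofCopyFun (hp : p ≠ ∞) (m : ℤ) (f : Lp ℂ p μ) :
    toCopy hp m (ofCopyFun hp m f) = f := by
  refine Lp.ext ?_
  filter_upwards [coeFn_toCopyFun m (ofCopyFun hp m f), ae_copies_iff.1 (MemLp.coeFn_toLp
    (memLp_extend (zero_lt_one.trans_le (Fact.out : 1 ≤ p)).ne' hp m f)) m] with x h1 h2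
  refine h1.trans (h2.trans ?_)
  simp

theorem toCopy_ofCopyFun_ne (hp : p ≠ ∞) {m k : ℤ} (hkm : k ≠ m) (f : Lp ℂ p μ) :
    toCopy hp k (ofCopyFun hp m f) = 0 := by
  refine Lp.ext ?_
  filter_upwards [coeFn_toCopyFun k (ofCopyFun hp m f), ae_copies_iff.1 (MemLp.coeFn_toLp
    (memLp_extend (zero_lt_one.trans_le (Fact.out : 1 ≤ p)).ne' hp m f)) k,
    Lp.coeFn_zero ℂ p μ] with x h1 h2 h3
  rw [h3]
  refine h1.trans (h2.trans ?_)
  simp [hkm]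

theorem ext_toCopy (hp : p ≠ ∞) {f g : Lp ℂ p (copies μ)}
    (h : ∀ m, toCopy hp m f = toCopy hp m g) : f = g := ext_toCopyFun h

theorem norm_ofCopyFun (hp : p ≠ ∞) (m : ℤ) (f : Lp ℂ p μ) : ‖ofCopyFun hp m f‖ = ‖f‖ := by
  have h0 := toReal_pos_of_fact hp
  refine (Real.rpow_left_inj (norm_nonneg _) (norm_nonneg _) h0.ne').1 ?_
  refine (hasSum_norm_toCopyFun hp (ofCopyFun hp m f)).unique ?_
  have := hasSum_single (f := fun k => ‖toCopy hp k (ofCopyFun hp m f)‖ ^ p.toReal) m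
    fun k hk => by
      rw [toCopy_ofCopyFun_ne hp hk, norm_zero, Real.zero_rpow h0.ne']
  rwa [toCopy_ofCopyFun] at this

/-- The extension by zero from a copy as an operator. -/
def ofCopy (hp : p ≠ ∞) (m : ℤ) : Lp ℂ p μ →L[ℂ] Lp ℂ p (copies μ) :=
  LinearMap.mkContinuous
    { toFun := ofCopyFun hp m
      map_add' f g := ext_toCopy hp fun k => by
        by_cases hk : k = m
        · subst hk
          rw [map_add, toCopy_ofCopyFun, toCopy_ofCopyFun, toCopy_ofCopyFun]
        · rw [map_add, toCopy_ofCopyFun_ne hp hk, toCopy_ofCopyFun_ne hp hk,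
            toCopy_ofCopyFun_ne hp hk, add_zero]
      map_smul' c f := ext_toCopy hp fun k => by
        by_cases hk : k = m
        · subst hk
          rw [map_smul, toCopy_ofCopyFun, toCopy_ofCopyFun, RingHom.id_apply]
        · rw [map_smul, toCopy_ofCopyFun_ne hp hk, toCopy_ofCopyFun_ne hp hk, smul_zero] } 1
    fun f => by
      rw [one_mul]
      exact (norm_ofCopyFun hp m f).le

theorem norm_ofCopy (hp : p ≠ ∞) (m : ℤ) (f : Lp ℂ p μ) : ‖ofCopy hp m f‖ = ‖f‖ :=
  norm_ofCopyFun hp m f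

theorem toCopy_ofCopy (hp : p ≠ ∞) (m : ℤ) (f : Lp ℂ p μ) : toCopy hp m (ofCopy hp m f) = f :=
  toCopy_ofCopyFun hp m f

theorem toCopy_ofCopy_ne (hp : p ≠ ∞) {m k : ℤ} (hkm : k ≠ m) (f : Lp ℂ p μ) :
    toCopy hp k (ofCopy hp m f) = 0 := toCopy_ofCopyFun_ne hp hkm f

theorem isLpProj_ofCopy_comp_toCopy (hp : p ≠ ∞) (m : ℤ) :
    IsLpProj p.toReal ((ofCopy hp m).comp (toCopy hp m) : LpOp p (copies μ)) := by
  have h0 := toReal_pos_of_fact hp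
  constructor
  · ext1 ξ
    simp [toCopy_ofCopy]
  · intro ξ
    refine (hasSum_norm_toCopyFun hp ξ).unique ?_
    rw [ContinuousLinearMap.comp_apply]
    convert (hasSum_norm_toCopyFun hp (ofCopy hp m (toCopy hp m ξ))).add
      (hasSum_norm_toCopyFun hp (ξ - ofCopy hp m (toCopy hp m ξ))) using 2 with k
    -- On copy m the first summand carries everything, on every other copy the second.
    change ‖toCopy hp k ξ‖ ^ p.toReal = ‖toCopy hp k _‖ ^ p.toReal + ‖toCopy hp k _‖ ^ p.toReal
    rw [map_sub]
    by_cases hk : k = m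
    · subst hk
      simp [toCopy_ofCopy, Real.zero_rpow h0.ne']
    · simp [toCopy_ofCopy_ne hp hk, Real.zero_rpow h0.ne']

/-- The operator that maps the copy `k` to the copy `m` by `d` and vanishes on the others. -/
def matrixUnit (hp : p ≠ ∞) (m k : ℤ) (d : LpOp p μ) : LpOp p (copies μ) :=
  (ofCopy hp m).comp (d.comp (toCopy hp k))

theorem matrixUnit_mul (hp : p ≠ ∞) (m k l : ℤ) (c d : LpOp p μ) :
    matrixUnit hp m k c * matrixUnit hp k l d = matrixUnit hp m l (c * d) := by
  ext1 ξ
  simp [matrixUnit, toCopy_ofCopy]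

theorem matrixUnit_mul_ne (hp : p ≠ ∞) {k k' : ℤ} (hk : k ≠ k') (m l : ℤ) (c d : LpOp p μ) :
    matrixUnit hp m k c * matrixUnit hp k' l d = 0 := by
  ext1 ξ
  simp [matrixUnit, toCopy_ofCopy_ne hp hk]

theorem matrixUnit_add (hp : p ≠ ∞) (m k : ℤ) (c d : LpOp p μ) :
    matrixUnit hp m k (c + d) = matrixUnit hp m k c + matrixUnit hp m k d := by
  ext1 ξ
  simp [matrixUnit]

theorem matrixUnit_smul (hp : p ≠ ∞) (m k : ℤ) (a : ℂ) (d : LpOp p μ) :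
    matrixUnit hp m k (a • d) = a • matrixUnit hp m k d := by
  ext1 ξ
  simp [matrixUnit]

theorem matrixUnit_zero (hp : p ≠ ∞) (m k : ℤ) : matrixUnit hp m k (0 : LpOp p μ) = 0 := by
  ext1 ξ
  simp [matrixUnit]

theorem norm_matrixUnit (hp : p ≠ ∞) (m k : ℤ) (d : LpOp p μ) : ‖matrixUnit hp m k d‖ = ‖d‖ := by
  refine le_antisymm (ContinuousLinearMap.opNorm_le_bound _ (norm_nonneg d) fun ξ => ?_)
    (ContinuousLinearMap.opNorm_le_bound _ (norm_nonneg _) fun ξ => ?_)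
  · refine (norm_ofCopy hp m _).le.trans ((d.le_opNorm _).trans ?_)
    gcongr
    simpa using (toCopy hp k).le_of_opNorm_le (norm_toCopy_le hp k) ξ
  -- The lower bound is tested on functions supported on copy k.
  · have := (matrixUnit hp m k d).le_opNorm (ofCopy hp k ξ)
    rw [norm_ofCopy] at this
    refine le_trans (le_of_eq ?_) this
    simp [matrixUnit, toCopy_ofCopy, norm_ofCopy]

theorem IsLpProj.matrixUnit (hp : p ≠ ∞) (m : ℤ) {P : LpOp p μ} (hP : IsLpProj p.toReal P) :
    IsLpProj p.toReal (matrixUnit hp m m P) :=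
  IsLpProj.conj (fun ξ => (norm_ofCopy hp m ξ).le)
    (fun ξ => by simpa using (toCopy hp m).le_of_opNorm_le (norm_toCopy_le hp m) ξ)
    (isLpProj_ofCopy_comp_toCopy hp m) hP (fun ξ => toCopy_ofCopy hp m _)
    (fun ξ => toCopy_ofCopy hp m _)

end Copies

/-! ### Dilation of Cuntz–Krieger families to the desingularization -/

section Defect

variable {A : Type*} [Ring A] {Q : DirGraph.{u}} {S T : Q.E → A} {E : Q.V → A}

/-- The part of `E v` that the edges in `F` do not cover. -/
def defect (S T : Q.E → A) (E : Q.V → A) (v : Q.V) (F : Finset Q.E) : A :=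
  E v - ∑ b ∈ F, S b * T b

namespace IsLeavittFamily

variable (h : IsLeavittFamily Q S T E)

include h

theorem E_mul_sum {v : Q.V} {F : Finset Q.E} (hF : ∀ b ∈ F, Q.r b = v) :
    E v * ∑ b ∈ F, S b * T b = ∑ b ∈ F, S b * T b := by
  rw [Finset.mul_sum]
  refine Finset.sum_congr rfl fun b hb => ?_
  rw [← hF b hb, ← mul_assoc, h.E_S]

theorem sum_mul_E {v : Q.V} {F : Finset Q.E} (hF : ∀ b ∈ F, Q.r b = v) :
    (∑ b ∈ F, S b * T b) * E v = ∑ b ∈ F, S b * T b := by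
  rw [Finset.sum_mul]
  refine Finset.sum_congr rfl fun b hb => ?_
  rw [← hF b hb, mul_assoc, h.T_E]

theorem E_mul_defect {v : Q.V} {F : Finset Q.E} (hF : ∀ b ∈ F, Q.r b = v) :
    E v * defect S T E v F = defect S T E v F := by
  rw [defect, mul_sub, h.idem, h.E_mul_sum hF]

theorem defect_mul_E {v : Q.V} {F : Finset Q.E} (hF : ∀ b ∈ F, Q.r b = v) :
    defect S T E v F * E v = defect S T E v F := by
  rw [defect, sub_mul, h.idem, h.sum_mul_E hF]

theorem defect_orth {v w : Q.V} (hvw : v ≠ w) {F G : Finset Q.E} (hF : ∀ b ∈ F, Q.r b = v)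
    (hG : ∀ b ∈ G, Q.r b = w) : defect S T E v F * defect S T E w G = 0 := by
  rw [← h.defect_mul_E hF, ← h.E_mul_defect hG, mul_assoc, ← mul_assoc (E v), h.orth v w hvw,
    zero_mul, mul_zero]

theorem T_mul_sum_mem {b : Q.E} {F : Finset Q.E} (hb : b ∈ F) :
    T b * ∑ a ∈ F, S a * T a = T b := by
  rw [Finset.mul_sum, Finset.sum_eq_single b]
  · rw [← mul_assoc, h.ck1_self, h.E_T]
  · intro a _ hab
    rw [← mul_assoc, h.ck1_ne b a hab.symm, zero_mul]
  · exact fun hb' => absurd hb hb'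

theorem T_mul_sum_notMem {b : Q.E} {F : Finset Q.E} (hb : b ∉ F) :
    T b * ∑ a ∈ F, S a * T a = 0 := by
  rw [Finset.mul_sum]
  refine Finset.sum_eq_zero fun a ha => ?_
  rw [← mul_assoc, h.ck1_ne b a fun hab => hb (hab ▸ ha), zero_mul]

theorem sum_mul_S_mem {b : Q.E} {F : Finset Q.E} (hb : b ∈ F) :
    (∑ a ∈ F, S a * T a) * S b = S b := by
  rw [Finset.sum_mul, Finset.sum_eq_single b]
  · rw [mul_assoc, h.ck1_self, h.S_E]
  · intro a _ hab
    rw [mul_assoc, h.ck1_ne a b hab, mul_zero]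
  · exact fun hb' => absurd hb hb'

theorem sum_mul_S_notMem {b : Q.E} {F : Finset Q.E} (hb : b ∉ F) :
    (∑ a ∈ F, S a * T a) * S b = 0 := by
  rw [Finset.sum_mul]
  refine Finset.sum_eq_zero fun a ha => ?_
  rw [mul_assoc, h.ck1_ne a b fun hab => hb (hab ▸ ha), mul_zero]

theorem T_mul_defect_mem {b : Q.E} {F : Finset Q.E} (hb : b ∈ F) :
    T b * defect S T E (Q.r b) F = 0 := by
  rw [defect, mul_sub, h.T_E, h.T_mul_sum_mem hb, sub_self]

theorem T_mul_defect_notMem {b : Q.E} {F : Finset Q.E} (hb : b ∉ F) :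
    T b * defect S T E (Q.r b) F = T b := by
  rw [defect, mul_sub, h.T_E, h.T_mul_sum_notMem hb, sub_zero]

theorem defect_mul_S_mem {b : Q.E} {F : Finset Q.E} (hb : b ∈ F) :
    defect S T E (Q.r b) F * S b = 0 := by
  rw [defect, sub_mul, h.E_S, h.sum_mul_S_mem hb, sub_self]

theorem defect_mul_S_notMem {b : Q.E} {F : Finset Q.E} (hb : b ∉ F) :
    defect S T E (Q.r b) F * S b = S b := by
  rw [defect, sub_mul, h.E_S, h.sum_mul_S_notMem hb, sub_zero]

theorem defect_idem {v : Q.V} {F : Finset Q.E} (hF : ∀ b ∈ F, Q.r b = v) :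
    defect S T E v F * defect S T E v F = defect S T E v F := by
  have h0 : (∑ b ∈ F, S b * T b) * defect S T E v F = 0 := by
    rw [Finset.sum_mul]
    refine Finset.sum_eq_zero fun b hb => ?_
    rw [mul_assoc, ← hF b hb, h.T_mul_defect_mem hb, mul_zero]
  nth_rewrite 1 [defect]
  rw [sub_mul, h0, sub_zero, h.E_mul_defect hF]

theorem T_mul_defect_ne {b : Q.E} {v : Q.V} {F : Finset Q.E} (hF : ∀ b ∈ F, Q.r b = v)
    (hb : Q.r b ≠ v) : T b * defect S T E v F = 0 := by
  rw [← h.T_E, ← h.E_mul_defect hF, mul_assoc, ← mul_assoc (E (Q.r b)), h.orth _ _ hb, zero_mul,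
    mul_zero]

theorem defect_mul_S_ne {b : Q.E} {v : Q.V} {F : Finset Q.E} (hF : ∀ b ∈ F, Q.r b = v)
    (hb : Q.r b ≠ v) : defect S T E v F * S b = 0 := by
  rw [← h.E_S, ← h.defect_mul_E hF, mul_assoc, ← mul_assoc (E v), h.orth _ _ hb.symm, zero_mul,
    mul_zero]

end IsLeavittFamily

end Defect

/-! ### The decreasing projections along a chain -/

section Level

variable {Q : DirGraph.{u}} {n : Q.E → ℕ} (hn : Function.Injective n)

open Classical in
/-- The edges with range `v` that enter the chain over `v` above level `m`. -/
def levelSet (v : Q.V) (m : ℤ) : Finset Q.E :=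
  ((Finset.range (-m).toNat).preimage n hn.injOn).filter fun b => Q.r b = v

theorem mem_levelSet {v : Q.V} {m : ℤ} {b : Q.E} :
    b ∈ levelSet hn v m ↔ Q.r b = v ∧ (n b : ℤ) < -m := by
  simp only [levelSet, Finset.mem_filter, Finset.mem_preimage, Finset.mem_range, Int.lt_toNat]
  exact and_comm

variable {A : Type*} [Ring A]

/-- The projection at the vertex `(v, m)`. -/
def levelProj (S T : Q.E → A) (E : Q.V → A) (v : Q.V) (m : ℤ) : A :=
  defect S T E v (levelSet hn v m)

variable {S T : Q.E → A} {E : Q.V → A}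

theorem levelSet_r (v : Q.V) (m : ℤ) : ∀ b ∈ levelSet hn v m, Q.r b = v :=
  fun _ hb => ((mem_levelSet hn).1 hb).1

theorem levelProj_of_nonneg (v : Q.V) {m : ℤ} (hm : 0 ≤ m) : levelProj hn S T E v m = E v := by
  have : levelSet hn v m = ∅ := by
    refine Finset.eq_empty_of_forall_notMem fun b hb => ?_
    have := ((mem_levelSet hn).1 hb).2
    omega
  rw [levelProj, this, defect, Finset.sum_empty, sub_zero]

theorem levelProj_eq_add (b : Q.E) {m : ℤ} (hm : (n b : ℤ) = -m) :
    levelProj hn S T E (Q.r b) m = levelProj hn S T E (Q.r b) (m - 1) + S b * T b := by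
  classical
  have : levelSet hn (Q.r b) (m - 1) = insert b (levelSet hn (Q.r b) m) := by
    ext b'
    rw [Finset.mem_insert, mem_levelSet, mem_levelSet]
    constructor
    · rintro ⟨h1, h2⟩
      by_cases hb : n b' = n b
      · exact Or.inl (hn hb)
      · exact Or.inr ⟨h1, by omega⟩
    · rintro (rfl | ⟨h1, h2⟩)
      · exact ⟨rfl, by omega⟩
      · exact ⟨h1, by omega⟩
  rw [levelProj, levelProj, this, defect, defect, Finset.sum_insert]
  · abel
  · rw [mem_levelSet]
    omega

theorem levelProj_eq {v : Q.V} {m : ℤ} (hb : ∀ b, Q.r b = v → (n b : ℤ) ≠ -m) :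
    levelProj hn S T E v m = levelProj hn S T E v (m - 1) := by
  have : levelSet hn v (m - 1) = levelSet hn v m := by
    ext b'
    rw [mem_levelSet, mem_levelSet]
    refine and_congr_right fun h => ?_
    have := hb b' h
    omega
  rw [levelProj, levelProj, this]

variable (h : IsLeavittFamily Q S T E)

include h

/-- Below the end of the chain every edge into the regular vertex has been subtracted, and the
Cuntz–Krieger relation leaves nothing. -/
theorem levelProj_of_not_isLevel {v : Q.V} {m : ℤ} (hl : ¬ Q.IsLevel n v m) :
    levelProj hn S T E v m = 0 := by
  unfold DirGraph.IsLevel at hl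
  push Not at hl
  have : levelSet hn v m = hl.1.finite.toFinset := by
    ext b
    rw [mem_levelSet, Set.Finite.mem_toFinset]
    exact ⟨fun hb => hb.1, fun hb => ⟨hb, hl.2 b hb⟩⟩
  rw [levelProj, this, defect, ← h.ck2 v hl.1, sub_self]

theorem levelProj_mul_S {b : Q.E} {m : ℤ} (hm : -m ≤ n b) :
    levelProj hn S T E (Q.r b) m * S b = S b :=
  h.defect_mul_S_notMem fun hb => by
    have := ((mem_levelSet hn).1 hb).2
    omega

theorem T_mul_levelProj {b : Q.E} {m : ℤ} (hm : -m ≤ n b) :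
    T b * levelProj hn S T E (Q.r b) m = T b :=
  h.T_mul_defect_notMem fun hb => by
    have := ((mem_levelSet hn).1 hb).2
    omega

theorem levelProj_mul_S_eq_zero {b : Q.E} {v : Q.V} {m : ℤ} (hm : (n b : ℤ) < -m) :
    levelProj hn S T E v m * S b = 0 := by
  by_cases hb : Q.r b = v
  · subst hb
    exact h.defect_mul_S_mem ((mem_levelSet hn).2 ⟨rfl, hm⟩)
  · exact h.defect_mul_S_ne (levelSet_r hn v m) hb

theorem T_mul_levelProj_eq_zero {b : Q.E} {v : Q.V} {m : ℤ} (hm : (n b : ℤ) < -m) :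
    T b * levelProj hn S T E v m = 0 := by
  by_cases hb : Q.r b = v
  · subst hb
    exact h.T_mul_defect_mem ((mem_levelSet hn).2 ⟨rfl, hm⟩)
  · exact h.T_mul_defect_ne (levelSet_r hn v m) hb

theorem levelProj_orth {v w : Q.V} (hvw : v ≠ w) (m k : ℤ) :
    levelProj hn S T E v m * levelProj hn S T E w k = 0 :=
  h.defect_orth hvw (levelSet_r hn v m) (levelSet_r hn w k)

theorem levelProj_idem (v : Q.V) (m : ℤ) :
    levelProj hn S T E v m * levelProj hn S T E v m = levelProj hn S T E v m :=
  h.defect_idem (levelSet_r hn v m)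

/-- One step down either changes nothing or subtracts a single S_b T_b, which is orthogonal to what
is left. -/
theorem levelProj_succ_mul (v : Q.V) (m : ℤ) :
    levelProj hn S T E v (m + 1) * levelProj hn S T E v m = levelProj hn S T E v m := by
  by_cases hb : ∃ b, Q.r b = v ∧ (n b : ℤ) = -(m + 1)
  · obtain ⟨b, rfl, hb⟩ := hb
    rw [levelProj_eq_add hn b hb, add_sub_cancel_right, add_mul, mul_assoc,
      T_mul_levelProj_eq_zero hn h (by omega), mul_zero, add_zero, levelProj_idem hn h]
  · push Not at hb
    rw [levelProj_eq hn hb, add_sub_cancel_right, levelProj_idem hn h]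

theorem levelProj_mul_succ (v : Q.V) (m : ℤ) :
    levelProj hn S T E v m * levelProj hn S T E v (m + 1) = levelProj hn S T E v m := by
  by_cases hb : ∃ b, Q.r b = v ∧ (n b : ℤ) = -(m + 1)
  · obtain ⟨b, rfl, hb⟩ := hb
    rw [levelProj_eq_add hn b hb, add_sub_cancel_right, mul_add, ← mul_assoc,
      levelProj_mul_S_eq_zero hn h (by omega), zero_mul, add_zero, levelProj_idem hn h]
  · push Not at hb
    rw [levelProj_eq hn hb, add_sub_cancel_right, levelProj_idem hn h]

end Level

/-! ### The dilated family and its corner -/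

section Dilation

variable {p : ℝ≥0∞} [Fact (1 ≤ p)] {Q : DirGraph.{u}} {n : Q.E → ℕ} {X : Type*}
  [MeasurableSpace X] {μ : Measure X} (hp : p ≠ ∞) (hn : Function.Injective n)

include hp in
-- The S_b T_b are subtracted one at a time; each lies below what is left, so the difference is
-- again an L^p-projection.
theorem IsCKFamily.isLpProj_levelProj {S T : Q.E → LpOp p μ} {E : Q.V → LpOp p μ}
    (h : IsCKFamily Q S T E) (hp2 : p ≠ 2) (v : Q.V) (m : ℤ) :
    IsLpProj p.toReal (levelProj hn S T E v m) := by
  classical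
  have hL := h.isLeavittFamily
  have key : ∀ F : Finset Q.E, (∀ b ∈ F, Q.r b = v) → IsLpProj p.toReal (defect S T E v F) := by
    intro F
    induction F using Finset.induction_on with
    | empty =>
      intro _
      simpa [defect] using (h.hermitian_E v).isLpProj hp hp2
    | insert b F hb ih =>
      intro hF
      obtain rfl := hF b (Finset.mem_insert_self b F)
      have hF' : ∀ b' ∈ F, Q.r b' = Q.r b := fun b' hb' => hF b' (Finset.mem_insert_of_mem hb')
      have e : defect S T E (Q.r b) (insert b F) = defect S T E (Q.r b) F - S b * T b := by
        rw [defect, defect, Finset.sum_insert hb]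
        abel
      rw [e]
      refine (ih hF').sub ((h.hermitian_ST b).isLpProj hp hp2) ?_ ?_
      · rw [← mul_assoc, hL.defect_mul_S_notMem hb]
      · rw [mul_assoc, hL.T_mul_defect_notMem hb]
  exact key _ (levelSet_r hn v m)

variable (S T : Q.E → LpOp p μ) (E : Q.V → LpOp p μ)

/-- The dilation of a family to the desingularization: the operators `S`. -/
def dilS : (Q.desing n).E → LpOp p (copies μ) :=
  Sum.elim (fun b => matrixUnit hp (-n b) (n b) (S b))
    (fun x => matrixUnit hp (x.1.2 + 1) x.1.2 (levelProj hn S T E x.1.1 x.1.2))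

/-- The dilation of a family to the desingularization: the operators `T`. -/
def dilT : (Q.desing n).E → LpOp p (copies μ) :=
  Sum.elim (fun b => matrixUnit hp (n b) (-n b) (T b))
    (fun x => matrixUnit hp x.1.2 (x.1.2 + 1) (levelProj hn S T E x.1.1 x.1.2))

/-- The dilation of a family to the desingularization: the idempotents `E`. -/
def dilE : (Q.desing n).V → LpOp p (copies μ) :=
  fun x => matrixUnit hp x.1.2 x.1.2 (levelProj hn S T E x.1.1 x.1.2)

variable {S T E}

/-- Operators attached to different copies multiply to zero through the matrix units. On a common
copy the relations reduce to those of the level projections, which equal E_v at the levels ≥ 0 where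
old edges start. -/
theorem IsLeavittFamily.dilation (h : IsLeavittFamily Q S T E) :
    IsLeavittFamily (Q.desing n) (dilS hp hn S T E) (dilT hp hn S T E) (dilE hp hn S T E) where
  idem := by
    rintro ⟨⟨v, m⟩, hl⟩
    simp only [dilE]
    rw [matrixUnit_mul, levelProj_idem hn h]
  orth := by
    rintro ⟨⟨v, m⟩, hl⟩ ⟨⟨w, k⟩, hl'⟩ hne
    simp only [dilE]
    by_cases hmk : m = k
    · subst hmk
      rw [matrixUnit_mul, levelProj_orth hn h, matrixUnit_zero]
      rintro rfl
      exact hne rfl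
    · rw [matrixUnit_mul_ne hp hmk]
  E_S := by
    rintro (b | ⟨⟨v, m⟩, hl⟩)
    · simp only [dilE, dilS, Sum.elim_inl]
      rw [matrixUnit_mul, levelProj_mul_S hn h (by omega)]
    · simp only [dilE, dilS, Sum.elim_inr]
      rw [matrixUnit_mul, levelProj_succ_mul hn h]
  S_E := by
    rintro (b | ⟨⟨v, m⟩, hl⟩)
    · simp only [dilE, dilS, Sum.elim_inl]
      rw [matrixUnit_mul, levelProj_of_nonneg hn _ (by omega), h.S_E]
    · simp only [dilE, dilS, Sum.elim_inr, id]
      rw [matrixUnit_mul, levelProj_idem hn h]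
  T_E := by
    rintro (b | ⟨⟨v, m⟩, hl⟩)
    · simp only [dilE, dilT, Sum.elim_inl]
      rw [matrixUnit_mul, T_mul_levelProj hn h (by omega)]
    · simp only [dilE, dilT, Sum.elim_inr]
      rw [matrixUnit_mul, levelProj_mul_succ hn h]
  E_T := by
    rintro (b | ⟨⟨v, m⟩, hl⟩)
    · simp only [dilE, dilT, Sum.elim_inl]
      rw [matrixUnit_mul, levelProj_of_nonneg hn _ (by omega), h.E_T]
    · simp only [dilE, dilT, Sum.elim_inr, id]
      rw [matrixUnit_mul, levelProj_idem hn h]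
  ck1_self := by
    rintro (b | ⟨⟨v, m⟩, hl⟩)
    · simp only [dilE, dilS, dilT, Sum.elim_inl]
      rw [matrixUnit_mul, levelProj_of_nonneg hn _ (by omega), h.ck1_self]
    · simp only [dilE, dilS, dilT, Sum.elim_inr, id]
      rw [matrixUnit_mul, levelProj_idem hn h]
  ck1_ne := by
    rintro (b | ⟨⟨v, m⟩, hl⟩) (b' | ⟨⟨w, k⟩, hl'⟩) hne
    · simp only [dilS, dilT, Sum.elim_inl]
      refine matrixUnit_mul_ne hp (fun hb => hne ?_) _ _ _ _
      rw [hn (by omega : n b = n b')]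
    · simp only [dilS, dilT, Sum.elim_inl, Sum.elim_inr]
      -- If the chain edge ends where b does, its projection is that of the level below b, from
      -- which S_b T_b has been subtracted.
      by_cases hk : -(n b : ℤ) = k + 1
      · rw [hk, matrixUnit_mul, T_mul_levelProj_eq_zero hn h (by omega), matrixUnit_zero]
      · exact matrixUnit_mul_ne hp hk _ _ _ _
    · simp only [dilS, dilT, Sum.elim_inl, Sum.elim_inr]
      by_cases hk : m + 1 = -(n b' : ℤ)
      · rw [hk, matrixUnit_mul, levelProj_mul_S_eq_zero hn h (by omega), matrixUnit_zero]
      · exact matrixUnit_mul_ne hp hk _ _ _ _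
    · simp only [dilS, dilT, Sum.elim_inr]
      by_cases hk : m = k
      · subst hk
        rw [matrixUnit_mul, levelProj_orth hn h, matrixUnit_zero]
        rintro rfl
        exact hne rfl
      · exact matrixUnit_mul_ne hp (by omega) _ _ _ _
  ck2 := by
    rintro ⟨⟨v, m⟩, hl⟩ hv
    have key : ∀ w k, extendZero (fun x => dilS hp hn S T E (Sum.inr x) *
        dilT hp hn S T E (Sum.inr x)) w k =
        matrixUnit hp (k + 1) (k + 1) (levelProj hn S T E w k) := by
      refine extendZero_eq (g := fun w k => matrixUnit hp (k + 1) (k + 1)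
        (levelProj hn S T E w k)) (fun x => ?_) fun w k hk => ?_
      · simp only [dilS, dilT, Sum.elim_inr]
        rw [matrixUnit_mul, levelProj_idem hn h]
      · rw [levelProj_of_not_isLevel hn h hk, matrixUnit_zero]
    by_cases hb : ∃ b, Q.r b = v ∧ (n b : ℤ) = -m
    · obtain ⟨b, rfl, hb⟩ := hb
      -- On copy m the chain edge contributes the projection of level m - 1, and b contributes the
      -- S_b T_b by which level m exceeds it.
      rw [sum_into_add hn b hb, key, sub_add_cancel]
      simp only [dilE, dilS, dilT, Sum.elim_inl]
      rw [matrixUnit_mul, levelProj_eq_add hn b hb, matrixUnit_add, hb, neg_neg]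
    · push Not at hb
      rw [sum_into_eq hl hb, key, sub_add_cancel, ← levelProj_eq hn hb, dilE]

/-- The dilation of a Cuntz–Krieger family on an `L^p`-space, `p ≠ 2`, to the desingularization. -/
theorem IsCKFamily.dilation (h : IsCKFamily Q S T E) (hp2 : p ≠ 2) :
    IsCKFamily (Q.desing n) (dilS hp hn S T E) (dilT hp hn S T E) (dilE hp hn S T E) := by
  have h0 := toReal_pos_of_fact hp
  have hP := h.isLpProj_levelProj hp hn hp2
  have hN : ∀ v m, ‖levelProj hn S T E v m‖ ≤ 1 := fun v m =>
    ((hP v m).isHermitianIdempotent h0).norm_le_one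
  refine (h.isLeavittFamily.dilation hp hn).isCKFamily (fun x => ?_) ?_ ?_ ?_
  · exact ((hP _ _).matrixUnit hp _).isHermitianIdempotent h0
  · rintro (b | x)
    · exact (norm_matrixUnit hp _ _ _).trans_le (h.norm_S b)
    · exact (norm_matrixUnit hp _ _ _).trans_le (hN _ _)
  · rintro (b | x)
    · exact (norm_matrixUnit hp _ _ _).trans_le (h.norm_T b)
    · exact (norm_matrixUnit hp _ _ _).trans_le (hN _ _)
  · rintro (b | x)
    · simp only [dilS, dilT, Sum.elim_inl]
      rw [matrixUnit_mul]
      exact (((h.hermitian_ST b).isLpProj hp hp2).matrixUnit hp _).isHermitianIdempotent h0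
    · simp only [dilS, dilT, Sum.elim_inr]
      rw [matrixUnit_mul, levelProj_idem hn h.isLeavittFamily]
      exact ((hP _ _).matrixUnit hp _).isHermitianIdempotent h0

section Corner

variable (h : IsLeavittFamily Q S T E)

include h

theorem extendZero_dilE (v : Q.V) (m : ℤ) : extendZero (dilE hp hn S T E) v m =
    matrixUnit hp m m (levelProj hn S T E v m) :=
  extendZero_eq (g := fun v m => matrixUnit hp m m (levelProj hn S T E v m)) (fun _ => rfl)
    (fun v m hl => by rw [levelProj_of_not_isLevel hn h hl, matrixUnit_zero]) v m

theorem extendZero_dilS (v : Q.V) (m : ℤ) :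
    extendZero (fun x => dilS hp hn S T E (Sum.inr x)) v m =
      matrixUnit hp (m + 1) m (levelProj hn S T E v m) :=
  extendZero_eq (g := fun v m => matrixUnit hp (m + 1) m (levelProj hn S T E v m))
    (fun _ => rfl) (fun v m hl => by rw [levelProj_of_not_isLevel hn h hl, matrixUnit_zero]) v m

theorem extendZero_dilT (v : Q.V) (m : ℤ) :
    extendZero (fun x => dilT hp hn S T E (Sum.inr x)) v m =
      matrixUnit hp m (m + 1) (levelProj hn S T E v m) :=
  extendZero_eq (g := fun v m => matrixUnit hp m (m + 1) (levelProj hn S T E v m))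
    (fun _ => rfl) (fun v m hl => by rw [levelProj_of_not_isLevel hn h hl, matrixUnit_zero]) v m

theorem extendZero_dilE_zero (v : Q.V) :
    extendZero (dilE hp hn S T E) v 0 = matrixUnit hp 0 0 (E v) := by
  rw [extendZero_dilE hp hn h, levelProj_of_nonneg hn v le_rfl]

theorem upS_dil (v : Q.V) (j : ℕ) :
    upS (dilS hp hn S T E) (dilE hp hn S T E) v j = matrixUnit hp j 0 (E v) := by
  induction j with
  | zero => exact extendZero_dilE_zero hp hn h v
  | succ j ih =>
    rw [upS, ih, extendZero_dilS hp hn h, matrixUnit_mul,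
      levelProj_of_nonneg hn v (by omega), h.idem, Nat.cast_succ]

theorem upT_dil (v : Q.V) (j : ℕ) :
    upT (dilT hp hn S T E) (dilE hp hn S T E) v j = matrixUnit hp 0 j (E v) := by
  induction j with
  | zero => exact extendZero_dilE_zero hp hn h v
  | succ j ih =>
    rw [upT, ih, extendZero_dilT hp hn h, matrixUnit_mul,
      levelProj_of_nonneg hn v (by omega), h.idem, Nat.cast_succ]

theorem downS_dil (v : Q.V) (j : ℕ) : downS (dilS hp hn S T E) (dilE hp hn S T E) v j =
    matrixUnit hp 0 (-j) (levelProj hn S T E v (-j)) := by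
  induction j with
  | zero => simpa [downS] using extendZero_dilE hp hn h v 0
  | succ j ih =>
    have := levelProj_succ_mul hn h v (-j - 1)
    rw [sub_add_cancel] at this
    rw [downS, ih, extendZero_dilS hp hn h, sub_add_cancel, matrixUnit_mul, this,
      show (-((j + 1 : ℕ) : ℤ)) = -j - 1 by push_cast; ring]

theorem downT_dil (v : Q.V) (j : ℕ) : downT (dilT hp hn S T E) (dilE hp hn S T E) v j =
    matrixUnit hp (-j) 0 (levelProj hn S T E v (-j)) := by
  induction j with
  | zero => simpa [downT] using extendZero_dilE hp hn h v 0
  | succ j ih =>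
    have := levelProj_mul_succ hn h v (-j - 1)
    rw [sub_add_cancel] at this
    rw [downT, ih, extendZero_dilT hp hn h, sub_add_cancel, matrixUnit_mul, this,
      show (-((j + 1 : ℕ) : ℤ)) = -j - 1 by push_cast; ring]

/-- The path visits the copies 0, n b, -n b, 0 in turn, and S_b absorbs the projections on either
side of it. -/
theorem edgeS_dil (b : Q.E) :
    edgeS (dilS hp hn S T E) (dilE hp hn S T E) b = matrixUnit hp 0 0 (S b) := by
  rw [edgeS, upS_dil hp hn h, downS_dil hp hn h, dilS, Sum.elim_inl, matrixUnit_mul,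
    matrixUnit_mul, levelProj_mul_S hn h (by omega), h.S_E]

theorem edgeT_dil (b : Q.E) :
    edgeT (dilT hp hn S T E) (dilE hp hn S T E) b = matrixUnit hp 0 0 (T b) := by
  rw [edgeT, upT_dil hp hn h, downT_dil hp hn h, dilT, Sum.elim_inl, matrixUnit_mul,
    matrixUnit_mul, h.E_T, T_mul_levelProj hn h (by omega)]

end Corner

/-- The corner embedding of the operators on a space into those on the union of its copies. -/
def cornerHom : LpOp p μ →ₙₐ[ℂ] LpOp p (copies μ) where
  toFun := matrixUnit hp 0 0
  map_zero' := matrixUnit_zero hp 0 0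
  map_add' := matrixUnit_add hp 0 0
  map_mul' c d := (matrixUnit_mul hp 0 0 0 c d).symm
  map_smul' := matrixUnit_smul hp 0 0

theorem cornerHom_apply (d : LpOp p μ) : cornerHom hp d = matrixUnit hp 0 0 d := rfl

theorem norm_cornerHom (d : LpOp p μ) : ‖cornerHom hp d‖ = ‖d‖ := norm_matrixUnit hp 0 0 d

end Dilation

/-! ### The embedding of the graph algebra into that of the desingularization -/

section Embedding

variable {Q : DirGraph.{u}} {n : Q.E → ℕ} (hn : Function.Injective n)

/-- The embedding of the Leavitt path algebra of a graph into that of its desingularization. -/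
def desingHom : Leavitt Q →ₙₐ[ℂ] Leavitt (Q.desing n) :=
  Leavitt.mapOf (Leavitt.isLeavittFamily.ofDesing hn)

theorem desingHom_s (b : Q.E) : desingHom hn (Leavitt.s b) = edgeS Leavitt.s Leavitt.e b :=
  Leavitt.mapOf_gen _ _

theorem desingHom_t (b : Q.E) : desingHom hn (Leavitt.t b) = edgeT Leavitt.t Leavitt.e b :=
  Leavitt.mapOf_gen _ _

theorem desingHom_e (v : Q.V) : desingHom hn (Leavitt.e v) =
    extendZero (Leavitt.e (Q := Q.desing n)) v 0 :=
  Leavitt.mapOf_gen _ _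

variable {p : ℝ≥0∞} [Fact (1 ≤ p)] (hp : p ≠ ∞) (hp2 : p ≠ 2)
  {X : Type*} [MeasurableSpace X] {μ : Measure X}

include hp hp2 in
-- Restriction of representations; it shows that `desingHom` does not increase the norm.
theorem isRepresentation_comp_desingHom {φ : Leavitt (Q.desing n) →ₙₐ[ℂ] LpOp p μ}
    (hφ : Leavitt.IsRepresentation φ) : Leavitt.IsRepresentation (φ.comp (desingHom hn)) := by
  have h := IsCKFamily.ofDesing hφ hp hp2 hn
  unfold Leavitt.IsRepresentation
  convert h using 2 with a a v
  · rw [NonUnitalAlgHom.comp_apply, desingHom_s, map_edgeS]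
  · rw [NonUnitalAlgHom.comp_apply, desingHom_t, map_edgeT]
  · rw [NonUnitalAlgHom.comp_apply, desingHom_e, map_extendZero]

/-- Restricting the dilation returns the original representation in the corner of copy 0. This shows
that `desingHom` does not decrease the norm, and it is the intertwining relation on L_Q. -/
theorem lift_dilation_desingHom {S T : Q.E → LpOp p μ} {E : Q.V → LpOp p μ}
    (h : IsCKFamily Q S T E) (x : Leavitt Q) :
    Leavitt.lift (h.dilation hp hn hp2) (desingHom hn x) = cornerHom hp (Leavitt.lift h x) := by
  have hs : ∀ a, Leavitt.lift (h.dilation hp hn hp2) (Leavitt.s a) = _ :=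
    fun a => Leavitt.lift_gen _ _
  have ht : ∀ a, Leavitt.lift (h.dilation hp hn hp2) (Leavitt.t a) = _ :=
    fun a => Leavitt.lift_gen _ _
  have he : ∀ v, Leavitt.lift (h.dilation hp hn hp2) (Leavitt.e v) = _ :=
    fun a => Leavitt.lift_gen _ _
  refine DFunLike.congr_fun (Leavitt.hom_ext
    (f := (Leavitt.lift (h.dilation hp hn hp2)).comp (desingHom hn))
    (g := (cornerHom hp).comp (Leavitt.lift h)) fun y => ?_) x
  rw [NonUnitalAlgHom.comp_apply, NonUnitalAlgHom.comp_apply, Leavitt.lift_gen, cornerHom_apply]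
  cases y with
  | s a =>
    change Leavitt.lift _ (desingHom hn (Leavitt.s a)) = _
    rw [desingHom_s, map_edgeS]
    simp only [hs, he]
    exact edgeS_dil hp hn h.isLeavittFamily a
  | t a =>
    change Leavitt.lift _ (desingHom hn (Leavitt.t a)) = _
    rw [desingHom_t, map_edgeT]
    simp only [ht, he]
    exact edgeT_dil hp hn h.isLeavittFamily a
  | e v =>
    change Leavitt.lift _ (desingHom hn (Leavitt.e v)) = _
    rw [desingHom_e, map_extendZero]
    simp only [he]
    exact extendZero_dilE_zero hp hn h.isLeavittFamily v

theorem lift_of_isRepresentation {φ : Leavitt Q →ₙₐ[ℂ] LpOp p μ}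
    (hφ : Leavitt.IsRepresentation φ) : Leavitt.lift hφ = φ := by
  refine Leavitt.hom_ext fun y => ?_
  refine (Leavitt.lift_gen _ y).trans ?_
  cases y <;> rfl

include hp hp2 in
theorem repNorm_desingHom (x : Leavitt Q) :
    repNorm p (Q.desing n) (desingHom hn x) = repNorm p Q x := by
  refine le_antisymm (repNorm_le p (repNorm_nonneg p Q x) fun X _ μ φ hφ => ?_)
    (repNorm_le p (repNorm_nonneg p _ _) fun X _ μ φ hφ => ?_)
  · exact norm_le_repNorm p (isRepresentation_comp_desingHom hn hp hp2 hφ) x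
  · have h := norm_le_repNorm p
      (Leavitt.isRepresentation_lift (IsCKFamily.dilation hp hn hφ hp2)) (desingHom hn x)
    rw [lift_dilation_desingHom hn hp hp2 hφ, norm_cornerHom] at h
    exact (congrArg (fun f => ‖f x‖) (lift_of_isRepresentation hφ)).ge.trans h

/-- The embedding of the graph algebra of a graph into that of its desingularization. -/
def graphAlgebraHom : GraphAlgebra p Q →ₙₐ[ℂ] GraphAlgebra p (Q.desing n) :=
  AlgCompletion.mapHom (A := NormedLeavitt p Q) (B := NormedLeavitt p (Q.desing n))
    (desingHom hn) (repNorm_desingHom hn hp hp2)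

theorem isometry_graphAlgebraHom :
    Isometry (graphAlgebraHom hn hp hp2 : GraphAlgebra p Q → GraphAlgebra p (Q.desing n)) :=
  AlgCompletion.isometry_mapHom _

end Embedding

/-- Both sides are continuous and agree on the dense image of L_Q. -/
theorem cornerHom_canonicalHom {Q : DirGraph.{u}} {n : Q.E → ℕ} (hn : Function.Injective n)
    {p : ℝ≥0∞} [Fact (1 ≤ p)] (hp : p ≠ ∞) (hp2 : p ≠ 2) {X : Type u} [MeasurableSpace X]
    {μ : Measure X} {S T : Q.E → LpOp p μ} {E : Q.V → LpOp p μ} (h : IsCKFamily Q S T E)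
    (x : GraphAlgebra p Q) : cornerHom hp (canonicalHom h x) =
      canonicalHom (h.dilation hp hn hp2) (graphAlgebraHom hn hp hp2 x) := by
  have h1 : Continuous (cornerHom hp : LpOp p μ → LpOp p (copies μ)) :=
    (AddMonoidHomClass.isometry_of_norm _ (norm_cornerHom hp)).continuous
  have h2 : Continuous (canonicalHom h) := AlgCompletion.continuous_extendFun _
  have h3 : Continuous (canonicalHom (h.dilation hp hn hp2)) :=
    AlgCompletion.continuous_extendFun _
  have h4 := (isometry_graphAlgebraHom (Q := Q) hn hp hp2).continuous
  refine AlgCompletion.induction_on (A := NormedLeavitt p Q) x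
    (P := fun x => cornerHom hp (canonicalHom h x) =
      canonicalHom (h.dilation hp hn hp2) (graphAlgebraHom hn hp hp2 x))
    (isClosed_eq (h1.comp h2) (h3.comp h4)) fun a => ?_
  refine (congrArg (cornerHom hp) (AlgCompletion.extend_of (A := NormedLeavitt p Q) _ _ a)).trans ?_
  refine (lift_dilation_desingHom hn hp hp2 h a).symm.trans ?_
  refine Eq.trans ?_ (congrArg (canonicalHom (h.dilation hp hn hp2))
    (AlgCompletion.mapHom_of (A := NormedLeavitt p Q) (B := NormedLeavitt p (Q.desing n))
      (f := desingHom hn) (repNorm_desingHom hn hp hp2) a).symm)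
  exact (AlgCompletion.extend_of (A := NormedLeavitt p (Q.desing n)) _ _ _).symm

end LpGraph

end

theorem mainTheorem9 (p : ENNReal) [Fact (1 ≤ p)] (hp_top : p ≠ ⊤) (hp_two : p ≠ 2)
    (Q : LpGraph.DirGraph.{u}) (hQ : Q.IsCountable)
    (X : Type u) [MeasurableSpace X] (μ : MeasureTheory.Measure X)
    (hμ : LpGraph.IsLocalizable μ)
    (S T : Q.E → LpGraph.LpOp p μ) (E : Q.V → LpGraph.LpOp p μ)
    (hSTE : LpGraph.IsCKFamily Q S T E) :
    ∃ Q' : LpGraph.DirGraph.{u},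
      Q'.IsCountable ∧
      (∀ v, ¬ Q'.IsSource v ∧ ¬ Q'.IsSink v ∧ ¬ Q'.IsInfiniteEmitter v ∧
        ¬ Q'.IsInfiniteReceiver v) ∧
      (Q.EveryCycleHasEntry → Q'.EveryCycleHasEntry) ∧
      ∃ (Y : Type u) (mY : MeasurableSpace Y) (ν : @MeasureTheory.Measure Y mY),
        LpGraph.IsLocalizable ν ∧
        ∃ (S' T' : Q'.E → LpGraph.LpOp p ν) (E' : Q'.V → LpGraph.LpOp p ν)
          (hSTE' : LpGraph.IsCKFamily Q' S' T' E')
          (φ : LpGraph.GraphAlgebra p Q →ₙₐ[ℂ] LpGraph.GraphAlgebra p Q')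
          (σ : LpGraph.LpOp p μ →ₙₐ[ℂ] LpGraph.LpOp p ν),
          Isometry φ ∧ Isometry σ ∧
          (∃ (i : MeasureTheory.Lp ℂ p μ →L[ℂ] MeasureTheory.Lp ℂ p ν)
            (j : MeasureTheory.Lp ℂ p ν →L[ℂ] MeasureTheory.Lp ℂ p μ),
            (∀ ξ, ‖i ξ‖ = ‖ξ‖) ∧ ‖j‖ ≤ 1 ∧ j.comp i = ContinuousLinearMap.id ℂ _ ∧
            LpGraph.IsHermitianIdempotent (i.comp j : LpGraph.LpOp p ν) ∧
            ∀ d : LpGraph.LpOp p μ, σ d = i.comp (ContinuousLinearMap.comp d j)) ∧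
          ∀ x : LpGraph.GraphAlgebra p Q,
            σ (LpGraph.canonicalHom hSTE x) = LpGraph.canonicalHom hSTE' (φ x) := by
  have := hQ.2
  -- Countability of the edges provides the numbering that fixes the levels at which they are
  -- attached.
  obtain ⟨n, hn⟩ := exists_injective_nat Q.E
  exact ⟨Q.desing n, LpGraph.DirGraph.desing_isCountable hQ,
    LpGraph.DirGraph.desing_nonsingular hn, LpGraph.DirGraph.desing_everyCycleHasEntry hn,
    Σ _ : ℤ, X, inferInstance, LpGraph.copies μ, hμ.copies,
    LpGraph.dilS hp_top hn S T E, LpGraph.dilT hp_top hn S T E, LpGraph.dilE hp_top hn S T E,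
    hSTE.dilation hp_top hn hp_two, LpGraph.graphAlgebraHom hn hp_top hp_two,
    LpGraph.cornerHom hp_top, LpGraph.isometry_graphAlgebraHom hn hp_top hp_two,
    AddMonoidHomClass.isometry_of_norm _ (LpGraph.norm_cornerHom hp_top),
    ⟨LpGraph.ofCopy hp_top 0, LpGraph.toCopy hp_top 0, LpGraph.norm_ofCopy hp_top 0,
      LpGraph.norm_toCopy_le hp_top 0,
      ContinuousLinearMap.ext fun ξ => LpGraph.toCopy_ofCopy hp_top 0 ξ,
      (LpGraph.isLpProj_ofCopy_comp_toCopy hp_top 0).isHermitianIdempotent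
        (LpGraph.toReal_pos_of_fact hp_top), fun _ => rfl⟩,
    LpGraph.cornerHom_canonicalHom hn hp_top hp_two hSTE⟩
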